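/- Let $(\Omega,\mathfrak W,\mathbb P)$ be a probability space with a diffusive Markov structure: a densely defined, symmetric, closed form $\mathcal E(f,g)=\mathbb E[\Gamma[f,g]]$ on a domain $\mathcal D(\mathcal E)\subset L^2(\mathbb P)$, where the carré du champ $\Gamma:\mathcal D(\mathcal E)\times\mathcal D(\mathcal E)\to L^1(\mathbb P)$ is bilinear and symmetric, $\Gamma[f,f]\ge 0$, and the chain rule holds: for $f_1,\dots,f_k\in\mathcal D(\mathcal E)$ and every smooth Lipschitz $\psi:\mathbb R^k\to\mathbb R$ one has $\psi(f_1,\dots,f_k)\in\mathcal D(\mathcal E)$ and $\Gamma[\psi(f_1,\dots,f_k),g]=\sum_i\partial_i\psi(f_1,\dots,f_k)\,\Gamma[f_i,g]$ for all $g\in\mathcal D(\mathcal E)$ ($k=0$, i.e. constants, included). Let $\mathsf L$ be its generator: $f\in\operatorname{dom}\mathsf L$ if and only if $f\in\mathcal D(\mathcal E)$ and there is $\mathsf Lf\in L^2(\mathbb P)$ with $\mathbb E[\Gamma[f,g]]=-\mathbb E[g\,\mathsf Lf]$ for all $g\in\mathcal D(\mathcal E)$. For a matrix $A$ let $|A|$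 be its Hilbert–Schmidt norm and $\|A\|_{op}$ its operator norm with respect to the Euclidean norm $|\cdot|$. For a random vector or matrix $Y$ put $\|Y\|_{L^p}=\mathbb E[|Y|^p]^{1/p}\in[0,\infty]$. Let $\mathbf W_p(X,Y)=\inf\{\mathbb E[|X'-Y'|^p]^{1/p}:X'\overset{law}{=}X,\ Y'\overset{law}{=}Y\}$ and $\mathbf{TV}(X,Y)=\sup_B(\mathbb P(X\in B)-\mathbb P(Y\in B))$, where $B$ runs over the Borel subsets of $\mathbb R$. For vectors, $\Gamma[F,G]_{ij}=\Gamma[F_i,G_j]$. **Theorem 2.1.** (i) Let $d\in\mathbb N$, $1\le p<\infty$, $F_1,\dots,F_d\in\operatorname{dom}\mathsf L$, $Z_1,\dots,Z_d\in L^p(\mathbb P)$, and assume that the components $X_i=\mathsf LF_i+Z_i$ of $X$ belong to $\mathcal D(\mathcal E)$, so that $\Gamma[X,-F]$ is defined. Let $\Sigma$ be a symmetric positive definite $d\times d$ matrix, $C=\Sigma^2$, and let $N$ be a standard Gaussian vector in $\mathbb R^d$. Then $$\mathbf W_p(X,\Sigma N)\le\|\Sigma\|_{op}\,\|N\|_{L^p}\,\|\mathrm{id}-\Sigma^{-1}\Gamma[X,-F]\Sigma^{-1}\|_{L^p}+\|Z\|_{L^p}\le\|\Sigma\|_{op}\,\|C^{-1}\|_{op}\,\|N\|_{L^p}\,\|C-\Gamma[X,-F]\|_{L^p}+\|Z\|_{L^p}.$$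 (ii) In dimension $d=1$, let $F\in\operatorname{dom}\mathsf L$, $Z\in L^1(\mathbb P)$, $X=\mathsf LF+Z\in\mathcal D(\mathcal E)$, $\sigma>0$ and let $N$ be a standard Gaussian variable. Then $$\mathbf{TV}(X,\sigma N)=\mathbf{TV}(\sigma^{-1}X,N)\le\frac{2}{\sigma^2}\,\|\sigma^2-\Gamma[X,-F]\|_{L^1}+\frac{\sqrt\pi}{2\sigma}\,\|Z\|_{L^1}.$$ -/

import Mathlib

open MeasureTheory ProbabilityTheory Filter Topology
open scoped ENNReal

noncomputable section

/-- A (symmetric, conservative) diffusive Markov structure on a probability space `(Ω, P)` with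
carré du champ `Γ`, that is, a Dirichlet form `𝓔(f, g) = ∫ Γ[f, g] dP` on `L²(P)` of diffusion type:
a densely defined, symmetric, nonnegative and closed form which satisfies the chain rule.
The chain rule contains the stability of the domain under smooth Lipschitz functions, which together
with the closedness is the Markov property; with `k = 0` it says that constants are in the domain
and that `Γ[1, ·] = 0`. -/
structure DiffusiveMarkov {Ω : Type*} [MeasurableSpace Ω] (P : Measure Ω)
    [IsProbabilityMeasure P] where
  /-- the domain of the Dirichlet form -/
  domE : Submodule ℝ (Lp ℝ 2 P)
  /-- the carré du champ -/
  Γ : domE →ₗ[ℝ] domE →ₗ[ℝ] Lp ℝ 1 P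
  dense_domE : Dense (domE : Set (Lp ℝ 2 P))
  symm : ∀ f g : domE, Γ f g = Γ g f
  nonneg : ∀ f : domE, 0 ≤ Γ f f
  closed : ∀ (u : ℕ → domE) (f : Lp ℝ 2 P),
    Tendsto (fun n => (u n : Lp ℝ 2 P)) atTop (𝓝 f) →
    (∀ ε > 0, ∃ n₀, ∀ m ≥ n₀, ∀ n ≥ n₀, ∫ ω, Γ (u m - u n) (u m - u n) ω ∂P < ε) →
    ∃ g : domE, (g : Lp ℝ 2 P) = f ∧
      Tendsto (fun n => ∫ ω, Γ (u n - g) (u n - g) ω ∂P) atTop (𝓝 0)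
  chain_rule : ∀ (k : ℕ) (f : Fin k → domE) (ψ : (Fin k → ℝ) → ℝ),
    ContDiff ℝ (⊤ : ℕ∞) ψ → (∃ K, LipschitzWith K ψ) →
    ∃ h : domE, ((h : Lp ℝ 2 P) : Ω → ℝ) =ᵐ[P] (fun ω => ψ fun i => (f i : Lp ℝ 2 P) ω) ∧
      ∀ g : domE, (Γ h g : Ω → ℝ) =ᵐ[P] fun ω =>
        ∑ i, fderiv ℝ ψ (fun j => (f j : Lp ℝ 2 P) ω) (Pi.single i 1) * Γ (f i) g ω

namespace DiffusiveMarkov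

variable {Ω : Type*} [MeasurableSpace Ω] {P : Measure Ω} [IsProbabilityMeasure P]

/-- The Dirichlet form `𝓔(f, g) = ∫ Γ[f, g] dP`. -/
def energy (D : DiffusiveMarkov P) (f g : D.domE) : ℝ := ∫ ω, D.Γ f g ω ∂P

theorem energy_add_left (D : DiffusiveMarkov P) (f f' g : D.domE) :
    D.energy (f + f') g = D.energy f g + D.energy f' g := by
  simp only [energy, map_add, LinearMap.add_apply]
  rw [integral_congr_ae (Lp.coeFn_add _ _)]
  exact integral_add (L1.integrable_coeFn _) (L1.integrable_coeFn _)

theorem energy_smul_left (D : DiffusiveMarkov P) (c : ℝ) (f g : D.domE) :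
    D.energy (c • f) g = c * D.energy f g := by
  simp only [energy, map_smul, LinearMap.smul_apply]
  rw [integral_congr_ae (Lp.coeFn_smul _ _)]
  simp [integral_const_mul]

/-- The domain of the generator: the `f` in the domain of the form for which there is `u ∈ L²(P)`
with `𝓔(f, g) = - ∫ u g dP` for all `g` in the domain of the form. -/
def domL (D : DiffusiveMarkov P) : Submodule ℝ D.domE where
  carrier := {f | ∃ u : Lp ℝ 2 P, ∀ g : D.domE, D.energy f g = -inner ℝ u (g : Lp ℝ 2 P)}
  add_mem' := by
    rintro f f' ⟨u, hu⟩ ⟨u', hu'⟩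
    refine ⟨u + u', fun g => ?_⟩
    rw [energy_add_left, hu, hu', inner_add_left]
    ring
  zero_mem' := ⟨0, fun g => by simpa using D.energy_smul_left 0 0 g⟩
  smul_mem' := by
    rintro c f ⟨u, hu⟩
    refine ⟨c • u, fun g => ?_⟩
    rw [energy_smul_left, hu, real_inner_smul_left]
    ring

theorem generator_unique (D : DiffusiveMarkov P) {u v : Lp ℝ 2 P}
    (h : ∀ g : D.domE, inner ℝ u (g : Lp ℝ 2 P) = inner ℝ v (g : Lp ℝ 2 P)) : u = v :=
  D.dense_domE.eq_of_inner_left ℝ fun g hg => h ⟨g, hg⟩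

/-- The generator `L`, the unique operator with `∫ Γ[f, g] dP = - ∫ (L f) g dP`. -/
def L (D : DiffusiveMarkov P) : D.domL →ₗ[ℝ] Lp ℝ 2 P where
  toFun f := f.2.choose
  map_add' f f' := by
    refine D.generator_unique fun g => ?_
    rw [inner_add_left]
    have h := (f + f').2.choose_spec g
    have h1 := f.2.choose_spec g
    have h2 := f'.2.choose_spec g
    have e : D.energy (f + f' : D.domL) g = _ := D.energy_add_left f f' g
    linarith
  map_smul' c f := by
    refine D.generator_unique fun g => ?_
    rw [real_inner_smul_left]
    have h := (c • f).2.choose_spec g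
    have h1 := f.2.choose_spec g
    have e : D.energy (c • f : D.domL) g = _ := D.energy_smul_left c f g
    rw [h1] at e
    simp only [RingHom.id_apply]
    linarith

theorem energy_eq_neg_inner_L (D : DiffusiveMarkov P) (f : D.domL) (g : D.domE) :
    D.energy f g = -inner ℝ (D.L f) (g : Lp ℝ 2 P) :=
  f.2.choose_spec g

/-- The matrix-valued carré du champ `Γ[F, G]ᵢⱼ = Γ[Fᵢ, Gⱼ]`. -/
def gammaMatrix (D : DiffusiveMarkov P) {d : ℕ} (F G : Fin d → D.domE) (ω : Ω) :
    Matrix (Fin d) (Fin d) ℝ :=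
  Matrix.of fun i j => D.Γ (F i) (G j) ω

end DiffusiveMarkov

/-- The `p`-Wasserstein distance `inf (∫ |x - y|^p dπ)^{1/p}` of two laws, the infimum being over all
couplings `π`. -/
def wassersteinDist {E : Type*} [NormedAddCommGroup E] [MeasurableSpace E]
    (p : ℝ) (μ ν : Measure E) : ℝ≥0∞ :=
  ⨅ (π : Measure (E × E)) (_ : π.map Prod.fst = μ) (_ : π.map Prod.snd = ν),
    (∫⁻ z, ‖z.1 - z.2‖ₑ ^ p ∂π) ^ (1 / p)

/-- The total variation distance `sup_B (μ B - ν B)`, the supremum being over Borel sets `B`.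
The truncation of the subtraction is harmless, since `B = ∅` gives the value `0`. -/
def tvDist (μ ν : Measure ℝ) : ℝ≥0∞ :=
  ⨆ (B : Set ℝ) (_ : MeasurableSet B), (μ B - ν B)

/-- The operator norm of a matrix with respect to the Euclidean norm. -/
def opNorm {d : ℕ} (A : Matrix (Fin d) (Fin d) ℝ) : ℝ :=
  ‖Matrix.toEuclideanCLM (n := Fin d) (𝕜 := ℝ) A‖

/-- The Euclidean (Hilbert–Schmidt) norm of a matrix. -/
def hsNorm {d : ℕ} (A : Matrix (Fin d) (Fin d) ℝ) : ℝ :=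
  Real.sqrt (∑ i, ∑ j, A i j ^ 2)

end

/-! Wasserstein bound. Put `A = Γ[X, -F]`. Pairing `L F` with functions of `X` and using the chain
rule gives the Stein identity `E[k(X)⟪X,w⟫] = E[k(X)⟪Z,w⟫] + E[Dk(X)(A w)]` for smooth compactly
supported `k` (`compactSteinIdentity`). Normalised by `Σ⁻¹` and truncated smoothly, it becomes an
identity of the same type for a bounded vector `V`, with a remainder `Y` close to `Σ⁻¹ Z` and a
kernel `T` close to `Σ⁻¹ A Σ⁻¹` (`CompactSteinIdentity.truncate`).

Let `N` be an independent standard Gaussian vector and `U_l = l V + N`. The field `b_l(u) = E[V |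
U_l = u]` is an explicit quotient of Gaussian-weighted integrals, and it is bounded and Lipschitz
because `V` is bounded. Its flow, started from the law of `N` at time `0`, has the law of `U_l` at
time `l` (`exists_flow_condField`). Divided by `√(1 + l²)`, the flow joins `N` at `l = 0` to `V` at
`l = ∞`, hence yields a coupling. Its velocity is `(1 + l²)^(-3/2)` times `(1 + l²) b_l(u) - l u`.
By the Stein identity and Gaussian integration by parts the latter is the conditional expectation of
`Y + l (T* N - N)` given `U_l = u` (`integral_smul_rescaledVelocity`). Jensen's inequality bounds
its `L^p` norm, after application of `Σ`, by `a + l b`, where `a` and `b` are the norms of `Σ Y` and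
`Σ (T* N - N)`. Since `∫₀^∞ (1 + l²)^(-3/2) (a + l b) dl = a + b`, Minkowski's inequality gives
`wassersteinDist_le_of_steinIdentity`. Independence of `T` and `N` separates their norms, and the
truncation is removed last.

That the flow transports the laws is proved by hand: one Euler step of size `h` carries the law of
`U_l` to that of `U_(l+h)` up to `O(h²)` when tested against functions with Lipschitz derivative.
The test functions that arise by composition with Euler maps are only Lipschitz, so they are
mollified; the number of steps tends to infinity first, and the mollification radius to zero
afterwards.

Total variation bound. This is Stein's method: for smooth `h` with values in `[0, 1]` the equation
`f' - x f = h - E h(N)` has a smooth solution with `|f| ≤ √π / 2` and `|f'| ≤ 2`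
(`exists_stein_solution`). Inserting `X / σ` and integrating by parts turns the difference of
expectations into `E[f' σ⁻² (σ² - Γ)] - σ⁻¹ E[f Z]`. -/

set_option linter.unusedSectionVars false

/-! ### Density, translation and integration by parts for the standard Gaussian measure -/

section GaussianDensity

open scoped RealInnerProductSpace

variable {E : Type*} [NormedAddCommGroup E] [InnerProductSpace ℝ E] [FiniteDimensional ℝ E]
  [MeasurableSpace E] [BorelSpace E]

variable (E) in
/-- The normalising constant of the standard Gaussian density. -/
noncomputable def stdGaussianConst : ℝ := (∫ x : E, Real.exp (-(1 / 2) * ‖x‖ ^ 2))⁻¹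

/-- The density of the standard Gaussian measure. -/
noncomputable def stdGaussianPDFReal (x : E) : ℝ :=
  stdGaussianConst E * Real.exp (-(1 / 2) * ‖x‖ ^ 2)

theorem integrable_exp_neg_half_sq :
    Integrable fun x : E => Real.exp (-(1 / 2) * ‖x‖ ^ 2) := by
  have h := GaussianFourier.integrable_cexp_neg_mul_sq_norm_add (V := E) (b := 1 / 2)
    (by norm_num) 0 0
  have h2 := h.re
  refine h2.congr (Eventually.of_forall fun x => ?_)
  simp only [zero_mul, add_zero]
  rw [show (-(1 / 2 : ℂ) * (‖x‖ : ℂ) ^ 2) = ((-(1 / 2) * ‖x‖ ^ 2 : ℝ) : ℂ) by push_cast; ring,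
    ← Complex.ofReal_exp]
  rfl

theorem stdGaussianConst_pos : 0 < stdGaussianConst E := by
  rw [stdGaussianConst, inv_pos]
  exact integral_exp_pos integrable_exp_neg_half_sq

theorem stdGaussianPDFReal_nonneg (x : E) : 0 ≤ stdGaussianPDFReal x :=
  mul_nonneg stdGaussianConst_pos.le (Real.exp_pos _).le

theorem integrable_stdGaussianPDFReal : Integrable (stdGaussianPDFReal (E := E)) :=
  integrable_exp_neg_half_sq.const_mul _

@[fun_prop]
theorem measurable_stdGaussianPDFReal : Measurable (stdGaussianPDFReal (E := E)) := by
  unfold stdGaussianPDFReal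
  fun_prop

/-- Both sides have the same characteristic function. The Fourier integral of the unnormalised
density is used twice: at frequency `t`, and at frequency `0` to evaluate the normalising constant.
-/
theorem stdGaussian_eq_withDensity :
    stdGaussian E = volume.withDensity fun x => ENNReal.ofReal (stdGaussianPDFReal x) := by
  have : IsFiniteMeasure (volume.withDensity fun x : E => ENNReal.ofReal (stdGaussianPDFReal x)) :=
    isFiniteMeasure_withDensity_ofReal integrable_stdGaussianPDFReal.2
  apply Measure.ext_of_charFun
  ext t
  rw [charFun_stdGaussian, charFun_apply, integral_withDensity_eq_integral_toReal_smul (by fun_prop)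
    (by simp)]
  have h1 := GaussianFourier.integral_cexp_neg_mul_sq_norm_add (V := E) (b := 1 / 2)
    (by norm_num) Complex.I t
  have h0 := GaussianFourier.integral_cexp_neg_mul_sq_norm_add (V := E) (b := 1 / 2)
    (by norm_num) 0 0
  have hc : ((stdGaussianConst E)⁻¹ : ℂ) =
      (Real.pi / (1 / 2 : ℂ)) ^ (Module.finrank ℝ E / 2 : ℂ) := by
    simp only [zero_mul, add_zero, ne_eq, OfNat.ofNat_ne_zero, not_false_eq_true, zero_pow,
      zero_div, Complex.exp_zero, mul_one] at h0
    rw [← h0, ← Complex.ofReal_inv, stdGaussianConst, inv_inv, ← integral_complex_ofReal]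
    congr 1
    ext x
    push_cast
    rfl
  have hne : (stdGaussianConst E : ℂ) ≠ 0 := by exact_mod_cast stdGaussianConst_pos.ne'
  have e : ∀ x : E, (ENNReal.ofReal (stdGaussianPDFReal x)).toReal •
      Complex.exp ((⟪x, t⟫ : ℂ) * Complex.I) = (stdGaussianConst E : ℂ) *
        Complex.exp (-(1 / 2) * (‖x‖ : ℂ) ^ 2 + Complex.I * (⟪t, x⟫ : ℂ)) := by
    intro x
    rw [ENNReal.toReal_ofReal (stdGaussianPDFReal_nonneg x), stdGaussianPDFReal, Complex.exp_add,
      Complex.real_smul, real_inner_comm]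
    push_cast
    ring_nf
  simp_rw [e]
  rw [integral_const_mul, h1, ← hc, ← mul_assoc, mul_inv_cancel₀ hne, one_mul]
  congr 1
  rw [Complex.I_sq]
  ring

theorem integral_stdGaussian {F : Type*} [NormedAddCommGroup F] [NormedSpace ℝ F] (f : E → F) :
    ∫ x, f x ∂(stdGaussian E) = ∫ x, stdGaussianPDFReal x • f x := by
  rw [stdGaussian_eq_withDensity, integral_withDensity_eq_integral_toReal_smul (by fun_prop)
    (by simp)]
  simp_rw [ENNReal.toReal_ofReal (stdGaussianPDFReal_nonneg _)]

/-- The density of a shifted standard Gaussian measure with respect to the unshifted one. -/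
theorem stdGaussian_map_add_right (w : E) :
    (stdGaussian E).map (· + w) = (stdGaussian E).withDensity fun x =>
      ENNReal.ofReal (Real.exp (⟪x, w⟫ - ‖w‖ ^ 2 / 2)) := by
  apply Measure.ext_of_lintegral
  intro f hf
  rw [lintegral_map hf (by fun_prop), stdGaussian_eq_withDensity,
    lintegral_withDensity_eq_lintegral_mul _ (by fun_prop) (by fun_prop),
    ← withDensity_mul _ (by fun_prop) (by fun_prop),
    lintegral_withDensity_eq_lintegral_mul _ (by fun_prop) (by fun_prop),
    ← lintegral_sub_right_eq_self _ w]
  refine lintegral_congr fun x => ?_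
  simp only [Pi.mul_apply, sub_add_cancel]
  rw [← ENNReal.ofReal_mul (stdGaussianPDFReal_nonneg _)]
  congr 2
  rw [stdGaussianPDFReal, stdGaussianPDFReal, mul_assoc, ← Real.exp_add,
    norm_sub_sq_real]
  ring_nf

theorem integral_stdGaussian_add_right {F : Type*} [NormedAddCommGroup F] [NormedSpace ℝ F]
    (f : E → F) (w : E) :
    ∫ x, f (x + w) ∂(stdGaussian E) =
      ∫ x, Real.exp (⟪x, w⟫ - ‖w‖ ^ 2 / 2) • f x ∂(stdGaussian E) := by
  have h := integral_map_equiv (μ := stdGaussian E) (MeasurableEquiv.addRight w) f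
  simp only [MeasurableEquiv.coe_addRight] at h
  rw [← h, stdGaussian_map_add_right, integral_withDensity_eq_integral_toReal_smul (by fun_prop)
    (by simp)]
  simp_rw [ENNReal.toReal_ofReal (Real.exp_pos _).le]

theorem integrable_exp_inner_stdGaussian (w : E) :
    Integrable (fun x => Real.exp (⟪x, w⟫ - ‖w‖ ^ 2 / 2)) (stdGaussian E) := by
  -- Without integrability the Bochner integral of the weight would be `0` by convention, whereas
  -- translating the constant function `1` shows that it is `1`.
  by_contra h
  have h1 := integral_stdGaussian_add_right (fun _ : E => (1 : ℝ)) w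
  simp only [smul_eq_mul, mul_one] at h1
  rw [integral_undef h] at h1
  simp at h1

theorem integral_exp_inner_stdGaussian (w : E) :
    ∫ x, Real.exp (⟪x, w⟫ - ‖w‖ ^ 2 / 2) ∂(stdGaussian E) = 1 := by
  have h1 := integral_stdGaussian_add_right (fun _ : E => (1 : ℝ)) w
  simpa using h1.symm

theorem hasFDerivAt_stdGaussianPDFReal (x : E) :
    HasFDerivAt (stdGaussianPDFReal (E := E))
      (-(stdGaussianPDFReal x) • innerSL ℝ x) x := by
  have h := ((hasStrictFDerivAt_norm_sq x).hasFDerivAt.const_mul (-(1 / 2 : ℝ))).exp.const_mul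
    (stdGaussianConst E)
  refine h.congr_fderiv ?_
  ext y
  simp [stdGaussianPDFReal]
  ring

/-- Gaussian integration by parts. -/
theorem integral_fderiv_stdGaussian {f : E → ℝ} (hf : ContDiff ℝ (⊤ : ℕ∞) f)
    (hc : HasCompactSupport f) (z : E) :
    ∫ x, fderiv ℝ f x z ∂(stdGaussian E) = ∫ x, f x * ⟪x, z⟫ ∂(stdGaussian E) := by
  have hd : ∀ x : E, fderiv ℝ (stdGaussianPDFReal (E := E)) x z = - stdGaussianPDFReal x * ⟪x, z⟫ := by
    intro x
    rw [(hasFDerivAt_stdGaussianPDFReal x).fderiv]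
    simp
  have hcont : Continuous (stdGaussianPDFReal (E := E)) :=
    continuous_iff_continuousAt.2 fun x => (hasFDerivAt_stdGaussianPDFReal x).continuousAt
  have hf' : Continuous fun x => fderiv ℝ f x z :=
    (hf.continuous_fderiv (by simp)).clm_apply continuous_const
  have hfc := hf.continuous
  rw [integral_stdGaussian, integral_stdGaussian]
  simp only [smul_eq_mul]
  rw [integral_mul_fderiv_eq_neg_fderiv_mul_of_integrable]
  · simp_rw [hd]
    rw [← integral_neg]
    congr 1
    ext x
    ring
  · simp_rw [hd]
    apply Continuous.integrable_of_hasCompactSupport (by fun_prop)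
    exact hc.mul_left
  · apply Continuous.integrable_of_hasCompactSupport (by fun_prop)
    exact (hc.fderiv_apply (𝕜 := ℝ) z).mul_left
  · apply Continuous.integrable_of_hasCompactSupport (by fun_prop)
    exact hc.mul_left
  · exact fun x _ => (hasFDerivAt_stdGaussianPDFReal x).differentiableAt
  · exact fun x _ => (hf.differentiable (by simp)) x

end GaussianDensity

/-! ### The conditional expectation field of a bounded vector observed with Gaussian noise -/

section CondField

open scoped RealInnerProductSpace

variable {E : Type*} [NormedAddCommGroup E] [InnerProductSpace ℝ E]

/-- The density of the law of `l • v + N` with respect to the law of `N`, for `N` a standard Gaussian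
vector. -/
noncomputable def shiftWeight (l : ℝ) (u v : E) : ℝ :=
  Real.exp (⟪u, l • v⟫ - ‖l • v‖ ^ 2 / 2)

theorem shiftWeight_pos (l : ℝ) (u v : E) : 0 < shiftWeight l u v := Real.exp_pos _

theorem continuous_shiftWeight :
    Continuous fun x : ℝ × E × E => shiftWeight x.1 x.2.1 x.2.2 := by
  unfold shiftWeight
  fun_prop

theorem shiftWeight_le {l R : ℝ} {u v : E} (hv : ‖v‖ ≤ R) :
    shiftWeight l u v ≤ Real.exp (|l| * R * ‖u‖) := by
  refine Real.exp_le_exp.2 ?_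
  have h1 : ⟪u, l • v⟫ ≤ ‖u‖ * ‖l • v‖ := real_inner_le_norm _ _
  have h2 : ‖l • v‖ ≤ |l| * R := by
    rw [norm_smul, Real.norm_eq_abs]
    gcongr
  have h3 : ‖u‖ * ‖l • v‖ ≤ ‖u‖ * (|l| * R) := by gcongr
  nlinarith [sq_nonneg ‖l • v‖]

variable [FiniteDimensional ℝ E] [MeasurableSpace E] [BorelSpace E]

/-- The conditional expectation of `V` given `l • V + N = u`, where `V` has law `μ` and `N` is an
independent standard Gaussian vector. -/
noncomputable def condField (μ : Measure E) (l : ℝ) (u : E) : E :=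
  (∫ v, shiftWeight l u v ∂μ)⁻¹ • ∫ v, shiftWeight l u v • v ∂μ

variable {μ : Measure E} [IsProbabilityMeasure μ] {R : ℝ}

theorem integrable_shiftWeight (hμ : ∀ᵐ v ∂μ, ‖v‖ ≤ R) (l : ℝ) (u : E) :
    Integrable (shiftWeight l u) μ := by
  have hc : Continuous (shiftWeight l u) :=
    continuous_shiftWeight.comp (by fun_prop : Continuous fun v : E => (l, u, v))
  refine Integrable.of_bound hc.aestronglyMeasurable (Real.exp (|l| * R * ‖u‖)) ?_
  filter_upwards [hμ] with v hv
  rw [Real.norm_eq_abs, abs_of_pos (shiftWeight_pos _ _ _)]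
  exact shiftWeight_le hv

theorem integrable_shiftWeight_smul {F : Type*} [NormedAddCommGroup F] [NormedSpace ℝ F]
    (hμ : ∀ᵐ v ∂μ, ‖v‖ ≤ R) (l : ℝ) (u : E) {f : E → F} {C : ℝ}
    (hf : AEStronglyMeasurable f μ) (hC : ∀ᵐ v ∂μ, ‖f v‖ ≤ C) :
    Integrable (fun v => shiftWeight l u v • f v) μ :=
  (integrable_shiftWeight hμ l u).smul_of_top_left (memLp_top_of_bound hf C hC)

theorem integral_shiftWeight_pos (hμ : ∀ᵐ v ∂μ, ‖v‖ ≤ R) (l : ℝ) (u : E) :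
    0 < ∫ v, shiftWeight l u v ∂μ :=
  integral_exp_pos (integrable_shiftWeight hμ l u)

/-- The weights divided by their integral form a probability density, so an average against them
obeys every almost sure bound. -/
theorem integral_shiftWeight_smul_le {F : Type*} [NormedAddCommGroup F] [NormedSpace ℝ F]
    (hμ : ∀ᵐ v ∂μ, ‖v‖ ≤ R) (l : ℝ) (u : E) {f : E → F} {C : ℝ}
    (hC : ∀ᵐ v ∂μ, ‖f v‖ ≤ C) :
    ‖(∫ v, shiftWeight l u v ∂μ)⁻¹ • ∫ v, shiftWeight l u v • f v ∂μ‖ ≤ C := by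
  have hp := integral_shiftWeight_pos hμ l u
  rw [norm_smul, norm_inv, Real.norm_eq_abs, abs_of_pos hp, inv_mul_le_iff₀ hp, ← integral_mul_const]
  refine norm_integral_le_of_norm_le ((integrable_shiftWeight hμ l u).mul_const C) ?_
  filter_upwards [hC] with v hv
  rw [norm_smul, Real.norm_eq_abs, abs_of_pos (shiftWeight_pos _ _ _)]
  exact mul_le_mul_of_nonneg_left hv (shiftWeight_pos _ _ _).le

theorem norm_condField_le (hμ : ∀ᵐ v ∂μ, ‖v‖ ≤ R) (l : ℝ) (u : E) :
    ‖condField μ l u‖ ≤ R :=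
  integral_shiftWeight_smul_le hμ l u hμ

/-- The field is the barycentre of `μ` for the weights at `u`. -/
theorem integral_shiftWeight_smul_sub_condField (hμ : ∀ᵐ v ∂μ, ‖v‖ ≤ R) (l : ℝ) (u : E) :
    ∫ v, shiftWeight l u v • (v - condField μ l u) ∂μ = 0 := by
  have hp := integral_shiftWeight_pos hμ l u
  simp_rw [smul_sub]
  rw [integral_sub (integrable_shiftWeight_smul hμ l u (f := fun v => v) (by fun_prop) hμ)
    ((integrable_shiftWeight hμ l u).smul_const _), integral_smul_const]
  rw [condField, smul_inv_smul₀ hp.ne', sub_self]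

/-- Passing from `u'` to `u` multiplies the weight by `exp ⟪u - u', l • v⟫`. The barycentre identity
at `u` then writes the difference as an average of `(1 - exp ⟪u - u', l • v⟫) • (v - condField μ l
u)` for the weights at `u'`. If `κ = |l| R ‖u' - u‖ ≤ 1`, the two factors are at most `2κ` and `2R`;
if `κ > 1`, the trivial bound `2R` is already enough. -/
theorem norm_condField_sub_le (hμ : ∀ᵐ v ∂μ, ‖v‖ ≤ R) (hR : 0 ≤ R) (l : ℝ) (u u' : E) :
    ‖condField μ l u' - condField μ l u‖ ≤ 4 * R ^ 2 * |l| * ‖u' - u‖ := by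
  set κ : ℝ := |l| * R * ‖u' - u‖ with hκ
  have hκ0 : 0 ≤ κ := by positivity
  have hgoal : 4 * R ^ 2 * |l| * ‖u' - u‖ = 4 * R * κ := by rw [hκ]; ring
  rw [hgoal]
  rcases le_or_gt κ 1 with h1 | h1
  · have e : condField μ l u' - condField μ l u = (∫ v, shiftWeight l u' v ∂μ)⁻¹ •
        ∫ v, shiftWeight l u' v • ((1 - Real.exp (⟪u - u', l • v⟫)) •
          (v - condField μ l u)) ∂μ := by
      have hp := integral_shiftWeight_pos hμ l u'
      have h2 : ∀ v, shiftWeight l u' v • ((1 - Real.exp (⟪u - u', l • v⟫)) •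
          (v - condField μ l u)) = shiftWeight l u' v • (v - condField μ l u) -
            shiftWeight l u v • (v - condField μ l u) := by
        intro v
        rw [smul_smul, ← sub_smul]
        congr 1
        rw [mul_sub, mul_one, shiftWeight, shiftWeight, ← Real.exp_add, inner_sub_left]
        congr 2
        ring
      have hb : ∀ᵐ v ∂μ, ‖v - condField μ l u‖ ≤ R + R := by
        filter_upwards [hμ] with v hv
        exact (norm_sub_le _ _).trans (add_le_add hv (norm_condField_le hμ l u))
      simp_rw [h2]
      rw [integral_sub (integrable_shiftWeight_smul hμ l u' (by fun_prop) hb)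
        (integrable_shiftWeight_smul hμ l u (by fun_prop) hb),
        integral_shiftWeight_smul_sub_condField hμ, sub_zero]
      simp_rw [smul_sub]
      rw [integral_sub (integrable_shiftWeight_smul hμ l u' (f := fun v => v) (by fun_prop) hμ)
        ((integrable_shiftWeight hμ l u').smul_const _), integral_smul_const, smul_sub,
        inv_smul_smul₀ hp.ne']
      rfl
    rw [e]
    refine integral_shiftWeight_smul_le hμ l u' ?_
    filter_upwards [hμ] with v hv
    have hY : |⟪u - u', l • v⟫| ≤ κ := by
      refine (abs_real_inner_le_norm _ _).trans ?_
      rw [norm_smul, Real.norm_eq_abs, norm_sub_rev]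
      calc ‖u' - u‖ * (|l| * ‖v‖) ≤ ‖u' - u‖ * (|l| * R) := by gcongr
        _ = κ := by rw [hκ]; ring
    have h3 := Real.abs_exp_sub_one_le (hY.trans h1)
    rw [norm_smul, Real.norm_eq_abs, abs_sub_comm]
    have h4 : ‖v - condField μ l u‖ ≤ R + R :=
      (norm_sub_le _ _).trans (add_le_add hv (norm_condField_le hμ l u))
    calc _ ≤ (2 * κ) * (R + R) := by
          gcongr
          linarith
      _ = 4 * R * κ := by ring
  · calc _ ≤ R + R := (norm_sub_le _ _).trans
          (add_le_add (norm_condField_le hμ l u') (norm_condField_le hμ l u))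
      _ ≤ 4 * R * κ := by nlinarith

theorem continuous_integral_shiftWeight_smul {F : Type*} [NormedAddCommGroup F] [NormedSpace ℝ F]
    (hμ : ∀ᵐ v ∂μ, ‖v‖ ≤ R) (hR : 0 ≤ R) {f : E → F} {C : ℝ}
    (hf : AEStronglyMeasurable f μ) (hC : ∀ᵐ v ∂μ, ‖f v‖ ≤ C) :
    Continuous fun x : ℝ × E => ∫ v, shiftWeight x.1 x.2 v • f v ∂μ := by
  rw [continuous_iff_continuousAt]
  rintro ⟨l, u⟩
  -- The dominating constant is valid on the neighbourhood where `|l|` and `‖u‖` grow by less than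
  -- `1`.
  refine continuousAt_of_dominated (bound := fun _ => Real.exp ((|l| + 1) * R * (‖u‖ + 1)) * C)
    ?_ ?_ (integrable_const _) ?_
  · refine Eventually.of_forall fun x => ?_
    exact (continuous_shiftWeight.comp
      (by fun_prop : Continuous fun v : E => (x.1, x.2, v))).aestronglyMeasurable.smul hf
  · have h1 : ∀ᶠ x : ℝ × E in 𝓝 (l, u), |x.1| < |l| + 1 :=
      (by fun_prop : Continuous fun x : ℝ × E => |x.1|).continuousAt.eventually_lt
        continuousAt_const (by simp)
    have h2 : ∀ᶠ x : ℝ × E in 𝓝 (l, u), ‖x.2‖ < ‖u‖ + 1 :=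
      (by fun_prop : Continuous fun x : ℝ × E => ‖x.2‖).continuousAt.eventually_lt
        continuousAt_const (by simp)
    filter_upwards [h1, h2] with x hx1 hx2
    filter_upwards [hμ, hC] with v hv hvC
    rw [norm_smul, Real.norm_eq_abs, abs_of_pos (shiftWeight_pos _ _ _)]
    gcongr
    refine (shiftWeight_le hv).trans (Real.exp_le_exp.2 ?_)
    gcongr
  · refine Eventually.of_forall fun v => ?_
    have := continuous_shiftWeight.comp (by fun_prop : Continuous fun x : ℝ × E => (x.1, x.2, v))
    exact (this.smul continuous_const).continuousAt

theorem continuous_condField (hμ : ∀ᵐ v ∂μ, ‖v‖ ≤ R) (hR : 0 ≤ R) :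
    Continuous fun x : ℝ × E => condField μ x.1 x.2 := by
  have h1 := continuous_integral_shiftWeight_smul hμ hR (f := fun _ => (1 : ℝ)) (C := 1)
    (by fun_prop) (by simp)
  have h2 := continuous_integral_shiftWeight_smul hμ hR (f := fun v => v) (by fun_prop) hμ
  simp only [smul_eq_mul, mul_one] at h1
  exact (h1.inv₀ fun x => (integral_shiftWeight_pos hμ _ _).ne').smul h2

theorem integrable_prod_shiftWeight (l : ℝ) :
    Integrable (fun x : E × E => shiftWeight l x.2 x.1) (μ.prod (stdGaussian E)) := by
  have hc : Continuous fun x : E × E => shiftWeight l x.2 x.1 :=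
    continuous_shiftWeight.comp (by fun_prop : Continuous fun x : E × E => (l, x.2, x.1))
  refine (integrable_prod_iff hc.aestronglyMeasurable).2 ⟨?_, ?_⟩
  · exact Eventually.of_forall fun v => integrable_exp_inner_stdGaussian (l • v)
  · refine (integrable_const (1 : ℝ)).congr (Eventually.of_forall fun v => ?_)
    simp only [Real.norm_eq_abs, abs_of_pos (shiftWeight_pos _ _ _)]
    exact (integral_exp_inner_stdGaussian (l • v)).symm

/-- This is the defining property of the conditional expectation: `V - E[V | U]` is orthogonal to
functions of `U = l • V + N`. Translating the Gaussian variable by `l • v` replaces `U` by `n` at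
the cost of the weight; for fixed `n` the integral over `v` vanishes by the barycentre identity. -/
theorem integral_clm_sub_condField {G : Type*} [NormedAddCommGroup G] [NormedSpace ℝ G]
    [CompleteSpace G]
    (hμ : ∀ᵐ v ∂μ, ‖v‖ ≤ R) (hR : 0 ≤ R) (l : ℝ) {F : E → E →L[ℝ] G} (hF : Continuous F) {M : ℝ}
    (hM : ∀ x, ‖F x‖ ≤ M) :
    ∫ x, F (l • x.1 + x.2) (x.1 - condField μ l (l • x.1 + x.2)) ∂(μ.prod (stdGaussian E)) = 0 := by
  have hb : Continuous (condField μ l) :=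
    (continuous_condField hμ hR).comp (by fun_prop : Continuous fun u : E => (l, u))
  have hM0 : 0 ≤ M := (norm_nonneg _).trans (hM 0)
  have hμ2 : ∀ᵐ x ∂(μ.prod (stdGaussian E)), ‖x.1‖ ≤ R :=
    Measure.quasiMeasurePreserving_fst.ae hμ
  have bound : ∀ᵐ x ∂(μ.prod (stdGaussian E)), ∀ y z, ‖F y (x.1 - condField μ l z)‖ ≤ M * (R + R) := by
    filter_upwards [hμ2] with x hx y z
    refine (ContinuousLinearMap.le_opNorm _ _).trans ?_
    gcongr
    · exact hM _
    · exact (norm_sub_le _ _).trans (add_le_add hx (norm_condField_le hμ l _))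
  have hint : Integrable (fun x : E × E => F (l • x.1 + x.2)
      (x.1 - condField μ l (l • x.1 + x.2))) (μ.prod (stdGaussian E)) := by
    refine Integrable.of_bound (Continuous.aestronglyMeasurable ?_) (M * (R + R)) ?_
    · fun_prop
    · filter_upwards [bound] with x hx using hx _ _
  rw [integral_prod _ hint]
  have e : ∀ v : E, ∫ n, F (l • v + n) (v - condField μ l (l • v + n)) ∂(stdGaussian E) =
      ∫ n, shiftWeight l n v • F n (v - condField μ l n) ∂(stdGaussian E) := by
    intro v
    have := integral_stdGaussian_add_right (fun n => F n (v - condField μ l n)) (l • v)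
    simp_rw [add_comm _ (l • v)] at this
    exact this
  simp_rw [e]
  have hint2 : Integrable (fun x : E × E => shiftWeight l x.2 x.1 •
      F x.2 (x.1 - condField μ l x.2)) (μ.prod (stdGaussian E)) := by
    refine (integrable_prod_shiftWeight l).smul_of_top_left (memLp_top_of_bound
      (Continuous.aestronglyMeasurable ?_) (M * (R + R)) ?_)
    · fun_prop
    · filter_upwards [bound] with x hx using hx _ _
  rw [integral_integral_swap hint2]
  refine integral_eq_zero_of_ae (Eventually.of_forall fun n => ?_)
  have hb' : ∀ᵐ v ∂μ, ‖v - condField μ l n‖ ≤ R + R := by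
    filter_upwards [hμ] with v hv
    exact (norm_sub_le _ _).trans (add_le_add hv (norm_condField_le hμ l n))
  simp_rw [← map_smul]
  rw [ContinuousLinearMap.integral_comp_comm _ (integrable_shiftWeight_smul hμ l n (by fun_prop) hb'),
    integral_shiftWeight_smul_sub_condField hμ, map_zero]
  rfl

end CondField

/-! ### Mollification of Lipschitz functions -/

section Mollify

variable {E : Type*} [NormedAddCommGroup E] [InnerProductSpace ℝ E] [FiniteDimensional ℝ E]
  [MeasurableSpace E] [BorelSpace E]

/-- Mollification of a function by a normalised bump function. -/
noncomputable def mollify (η : ContDiffBump (0 : E)) (g : E → ℝ) (x : E) : ℝ :=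
  ∫ t, η.normed volume t * g (x - t)

theorem integrable_normed_mul (η : ContDiffBump (0 : E)) {g : E → ℝ} (hg : Continuous g) :
    Integrable (fun t => η.normed volume t * g t) (volume : Measure E) :=
  Continuous.integrable_of_hasCompactSupport (η.continuous_normed.mul hg)
    η.hasCompactSupport_normed.mul_right

/-- Averages against a bump function of functions which are close on its support are close. -/
theorem abs_integral_normed_mul_sub_le (η : ContDiffBump (0 : E)) {g g' : E → ℝ}
    (hg : Continuous g) (hg' : Continuous g') {C : ℝ}
    (h : ∀ t, ‖t‖ ≤ η.rOut → |g t - g' t| ≤ C) :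
    |(∫ t, η.normed volume t * g t) - ∫ t, η.normed volume t * g' t| ≤ C := by
  rw [← integral_sub (integrable_normed_mul η hg) (integrable_normed_mul η hg')]
  have h1 : ∫ t : E, η.normed volume t * C = C := by
    rw [integral_mul_const, η.integral_normed, one_mul]
  rw [← h1, ← Real.norm_eq_abs]
  refine norm_integral_le_of_norm_le (η.integrable_normed.mul_const C)
    (Eventually.of_forall fun t => ?_)
  rw [← mul_sub, Real.norm_eq_abs, abs_mul, abs_of_nonneg (η.nonneg_normed t)]
  by_cases ht : ‖t‖ ≤ η.rOut
  · exact mul_le_mul_of_nonneg_left (h t ht) (η.nonneg_normed t)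
  · have : η.normed volume t = 0 := by
      rw [← Function.notMem_support, η.support_normed_eq]
      simpa using (not_le.1 ht).le
    simp [this]

variable {g : E → ℝ} {M : ℝ}

theorem continuous_of_abs_sub_le (hg : ∀ x y, |g x - g y| ≤ M * ‖x - y‖) : Continuous g := by
  refine (LipschitzWith.of_dist_le_mul (K := M.toNNReal) fun x y => ?_).continuous
  rw [Real.dist_eq, dist_eq_norm]
  exact (hg x y).trans (mul_le_mul_of_nonneg_right (Real.le_coe_toNNReal M) (norm_nonneg _))

theorem abs_mollify_sub_le (η : ContDiffBump (0 : E)) (hM : 0 ≤ M)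
    (hg : ∀ x y, |g x - g y| ≤ M * ‖x - y‖) (x : E) :
    |mollify η g x - g x| ≤ M * η.rOut := by
  have hc := continuous_of_abs_sub_le hg
  have := abs_integral_normed_mul_sub_le η (g := fun t => g (x - t)) (g' := fun _ => g x)
    (C := M * η.rOut) (by fun_prop) (by fun_prop) (fun t ht => (hg _ _).trans (by
      rw [sub_sub_cancel_left, norm_neg]; gcongr))
  rwa [integral_mul_const, η.integral_normed, one_mul] at this

theorem abs_mollify_le (η : ContDiffBump (0 : E)) (hg : Continuous g) {B : ℝ}
    (hB : ∀ x, |g x| ≤ B) (x : E) : |mollify η g x| ≤ B := by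
  have := abs_integral_normed_mul_sub_le η (g := fun t => g (x - t)) (g' := fun _ => 0)
    (C := B) (by fun_prop) (by fun_prop) (fun t ht => by simpa using hB _)
  simpa [mollify] using this

theorem abs_mollify_sub_mollify_le (η : ContDiffBump (0 : E))
    (hg : ∀ x y, |g x - g y| ≤ M * ‖x - y‖) (x y : E) :
    |mollify η g x - mollify η g y| ≤ M * ‖x - y‖ := by
  have hc := continuous_of_abs_sub_le hg
  refine abs_integral_normed_mul_sub_le η (g := fun t => g (x - t)) (g' := fun t => g (y - t))
    (by fun_prop) (by fun_prop) (fun t _ => (hg _ _).trans_eq (by congr 2; abel))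

/-- Mollification almost commutes with composition with a map which is Lipschitz close to the
identity. -/
theorem abs_mollify_comp_sub_le (η : ContDiffBump (0 : E)) (hM : 0 ≤ M)
    (hg : ∀ x y, |g x - g y| ≤ M * ‖x - y‖) {w : E → E} {K : ℝ} (hK : 0 ≤ K)
    (hw : ∀ x y, ‖w x - w y‖ ≤ K * ‖x - y‖) (hwc : Continuous w) (x : E) :
    |mollify η (fun y => g (y + w y)) x - mollify η g (x + w x)| ≤ M * (K * η.rOut) := by
  have hc := continuous_of_abs_sub_le hg
  refine abs_integral_normed_mul_sub_le η (g := fun t => g (x - t + w (x - t)))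
    (g' := fun t => g (x + w x - t)) (by fun_prop) (by fun_prop) (fun t ht => (hg _ _).trans ?_)
  gcongr
  rw [show x - t + w (x - t) - (x + w x - t) = w (x - t) - w x by abel]
  refine (hw _ _).trans ?_
  rw [sub_sub_cancel_left, norm_neg]
  gcongr

/-- The derivative falls on the compactly supported factor, so that `g` need only be continuous. -/
theorem hasFDerivAt_integral_mul_comp_sub {f g : E → ℝ} (hfc : HasCompactSupport f)
    (hfd : ContDiff ℝ 1 f) (hc : Continuous g) (x : E) :
    HasFDerivAt (fun x => ∫ t, f t * g (x - t)) (∫ t, g (x - t) • fderiv ℝ f t) x := by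
  have h := hfc.hasFDerivAt_convolution_left (ContinuousLinearMap.lsmul ℝ ℝ) hfd
    (hc.locallyIntegrable (μ := (volume : Measure E))) x
  refine HasFDerivAt.congr_fderiv h ?_
  rw [convolution_def]
  refine integral_congr_ae (Eventually.of_forall fun t => ?_)
  ext z
  simp [mul_comm]

/-- The mollification of a Lipschitz function has a Lipschitz derivative. -/
theorem exists_mollify_taylor (η : ContDiffBump (0 : E)) :
    ∃ C, 0 ≤ C ∧ ∀ (g : E → ℝ) (M : ℝ), 0 ≤ M → (∀ x y, |g x - g y| ≤ M * ‖x - y‖) →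
      ∃ D : E → E →L[ℝ] ℝ, Continuous D ∧ (∀ x, ‖D x‖ ≤ M) ∧
        ∀ x z, |mollify η g (x + z) - mollify η g x - D x z| ≤ C * M * ‖z‖ ^ 2 := by
  set f : E → ℝ := η.normed volume with hf
  have hfc : HasCompactSupport f := η.hasCompactSupport_normed
  have hfd : ContDiff ℝ 1 f := η.contDiff_normed (n := 1)
  have hfd' : Continuous (fderiv ℝ f) := hfd.continuous_fderiv (by simp)
  have hfi : Integrable (fderiv ℝ f) (volume : Measure E) :=
    hfd'.integrable_of_hasCompactSupport (hfc.fderiv (𝕜 := ℝ))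
  -- The constant depends on the bump function alone. It has to be chosen before `g`, because the
  -- Euler iteration changes `g` at every step.
  refine ⟨∫ t, ‖fderiv ℝ f t‖, integral_nonneg fun _ => norm_nonneg _, fun g M hM hg => ?_⟩
  have hc := continuous_of_abs_sub_le hg
  set D : E → E →L[ℝ] ℝ := fun x => ∫ t, g (x - t) • fderiv ℝ f t with hD
  have hint : ∀ x, Integrable (fun t => g (x - t) • fderiv ℝ f t) (volume : Measure E) := by
    intro x
    refine Continuous.integrable_of_hasCompactSupport (by fun_prop) ?_
    exact (hfc.fderiv (𝕜 := ℝ)).mono fun t ht h0 => ht (by simp only [h0, smul_zero])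
  have hder : ∀ x, HasFDerivAt (mollify η g) (D x) x :=
    hasFDerivAt_integral_mul_comp_sub hfc hfd hc
  have hlip : ∀ x y, ‖D x - D y‖ ≤ (∫ t, ‖fderiv ℝ f t‖) * M * ‖x - y‖ := by
    intro x y
    rw [hD]
    simp only
    rw [← integral_sub (hint x) (hint y), mul_assoc, ← integral_mul_const]
    refine norm_integral_le_of_norm_le (hfi.norm.mul_const _) (Eventually.of_forall fun t => ?_)
    rw [← sub_smul, norm_smul, mul_comm, Real.norm_eq_abs]
    refine mul_le_mul_of_nonneg_left ((hg _ _).trans_eq (by congr 2; abel)) (norm_nonneg _)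
  have hC : 0 ≤ ∫ t, ‖fderiv ℝ f t‖ := integral_nonneg fun _ => norm_nonneg _
  refine ⟨D, ?_, fun x => ?_, fun x z => ?_⟩
  · refine (LipschitzWith.of_dist_le_mul
      (K := ((∫ t, ‖fderiv ℝ f t‖) * M).toNNReal) fun x y => ?_).continuous
    rw [dist_eq_norm, dist_eq_norm, Real.coe_toNNReal _ (by positivity)]
    exact hlip x y
  · have hl : LipschitzWith M.toNNReal (mollify η g) := LipschitzWith.of_dist_le_mul fun x y => by
      rw [Real.dist_eq, dist_eq_norm, Real.coe_toNNReal _ hM]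
      exact abs_mollify_sub_mollify_le η hg x y
    simpa [hM] using (hder x).le_of_lipschitz hl
  -- Mean value inequality on the ball of radius `‖z‖` about `x`, where `D` differs from `D x` by at
  -- most a multiple of `‖z‖`.
  · have := Convex.norm_image_sub_le_of_norm_hasFDerivWithin_le' (f := mollify η g) (f' := D)
      (φ := D x) (s := Metric.closedBall x ‖z‖) (x := x) (y := x + z)
      (C := (∫ t, ‖fderiv ℝ f t‖) * M * ‖z‖) (fun y _ => (hder y).hasFDerivWithinAt)
      (fun y hy => (hlip y x).trans (by
        gcongr
        simpa [dist_eq_norm] using hy)) (convex_closedBall _ _) (by simp) (by simp)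
    simp only [add_sub_cancel_left, Real.norm_eq_abs] at this
    calc _ ≤ _ := this
      _ = _ := by ring

end Mollify

/-! ### Convergence of the explicit Euler scheme -/

section Euler

variable {E : Type*} [NormedAddCommGroup E] [NormedSpace ℝ E]

/-- The explicit Euler scheme with step `h` for the ordinary differential equation `x' = f t x`. -/
noncomputable def eulerScheme (f : ℝ → E → E) (h : ℝ) : ℕ → E → E
  | 0, x => x
  | k + 1, x => eulerScheme f h k x + h • f (k * h) (eulerScheme f h k x)

theorem continuous_eulerScheme {f : ℝ → E → E} (hf : ∀ t, Continuous (f t)) (h : ℝ) (k : ℕ) :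
    Continuous (eulerScheme f h k) := by
  induction k with
  | zero => exact continuous_id
  | succ k ih =>
    have := hf (k * h)
    exact ih.add ((this.comp ih).const_smul h)

/-- A discrete Grönwall argument. Since `f` is merely continuous in time, the consistency error of
one step is `h ε` rather than `O(h²)`, by uniform continuity of `t ↦ f t (α t)`; each step amplifies
earlier errors by at most `1 + K h`. -/
theorem tendsto_eulerScheme {f : ℝ → E → E} {K T : ℝ} (hK : 0 ≤ K) (hT : 0 ≤ T)
    (hf : ∀ t ∈ Set.Icc 0 T, ∀ x y, ‖f t x - f t y‖ ≤ K * ‖x - y‖)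
    (hfc : Continuous fun x : ℝ × E => f x.1 x.2) {α : ℝ → E}
    (hα : ∀ t ∈ Set.Icc 0 T, HasDerivWithinAt α (f t (α t)) (Set.Icc 0 T) t) :
    Tendsto (fun n : ℕ => eulerScheme f (T / n) n (α 0)) atTop (𝓝 (α T)) := by
  have hαc : ContinuousOn α (Set.Icc 0 T) := fun t ht => (hα t ht).continuousWithinAt
  have hgc : ContinuousOn (fun t => f t (α t)) (Set.Icc 0 T) :=
    hfc.comp_continuousOn (continuousOn_id.prodMk hαc)
  have huc := isCompact_Icc.uniformContinuousOn_of_continuous hgc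
  rw [Metric.uniformContinuousOn_iff] at huc
  have key : ∀ ε > 0, ∀ᶠ n : ℕ in atTop,
      ‖eulerScheme f (T / n) n (α 0) - α T‖ ≤ T * ε * Real.exp (K * T) := by
    intro ε hε
    obtain ⟨δ, hδ, hδε⟩ := huc ε hε
    have hlim : ∀ᶠ n : ℕ in atTop, T / n < δ :=
      (tendsto_const_div_atTop_nhds_zero_nat T).eventually_lt_const hδ
    filter_upwards [hlim, eventually_gt_atTop 0] with n hn hn0
    have hn0' : (0 : ℝ) < n := by exact_mod_cast hn0
    set h : ℝ := T / n with hh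
    have hh0 : 0 ≤ h := by positivity
    have hnh : n * h = T := by rw [hh]; field_simp
    have ind : ∀ k ≤ n, ‖eulerScheme f h k (α 0) - α (k * h)‖ ≤ k * (h * ε) * (1 + K * h) ^ k := by
      intro k
      induction k with
      | zero => intro _; simp [eulerScheme]
      | succ k ih =>
        intro hk
        have ihk := ih (by omega)
        have hk1 : ((k : ℝ) + 1) * h ≤ T := by
          rw [← hnh]
          gcongr
          exact_mod_cast hk
        have hk0 : 0 ≤ k * h := by positivity
        have hmem : ∀ t ∈ Set.Icc (k * h) ((k + 1) * h), t ∈ Set.Icc 0 T := fun t ht =>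
          ⟨hk0.trans ht.1, ht.2.trans hk1⟩
        have hle : k * h ≤ (k + 1) * h := by nlinarith
        have hkm := hmem _ (Set.left_mem_Icc.2 hle)
        -- The solution minus its tangent at the left end point has a derivative of size at most `ε`
        -- on the step interval.
        have step := Convex.norm_image_sub_le_of_norm_hasDerivWithin_le
          (f := fun t => α t - t • f (k * h) (α (k * h)))
          (f' := fun t => f t (α t) - (1 : ℝ) • f (k * h) (α (k * h)))
          (s := Set.Icc (k * h) ((k + 1) * h)) (C := ε) (x := k * h) (y := (k + 1) * h)
          (fun t ht => ((hα t (hmem t ht)).mono hmem).sub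
            ((hasDerivWithinAt_id t _).smul_const _))
          (fun t ht => by
            have := hδε t (hmem t ht) (k * h) hkm (by
              rw [Real.dist_eq, abs_of_nonneg (by linarith [ht.1])]
              have := ht.2
              linarith)
            rw [dist_eq_norm] at this
            rw [one_smul]
            exact this.le)
          (convex_Icc _ _) (Set.left_mem_Icc.2 hle) (Set.right_mem_Icc.2 hle)
        have e1 : ((k : ℝ) + 1) * h - k * h = h := by ring
        rw [e1, Real.norm_eq_abs, abs_of_nonneg hh0] at step
        have hL := hf _ hkm (eulerScheme f h k (α 0)) (α (k * h))
        -- The new error is the old error, plus its propagation through `f`, minus the consistency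
        -- error of the step.
        have e2 : eulerScheme f h (k + 1) (α 0) - α (((k + 1 : ℕ) : ℝ) * h) =
            (eulerScheme f h k (α 0) - α (k * h)) +
            h • (f (k * h) (eulerScheme f h k (α 0)) - f (k * h) (α (k * h))) -
            (α ((k + 1) * h) - ((k + 1) * h) • f (k * h) (α (k * h)) -
              (α (k * h) - (k * h) • f (k * h) (α (k * h)))) := by
          rw [eulerScheme]
          push_cast
          module
        have hq : 1 ≤ (1 + K * h) ^ (k + 1) := one_le_pow₀ (by nlinarith [mul_nonneg hK hh0])
        rw [e2]
        calc _ ≤ ‖eulerScheme f h k (α 0) - α (k * h)‖ +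
              h * (K * ‖eulerScheme f h k (α 0) - α (k * h)‖) + ε * h := by
              refine (norm_sub_le _ _).trans (add_le_add ((norm_add_le _ _).trans ?_) step)
              rw [norm_smul, Real.norm_eq_abs, abs_of_nonneg hh0]
              gcongr
          _ = (1 + K * h) * ‖eulerScheme f h k (α 0) - α (k * h)‖ + h * ε := by ring
          _ ≤ (1 + K * h) * (k * (h * ε) * (1 + K * h) ^ k) + h * ε * (1 + K * h) ^ (k + 1) := by
              exact add_le_add (by gcongr) (le_mul_of_one_le_right (by positivity) hq)
          _ = _ := by push_cast; ring
    have := ind n le_rfl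
    rw [hnh] at this
    refine this.trans ?_
    rw [show (n : ℝ) * (h * ε) = T * ε by rw [← hnh]; ring]
    gcongr
    calc (1 + K * h) ^ n ≤ Real.exp (K * h) ^ n := by
          gcongr
          rw [add_comm]
          exact Real.add_one_le_exp _
      _ = Real.exp (K * T) := by
          rw [← Real.exp_nat_mul, ← hnh]
          congr 1
          ring
  rw [tendsto_iff_norm_sub_tendsto_zero]
  rw [Metric.tendsto_nhds]
  intro ε hε
  have hpos : 0 < (T + 1) * Real.exp (K * T) := by positivity
  filter_upwards [key (ε / ((T + 1) * Real.exp (K * T))) (by positivity)] with n hn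
  rw [Real.dist_eq, sub_zero, abs_of_nonneg (norm_nonneg _)]
  refine hn.trans_lt ?_
  rw [show T * (ε / ((T + 1) * Real.exp (K * T))) * Real.exp (K * T) = ε * (T / (T + 1)) by
    field_simp]
  exact mul_lt_of_lt_one_right hε ((div_lt_one (by positivity)).2 (by linarith))

end Euler

/-! ### The flow of the conditional field transports the Gaussian law -/

section Transport

open scoped RealInnerProductSpace

variable {E : Type*} [NormedAddCommGroup E] [InnerProductSpace ℝ E] [FiniteDimensional ℝ E]
  [MeasurableSpace E] [BorelSpace E]

/-- Finite measures are determined by the integrals of bounded Lipschitz functions. -/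
theorem measure_eq_of_integral_lipschitz {μ ν : Measure E} [IsFiniteMeasure μ] [IsFiniteMeasure ν]
    (h : ∀ (g : E → ℝ) (B M : ℝ), 0 ≤ M → (∀ x, |g x| ≤ B) →
      (∀ x y, |g x - g y| ≤ M * ‖x - y‖) → ∫ x, g x ∂μ = ∫ x, g x ∂ν) : μ = ν := by
  apply Measure.ext_of_charFun
  ext t
  have lip : ∀ s : ℝ → ℝ, LipschitzWith 1 s → ∀ x y : E, |s ⟪x, t⟫ - s ⟪y, t⟫| ≤ ‖t‖ * ‖x - y‖ := by
    intro s hs x y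
    have h1 := hs.dist_le_mul ⟪x, t⟫ ⟪y, t⟫
    rw [Real.dist_eq, Real.dist_eq, NNReal.coe_one, one_mul, ← inner_sub_left] at h1
    refine h1.trans ((abs_real_inner_le_norm _ _).trans_eq (mul_comm _ _))
  have hcos := h (fun x => Real.cos ⟪x, t⟫) 1 ‖t‖ (norm_nonneg _) (fun x => Real.abs_cos_le_one _)
    (lip _ Real.lipschitzWith_cos)
  have hsin := h (fun x => Real.sin ⟪x, t⟫) 1 ‖t‖ (norm_nonneg _) (fun x => Real.abs_sin_le_one _)
    (lip _ Real.lipschitzWith_sin)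
  have key : ∀ (ρ : Measure E) [IsFiniteMeasure ρ], charFun ρ t =
      ((∫ x, Real.cos ⟪x, t⟫ ∂ρ : ℝ) : ℂ) + ((∫ x, Real.sin ⟪x, t⟫ ∂ρ : ℝ) : ℂ) * Complex.I := by
    intro ρ _
    rw [charFun_apply, ← integral_complex_ofReal, ← integral_complex_ofReal, ← integral_mul_const,
      ← integral_add]
    · refine integral_congr_ae (Eventually.of_forall fun x => ?_)
      simp only [Complex.exp_mul_I, Complex.ofReal_cos, Complex.ofReal_sin]
    · exact Integrable.of_bound (by fun_prop) 1 (Eventually.of_forall fun x => by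
        rw [Complex.norm_real]; exact Real.abs_cos_le_one _)
    · exact (Integrable.of_bound (by fun_prop) 1 (Eventually.of_forall fun x => by
        rw [Complex.norm_real]; exact Real.abs_sin_le_one _)).mul_const _
  rw [key μ, key ν, hcos, hsin]

variable {μ : Measure E} [IsProbabilityMeasure μ] {R : ℝ}

theorem norm_condField_sub_le_of_mem (hμ : ∀ᵐ v ∂μ, ‖v‖ ≤ R) (hR : 0 ≤ R) {T : ℝ} :
    ∀ t ∈ Set.Icc 0 T, ∀ x y, ‖condField μ t x - condField μ t y‖ ≤ 4 * R ^ 2 * T * ‖x - y‖ := by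
  intro t ht x y
  refine (norm_condField_sub_le hμ hR t y x).trans ?_
  gcongr
  rw [abs_of_nonneg ht.1]
  exact ht.2

variable (μ) in
/-- The expectation of `g (l • V + N)` after mollification of `g`. -/
noncomputable def mollifiedMean (η : ContDiffBump (0 : E)) (l : ℝ) (g : E → ℝ) : ℝ :=
  ∫ x, mollify η g (l • x.1 + x.2) ∂(μ.prod (stdGaussian E))

theorem abs_integral_sub_integral_le {α : Type*} [MeasurableSpace α] {ρ : Measure α}
    [IsProbabilityMeasure ρ] {f g : α → ℝ} (hf : Integrable f ρ) (hg : Integrable g ρ) {C : ℝ}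
    (h : ∀ᵐ x ∂ρ, |f x - g x| ≤ C) : |∫ x, f x ∂ρ - ∫ x, g x ∂ρ| ≤ C := by
  rw [← integral_sub hf hg, ← Real.norm_eq_abs]
  simpa using norm_integral_le_of_norm_le_const (f := fun x => f x - g x) h

theorem integrable_of_continuous_of_abs_le {α : Type*} [MeasurableSpace α] [TopologicalSpace α]
    [OpensMeasurableSpace α] {ρ : Measure α} [IsFiniteMeasure ρ] {f : α → ℝ}
    (hf : Continuous f) {B : ℝ} (hB : ∀ x, |f x| ≤ B) : Integrable f ρ :=
  Integrable.of_bound hf.measurable.aestronglyMeasurable B (Eventually.of_forall hB)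

variable {g : E → ℝ} {B M : ℝ}

theorem continuous_mollify (η : ContDiffBump (0 : E))
    (hg : ∀ x y, |g x - g y| ≤ M * ‖x - y‖) : Continuous (mollify η g) :=
  continuous_of_abs_sub_le (abs_mollify_sub_mollify_le η hg)

/-- The law of `(l + h) • V + N` is close to the image of the law of `l • V + N` under one step of
the Euler scheme. -/
theorem abs_mollifiedMean_step_le (hμ : ∀ᵐ v ∂μ, ‖v‖ ≤ R) (hR : 0 ≤ R) (η : ContDiffBump (0 : E)) :
    ∃ C, 0 ≤ C ∧ ∀ (g : E → ℝ) (B M : ℝ), 0 ≤ M → (∀ x, |g x| ≤ B) →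
      (∀ x y, |g x - g y| ≤ M * ‖x - y‖) → ∀ T l h : ℝ, l ∈ Set.Icc 0 T → 0 ≤ h →
      |mollifiedMean μ η (l + h) g - mollifiedMean μ η l (fun x => g (x + h • condField μ l x))| ≤
        M * h * (C * h + 4 * R ^ 2 * T * η.rOut) := by
  obtain ⟨C, hC, hD⟩ := exists_mollify_taylor η
  refine ⟨C * R ^ 2 * 2, by positivity, fun g B M hM hB hg T l h hl hh => ?_⟩
  have hT : 0 ≤ T := hl.1.trans hl.2
  obtain ⟨D, hDc, hDM, hDt⟩ := hD g M hM hg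
  have hgc := continuous_of_abs_sub_le hg
  have hb : Continuous (condField μ l) :=
    (continuous_condField hμ hR).comp (by fun_prop : Continuous fun u : E => (l, u))
  have hmc := continuous_mollify η hg
  have hmB := abs_mollify_le η hgc hB
  have hL : ∀ x y, ‖h • condField μ l x - h • condField μ l y‖ ≤
      (h * (4 * R ^ 2 * T)) * ‖x - y‖ := by
    intro x y
    rw [← smul_sub, norm_smul, Real.norm_eq_abs, abs_of_nonneg hh, mul_assoc]
    gcongr
    exact norm_condField_sub_le_of_mem hμ hR l hl x y
  have hgE : Continuous fun x => g (x + h • condField μ l x) := by fun_prop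
  have hgEL : ∀ x y, |g (x + h • condField μ l x) - g (y + h • condField μ l y)| ≤
      (M * (1 + h * (4 * R ^ 2 * T))) * ‖x - y‖ := by
    intro x y
    refine (hg _ _).trans ?_
    rw [mul_assoc]
    gcongr
    rw [add_sub_add_comm, add_mul, one_mul]
    exact (norm_add_le _ _).trans (add_le_add le_rfl (hL x y))
  have hmE := continuous_mollify η hgEL
  have hmEB := abs_mollify_le η hgE (fun x => hB (x + h • condField μ l x))
  have hμ2 : ∀ᵐ x ∂(μ.prod (stdGaussian E)), ‖x.1‖ ≤ R :=
    Measure.quasiMeasurePreserving_fst.ae hμ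
  have i1 : Integrable (fun x : E × E => mollify η g ((l + h) • x.1 + x.2))
      (μ.prod (stdGaussian E)) :=
    integrable_of_continuous_of_abs_le (by fun_prop) (fun x => hmB _)
  have i3 : Integrable (fun x : E × E => mollify η g ((l • x.1 + x.2) +
      h • condField μ l (l • x.1 + x.2))) (μ.prod (stdGaussian E)) :=
    integrable_of_continuous_of_abs_le (by fun_prop) (fun x => hmB _)
  have i2 : Integrable (fun x : E × E => mollify η (fun x => g (x + h • condField μ l x))
      (l • x.1 + x.2)) (μ.prod (stdGaussian E)) :=
    integrable_of_continuous_of_abs_le (by fun_prop) (fun x => hmEB _)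
  have i4 : Integrable (fun x : E × E => h * D (l • x.1 + x.2)
      (x.1 - condField μ l (l • x.1 + x.2))) (μ.prod (stdGaussian E)) := by
    refine Integrable.const_mul (Integrable.of_bound
      (Continuous.aestronglyMeasurable (by fun_prop)) (M * (R + R)) ?_) _
    filter_upwards [hμ2] with x hx
    refine (ContinuousLinearMap.le_opNorm _ _).trans ?_
    gcongr
    · exact hDM _
    · exact (norm_sub_le _ _).trans (add_le_add hx (norm_condField_le hμ l _))
  -- Mollification is interchanged with the Euler step; the commutator is small because the
  -- displacement has Lipschitz constant `O(h)`.
  have h32 := abs_integral_sub_integral_le i2 i3 (Eventually.of_forall fun x =>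
    abs_mollify_comp_sub_le η hM hg (w := fun x => h • condField μ l x)
      (K := h * (4 * R ^ 2 * T)) (by positivity) hL (by fun_prop) (l • x.1 + x.2))
  -- Taylor expansions at `l • V + N` with the increments `h • V` and `h • condField`, each with
  -- remainder at most `C M (h R)²`. The first-order terms differ by `h D(V - condField)`, which is
  -- subtracted here because its expectation is zero.
  have h13 := abs_integral_sub_integral_le (i1.sub i4) i3 (C := C * R ^ 2 * 2 * M * h ^ 2) (by
    filter_upwards [hμ2] with x hx
    have a1 := hDt (l • x.1 + x.2) (h • x.1)
    have a2 := hDt (l • x.1 + x.2) (h • condField μ l (l • x.1 + x.2))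
    have q1 : C * M * ‖h • x.1‖ ^ 2 ≤ C * M * (h * R) ^ 2 := by
      rw [norm_smul, Real.norm_eq_abs, abs_of_nonneg hh]
      gcongr
    have q2 : C * M * ‖h • condField μ l (l • x.1 + x.2)‖ ^ 2 ≤ C * M * (h * R) ^ 2 := by
      rw [norm_smul, Real.norm_eq_abs, abs_of_nonneg hh]
      gcongr
      exact norm_condField_le hμ l _
    have e1 : (l + h) • x.1 + x.2 = l • x.1 + x.2 + h • x.1 := by module
    simp only [Pi.sub_apply]
    rw [e1, map_sub]
    rw [map_smul, smul_eq_mul] at a1 a2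
    have a1' := abs_le.1 (a1.trans q1)
    have a2' := abs_le.1 (a2.trans q2)
    rw [abs_le]
    constructor <;> nlinarith)
  have hz : ∫ x : E × E, h * D (l • x.1 + x.2) (x.1 - condField μ l (l • x.1 + x.2))
      ∂(μ.prod (stdGaussian E)) = 0 := by
    rw [integral_const_mul, integral_clm_sub_condField hμ hR l hDc hDM, mul_zero]
  rw [integral_sub' i1 i4, hz, sub_zero] at h13
  rw [abs_sub_comm] at h32
  calc _ ≤ _ := abs_sub_le _ _ _
    _ ≤ C * R ^ 2 * 2 * M * h ^ 2 + M * (h * (4 * R ^ 2 * T) * η.rOut) := add_le_add h13 h32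
    _ = _ := by ring

/-- The one-step errors telescope backwards in time: `k + 1` steps followed by `g` are `k` steps
followed by the composition of `g` with the last step. The induction is therefore over all `g` at
once, and the second conclusion keeps track of the Lipschitz constant, which gains a factor `1 + 4
R² T h` per step. -/
theorem abs_mollifiedMean_eulerScheme_le (hμ : ∀ᵐ v ∂μ, ‖v‖ ≤ R) (hR : 0 ≤ R)
    (η : ContDiffBump (0 : E)) :
    ∃ C, 0 ≤ C ∧ ∀ (T h : ℝ), 0 ≤ h → ∀ (k : ℕ), k * h ≤ T →
      ∀ (g : E → ℝ) (B M : ℝ), 0 ≤ M → (∀ x, |g x| ≤ B) →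
      (∀ x y, |g x - g y| ≤ M * ‖x - y‖) →
      |mollifiedMean μ η (k * h) g -
          mollifiedMean μ η 0 (fun x => g (eulerScheme (condField μ) h k x))| ≤
        k * (h * M * (C * h + 4 * R ^ 2 * T * η.rOut) * (1 + 4 * R ^ 2 * T * h) ^ k) ∧
      ∀ x y, |g (eulerScheme (condField μ) h k x) - g (eulerScheme (condField μ) h k y)| ≤
        M * (1 + 4 * R ^ 2 * T * h) ^ k * ‖x - y‖ := by
  obtain ⟨C, hC, hstep⟩ := abs_mollifiedMean_step_le hμ hR η
  refine ⟨C, hC, fun T h hh k => ?_⟩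
  induction k with
  | zero =>
    intro _ g B M hM hB hg
    simpa [eulerScheme] using hg
  | succ k ih =>
    intro hk g B M hM hB hg
    have e : (((k + 1 : ℕ) : ℝ)) * h = k * h + h := by push_cast; ring
    have hl : k * h ∈ Set.Icc 0 T := ⟨by positivity, by linarith⟩
    have hT : 0 ≤ T := hl.1.trans hl.2
    have hrη := η.rOut_pos
    have hL : ∀ x y, |g (x + h • condField μ (k * h) x) - g (y + h • condField μ (k * h) y)| ≤
        (M * (1 + 4 * R ^ 2 * T * h)) * ‖x - y‖ := by
      intro x y
      refine (hg _ _).trans ?_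
      rw [mul_assoc]
      gcongr
      rw [add_sub_add_comm, add_mul, one_mul, ← smul_sub]
      refine (norm_add_le _ _).trans (add_le_add le_rfl ?_)
      rw [norm_smul, Real.norm_eq_abs, abs_of_nonneg hh,
        show 4 * R ^ 2 * T * h * ‖x - y‖ = h * (4 * R ^ 2 * T * ‖x - y‖) by ring]
      gcongr
      exact norm_condField_sub_le_of_mem hμ hR _ hl x y
    obtain ⟨ih1, ih2⟩ := ih hl.2 (fun x => g (x + h • condField μ (k * h) x)) B
      (M * (1 + 4 * R ^ 2 * T * h)) (by positivity) (fun x => hB _) hL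
    have st := hstep g B M hM hB hg T (k * h) h hl hh
    refine ⟨?_, fun x y => (ih2 x y).trans_eq (by ring)⟩
    rw [e]
    have hq : 1 ≤ (1 + 4 * R ^ 2 * T * h) ^ (k + 1) :=
      one_le_pow₀ (le_add_of_nonneg_right (by positivity))
    calc _ ≤ _ := abs_sub_le _ (mollifiedMean μ η (k * h)
            (fun x => g (x + h • condField μ (k * h) x))) _
      _ ≤ M * h * (C * h + 4 * R ^ 2 * T * η.rOut) * (1 + 4 * R ^ 2 * T * h) ^ (k + 1) +
          k * (h * (M * (1 + 4 * R ^ 2 * T * h)) * (C * h + 4 * R ^ 2 * T * η.rOut) *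
            (1 + 4 * R ^ 2 * T * h) ^ k) :=
          add_le_add (st.trans (le_mul_of_one_le_right (by positivity) hq)) ih1
      _ = _ := by push_cast; ring

theorem abs_mollifiedMean_sub_le (η : ContDiffBump (0 : E)) (l : ℝ) (hM : 0 ≤ M)
    (hB : ∀ x, |g x| ≤ B) (hg : ∀ x y, |g x - g y| ≤ M * ‖x - y‖) :
    |mollifiedMean μ η l g - ∫ x, g (l • x.1 + x.2) ∂(μ.prod (stdGaussian E))| ≤ M * η.rOut := by
  have hgc := continuous_of_abs_sub_le hg
  have hmc := continuous_mollify η hg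
  exact abs_integral_sub_integral_le
    (integrable_of_continuous_of_abs_le (by fun_prop) (fun x => abs_mollify_le η hgc hB _))
    (integrable_of_continuous_of_abs_le (by fun_prop) (fun x => hB _))
    (Eventually.of_forall fun x => abs_mollify_sub_le η hM hg _)

/-- The limit of the Euler schemes transports the standard Gaussian measure to the law of
`T • V + N`. -/
theorem map_eulerScheme_limit (hμ : ∀ᵐ v ∂μ, ‖v‖ ≤ R) (hR : 0 ≤ R) {T : ℝ} (hT : 0 ≤ T) {Φ : E → E}
    (hΦ : ∀ x, Tendsto (fun n : ℕ => eulerScheme (condField μ) (T / n) n x) atTop (𝓝 (Φ x))) :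
    (stdGaussian E).map Φ = (μ.prod (stdGaussian E)).map (fun x => T • x.1 + x.2) := by
  have hbc : ∀ t, Continuous (condField μ t) := fun t =>
    (continuous_condField hμ hR).comp (by fun_prop : Continuous fun u : E => (t, u))
  have hΦm : Measurable Φ := measurable_of_tendsto_metrizable
    (fun n => (continuous_eulerScheme hbc (T / n) n).measurable) (tendsto_pi_nhds.2 hΦ)
  have : IsProbabilityMeasure ((stdGaussian E).map Φ) :=
    Measure.isProbabilityMeasure_map hΦm.aemeasurable
  have : IsProbabilityMeasure ((μ.prod (stdGaussian E)).map (fun x => T • x.1 + x.2)) :=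
    Measure.isProbabilityMeasure_map (by fun_prop)
  refine measure_eq_of_integral_lipschitz fun g B M hM hB hg => ?_
  have hgc := continuous_of_abs_sub_le hg
  rw [integral_map hΦm.aemeasurable hgc.aestronglyMeasurable,
    integral_map (by fun_prop) hgc.aestronglyMeasurable]
  set K : ℝ := 4 * R ^ 2 * T with hKdef
  have hK : 0 ≤ K := by positivity
  set I : ℝ := ∫ x, g (T • x.1 + x.2) ∂(μ.prod (stdGaussian E)) with hI
  have lim1 : Tendsto (fun n : ℕ => ∫ x, g (eulerScheme (condField μ) (T / n) n x) ∂(stdGaussian E))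
      atTop (𝓝 (∫ x, g (Φ x) ∂(stdGaussian E))) := by
    refine tendsto_integral_of_dominated_convergence (fun _ => B)
      (fun n => (hgc.comp (continuous_eulerScheme hbc _ _)).aestronglyMeasurable)
      (integrable_const _) (fun n => Eventually.of_forall fun x => hB _)
      (Eventually.of_forall fun x => (hgc.tendsto _).comp (hΦ x))
  -- The Taylor constant `C` depends on the mollification radius `δ`, so `δ` is fixed while the
  -- number of steps tends to infinity, which removes `C`. Only then does `δ` tend to `0`.
  have bound : ∀ δ > 0, |∫ x, g (Φ x) ∂(stdGaussian E) - I| ≤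
      (M * Real.exp (K * T) + M + T * M * K * Real.exp (K * T)) * δ := by
    intro δ hδ
    let η : ContDiffBump (0 : E) := ⟨δ / 2, δ, by positivity, by linarith⟩
    have hη : η.rOut = δ := rfl
    obtain ⟨C, hC, hCb⟩ := abs_mollifiedMean_eulerScheme_le hμ hR η
    have fin : ∀ᶠ n : ℕ in atTop, |∫ x, g (eulerScheme (condField μ) (T / n) n x) ∂(stdGaussian E) - I|
        ≤ M * Real.exp (K * T) * δ + M * δ +
          T * M * (C * (T / n) + K * δ) * Real.exp (K * T) := by
      filter_upwards [eventually_gt_atTop 0] with n hn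
      have hn' : (0 : ℝ) < n := by exact_mod_cast hn
      have hnT : n * (T / n) = T := by field_simp
      have hh : 0 ≤ T / n := by positivity
      obtain ⟨b1, b2⟩ := hCb T (T / n) hh n hnT.le g B M hM hB hg
      have hpow : (1 + K * (T / n)) ^ n ≤ Real.exp (K * T) := by
        calc (1 + K * (T / n)) ^ n ≤ Real.exp (K * (T / n)) ^ n := by
              gcongr
              rw [add_comm]
              exact Real.add_one_le_exp _
          _ = Real.exp (K * T) := by
              rw [← Real.exp_nat_mul]
              congr 1
              rw [mul_left_comm, hnT]
      rw [hnT] at b1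
      have c1 := abs_mollifiedMean_sub_le (μ := μ) η T hM hB hg
      have c0 := abs_mollifiedMean_sub_le (μ := μ) (M := M * Real.exp (K * T)) η 0 (by positivity)
        (fun x => hB (eulerScheme (condField μ) (T / n) n x))
        (fun x y => (b2 x y).trans (by gcongr))
      -- At `l = 0` the vector `V` drops out and only the Gaussian variable is left.
      have e0 : ∫ x : E × E, g (eulerScheme (condField μ) (T / n) n ((0 : ℝ) • x.1 + x.2))
          ∂(μ.prod (stdGaussian E)) =
          ∫ x, g (eulerScheme (condField μ) (T / n) n x) ∂(stdGaussian E) := by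
        simp only [zero_smul, zero_add]
        rw [integral_fun_snd (fun x => g (eulerScheme (condField μ) (T / n) n x))]
        simp
      rw [e0] at c0
      have b1' : |mollifiedMean μ η T g - mollifiedMean μ η 0
          (fun x => g (eulerScheme (condField μ) (T / n) n x))| ≤
          T * M * (C * (T / n) + K * δ) * Real.exp (K * T) := by
        refine b1.trans ?_
        calc _ = (n * (T / n)) * M * (C * (T / n) + K * δ) * (1 + K * (T / n)) ^ n := by
              rw [hη]; ring
          _ ≤ _ := by
              rw [hnT]
              gcongr
      rw [hη] at c0 c1
      have c0' := abs_le.1 c0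
      have c1' := abs_le.1 c1
      have b1'' := abs_le.1 b1'
      rw [abs_le]
      constructor <;> linarith [c0'.1, c0'.2, c1'.1, c1'.2, b1''.1, b1''.2]
    have lim2 : Tendsto (fun n : ℕ => M * Real.exp (K * T) * δ + M * δ +
        T * M * (C * (T / n) + K * δ) * Real.exp (K * T)) atTop
        (𝓝 (M * Real.exp (K * T) * δ + M * δ +
        T * M * (C * 0 + K * δ) * Real.exp (K * T))) := by
      have := tendsto_const_div_atTop_nhds_zero_nat T
      exact ((((this.const_mul C).add_const _).const_mul _).mul_const _).const_add _
    refine (le_of_tendsto_of_tendsto ((lim1.sub_const I).abs) lim2 fin).trans_eq ?_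
    ring
  have hz : |∫ x, g (Φ x) ∂(stdGaussian E) - I| ≤ 0 := by
    have lim : Tendsto (fun δ : ℝ => (M * Real.exp (K * T) + M + T * M * K * Real.exp (K * T)) * δ)
        (𝓝[>] 0) (𝓝 ((M * Real.exp (K * T) + M + T * M * K * Real.exp (K * T)) * 0)) :=
      ((continuous_const.mul continuous_id).tendsto 0).mono_left nhdsWithin_le_nhds
    rw [mul_zero] at lim
    exact ge_of_tendsto lim (by filter_upwards [self_mem_nhdsWithin] with δ hδ using bound δ hδ)
  exact sub_eq_zero.1 (abs_nonpos_iff.1 hz)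

/-- The flow of the field `condField μ` transports the standard Gaussian measure to the law of
`t • V + N` at time `t`. -/
theorem exists_flow_condField (hμ : ∀ᵐ v ∂μ, ‖v‖ ≤ R) (hR : 0 ≤ R) {T : ℝ} (hT : 0 ≤ T) :
    ∃ φ : E → ℝ → E, (∀ x, φ x 0 = x) ∧
      (∀ x, ∀ t ∈ Set.Icc 0 T, HasDerivWithinAt (φ x) (condField μ t (φ x t)) (Set.Icc 0 T) t) ∧
      (∀ t ∈ Set.Icc 0 T, Measurable fun x => φ x t) ∧
      ∀ t ∈ Set.Icc 0 T, (stdGaussian E).map (fun x => φ x t) =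
        (μ.prod (stdGaussian E)).map (fun x => t • x.1 + x.2) := by
  have hbc := continuous_condField hμ hR
  have hbt : ∀ t, Continuous (condField μ t) := fun t =>
    hbc.comp (by fun_prop : Continuous fun u : E => (t, u))
  -- The speed is at most `R`, so trajectories stay in the ball of radius `R T` up to time `T`.
  -- Hence a single application of Picard–Lindelöf covers the whole interval.
  have hpl : ∀ x : E, IsPicardLindelof (condField μ) (tmin := 0) (tmax := T) ⟨0, le_rfl, hT⟩ x
      (R * T).toNNReal 0 R.toNNReal (4 * R ^ 2 * T).toNNReal := by
    intro x
    constructor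
    · intro t ht
      refine LipschitzOnWith.of_dist_le_mul fun y _ z _ => ?_
      rw [dist_eq_norm, dist_eq_norm, Real.coe_toNNReal _ (by positivity)]
      exact norm_condField_sub_le_of_mem hμ hR t ht y z
    · intro y _
      exact (hbc.comp (by fun_prop : Continuous fun t : ℝ => (t, y))).continuousOn
    · intro t _ y _
      rw [Real.coe_toNNReal _ hR]
      exact norm_condField_le hμ t y
    · rw [Real.coe_toNNReal _ hR, Real.coe_toNNReal _ (by positivity)]
      simp [hT]
  choose φ h0 hd using fun x => (hpl x).exists_eq_forall_mem_Icc_hasDerivWithinAt₀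
  have hlim : ∀ t ∈ Set.Icc 0 T, ∀ x,
      Tendsto (fun n : ℕ => eulerScheme (condField μ) (t / n) n x) atTop (𝓝 (φ x t)) := by
    intro t ht x
    have hsub : Set.Icc 0 t ⊆ Set.Icc 0 T := Set.Icc_subset_Icc_right ht.2
    have := tendsto_eulerScheme (f := condField μ) (K := 4 * R ^ 2 * t) (T := t)
      (by have := ht.1; positivity) ht.1
      (norm_condField_sub_le_of_mem hμ hR) hbc (α := φ x)
      (fun s hs => (hd x s (hsub hs)).mono hsub)
    have h0' : φ x 0 = x := h0 x
    rwa [h0'] at this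
  refine ⟨φ, h0, hd, fun t ht => ?_, fun t ht => map_eulerScheme_limit hμ hR ht.1 (hlim t ht)⟩
  exact measurable_of_tendsto_metrizable
    (fun n => (continuous_eulerScheme hbt (t / n) n).measurable) (tendsto_pi_nhds.2 (hlim t ht))

end Transport

/-! ### The velocity as a conditional expectation -/

section ConditionalVelocity

open scoped RealInnerProductSpace

variable {E : Type*} [NormedAddCommGroup E] [InnerProductSpace ℝ E] [FiniteDimensional ℝ E]
  [MeasurableSpace E] [BorelSpace E]

/-- If `c (U)` is the conditional expectation of `K` given `U`, tested against smooth functions, then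
its `L^p` norm is at most that of `K`. -/
theorem eLpNorm_comp_le_of_integral_smul_eq {α : Type*} [mα : MeasurableSpace α] {ρ : Measure α}
    [IsProbabilityMeasure ρ] {F : Type*} [NormedAddCommGroup F] [NormedSpace ℝ F] [CompleteSpace F]
    {U : α → E} (hU : Measurable U) {c : E → F} (hc : Continuous c) {k : α → F}
    (hci : Integrable (fun x => c (U x)) ρ) (hk : Integrable k ρ)
    (h : ∀ f : E → ℝ, ContDiff ℝ (⊤ : ℕ∞) f → HasCompactSupport f →
      ∫ x, f (U x) • c (U x) ∂ρ = ∫ x, f (U x) • k x ∂ρ) {p : ℝ≥0∞} (hp : 1 ≤ p) :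
    eLpNorm (fun x => c (U x)) p ρ ≤ eLpNorm k p ρ := by
  have hmle : MeasurableSpace.comap U ‹MeasurableSpace E› ≤ mα := hU.comap_le
  have hUm : Measurable[MeasurableSpace.comap U ‹MeasurableSpace E›] U := comap_measurable U
  obtain ⟨κ, hκ, hκe⟩ := (stronglyMeasurable_condExp (f := k) (m := MeasurableSpace.comap U ‹MeasurableSpace E›) (μ := ρ)).exists_eq_measurable_comp
  have hκi : Integrable (fun x => κ (U x)) ρ := by
    have : Integrable (ρ[k | MeasurableSpace.comap U ‹MeasurableSpace E›]) ρ := integrable_condExp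
    rwa [hκe] at this
  -- Smooth compactly supported test functions suffice to identify `c` with the factor `κ` of the
  -- conditional expectation through `U`, almost everywhere for the law of `U`. The claim is then
  -- the contractivity of conditional expectation in `L^p`.
  have hae : ∀ᵐ u ∂(ρ.map U), c u = κ u := by
    have i1 : Integrable c (ρ.map U) :=
      (integrable_map_measure hc.aestronglyMeasurable hU.aemeasurable).2 hci
    have i2 : Integrable κ (ρ.map U) :=
      (integrable_map_measure hκ.aestronglyMeasurable hU.aemeasurable).2 hκi
    refine ae_eq_of_integral_contDiff_smul_eq i1.locallyIntegrable i2.locallyIntegrable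
      fun f hf hfc => ?_
    have hfcont := hf.continuous
    obtain ⟨B, hB⟩ := hfc.exists_bound_of_continuous hfcont
    have k1 : AEStronglyMeasurable (fun u => f u • c u) (ρ.map U) :=
      (hfcont.smul hc).aestronglyMeasurable
    have k2 : AEStronglyMeasurable (fun u => f u • κ u) (ρ.map U) :=
      hfcont.aestronglyMeasurable.smul hκ.aestronglyMeasurable
    rw [integral_map hU.aemeasurable k1, integral_map hU.aemeasurable k2, h f hf hfc]
    have hfm : StronglyMeasurable[MeasurableSpace.comap U ‹MeasurableSpace E›] (fun x => f (U x)) :=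
      (hfcont.measurable.comp hUm).stronglyMeasurable
    have hfk : Integrable (fun x => f (U x) • k x) ρ :=
      hk.smul_of_top_right (memLp_top_of_bound (hfcont.measurable.comp hU).aestronglyMeasurable B
        (Eventually.of_forall fun x => hB _))
    have hpull := condExp_bilin_of_stronglyMeasurable_left (ContinuousLinearMap.lsmul ℝ ℝ) hfm
      (g := k) (μ := ρ) hfk hk
    have h1 := integral_condExp hmle (f := fun x => f (U x) • k x) (μ := ρ)
    rw [← h1]
    refine integral_congr_ae ?_
    filter_upwards [hpull] with x hx
    rw [hκe] at hx
    exact hx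
  have hae' : (fun x => c (U x)) =ᵐ[ρ] ρ[k | MeasurableSpace.comap U ‹MeasurableSpace E›] := by
    rw [hκe]
    exact ae_of_ae_map hU.aemeasurable hae
  rw [eLpNorm_congr_ae hae']
  exact eLpNorm_condExp_le_eLpNorm k hp

variable {Ω : Type*} [MeasurableSpace Ω] {P : Measure Ω} [IsProbabilityMeasure P]

/-- `Y` and `T` satisfy a Stein identity for the random vector `V`: the expectation of
`f (V) ⟪V, w⟫` is that of `f (V) ⟪Y, w⟫ + Df (V) (T w)`. -/
def SteinIdentity (P : Measure Ω) (V Y : Ω → E) (T : Ω → E →L[ℝ] E) : Prop :=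
  ∀ f : E → ℝ, ContDiff ℝ (⊤ : ℕ∞) f → ∀ w : E,
    ∫ ω, f (V ω) * ⟪V ω, w⟫ ∂P =
      ∫ ω, f (V ω) * ⟪Y ω, w⟫ ∂P + ∫ ω, fderiv ℝ f (V ω) (T ω w) ∂P

/-- The velocity, up to a scalar factor, of the rescaled flow of `condField μ`. -/
noncomputable def rescaledVelocity (μ : Measure E) (l : ℝ) (u : E) : E :=
  (1 + l ^ 2) • condField μ l u - l • u

variable {V Y : Ω → E} {T : Ω → E →L[ℝ] E} {R : ℝ}

theorem ae_norm_le_map (hV : Measurable V) (hVR : ∀ᵐ ω ∂P, ‖V ω‖ ≤ R) :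
    ∀ᵐ v ∂(P.map V), ‖v‖ ≤ R :=
  (ae_map_iff hV.aemeasurable (measurableSet_le measurable_norm measurable_const)).2 hVR

theorem map_prod_stdGaussian (hV : Measurable V) :
    (P.prod (stdGaussian E)).map (fun x => (V x.1, x.2)) = (P.map V).prod (stdGaussian E) := by
  have := Measure.map_prod_map P (stdGaussian E) hV measurable_id
  rw [Measure.map_id] at this
  exact this.symm

theorem integrable_snd_stdGaussian : Integrable (fun x : Ω × E => x.2) (P.prod (stdGaussian E)) :=
  (IsGaussian.integrable_id (μ := stdGaussian E)).comp_snd P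

theorem continuous_rescaledVelocity {μ : Measure E} [IsProbabilityMeasure μ]
    (hμ : ∀ᵐ v ∂μ, ‖v‖ ≤ R) (hR : 0 ≤ R) :
    Continuous fun x : ℝ × E => rescaledVelocity μ x.1 x.2 := by
  have := continuous_condField hμ hR
  unfold rescaledVelocity
  fun_prop

theorem integrable_adjoint_apply (hT : Integrable T P) :
    Integrable (fun x : Ω × E => ContinuousLinearMap.adjoint (T x.1) x.2)
      (P.prod (stdGaussian E)) := by
  have h1 : Integrable (fun x : Ω × E => ‖T x.1‖ * ‖x.2‖) (P.prod (stdGaussian E)) :=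
    hT.norm.mul_prod (IsGaussian.integrable_id (μ := stdGaussian E)).norm
  refine h1.mono' ?_ (Eventually.of_forall fun x => ?_)
  · have h2 : AEStronglyMeasurable (fun x : Ω × E => ContinuousLinearMap.adjoint (T x.1))
        (P.prod (stdGaussian E)) :=
      (ContinuousLinearMap.adjoint (𝕜 := ℝ) (E := E) (F := E)).continuous.comp_aestronglyMeasurable
        hT.aestronglyMeasurable.comp_fst
    exact ContinuousLinearMap.aestronglyMeasurable_comp₂ (ContinuousLinearMap.id ℝ (E →L[ℝ] E)) h2
      (g := fun x : Ω × E => x.2) (by fun_prop)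
  · refine (ContinuousLinearMap.le_opNorm _ _).trans_eq ?_
    rw [LinearIsometryEquiv.norm_map]

/-- The Stein identity for `V` and Gaussian integration by parts express the velocity as a conditional
expectation. -/
theorem integral_smul_rescaledVelocity (hV : Measurable V) (hR : 0 ≤ R) (hVR : ∀ᵐ ω ∂P, ‖V ω‖ ≤ R)
    (hY : Integrable Y P) (hT : Integrable T P) (hS : SteinIdentity P V Y T) (l : ℝ)
    {f : E → ℝ} (hf : ContDiff ℝ (⊤ : ℕ∞) f) (hfc : HasCompactSupport f) :
    ∫ x, f (l • V x.1 + x.2) • rescaledVelocity (P.map V) l (l • V x.1 + x.2)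
        ∂(P.prod (stdGaussian E)) =
      ∫ x, f (l • V x.1 + x.2) • (Y x.1 + l • (ContinuousLinearMap.adjoint (T x.1) x.2 - x.2))
        ∂(P.prod (stdGaussian E)) := by
  have hVp : IsProbabilityMeasure (P.map V) := Measure.isProbabilityMeasure_map hV.aemeasurable
  have hμ := ae_norm_le_map hV hVR
  have hfcont := hf.continuous
  obtain ⟨B, hB⟩ := hfc.exists_bound_of_continuous hfcont
  have hbc : Continuous (condField (P.map V) l) :=
    (continuous_condField hμ hR).comp (by fun_prop : Continuous fun u : E => (l, u))
  have hfm : MemLp (fun x : Ω × E => f (l • V x.1 + x.2)) ⊤ (P.prod (stdGaussian E)) :=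
    memLp_top_of_bound (hfcont.measurable.comp (by fun_prop)).aestronglyMeasurable B
      (Eventually.of_forall fun x => hB _)
  have fint : ∀ {k : Ω × E → E}, Integrable k (P.prod (stdGaussian E)) →
      Integrable (fun x => f (l • V x.1 + x.2) • k x) (P.prod (stdGaussian E)) := fun hk =>
    hk.smul_of_top_right hfm
  have fint' : ∀ {k : Ω × E → ℝ}, Integrable k (P.prod (stdGaussian E)) →
      Integrable (fun x => f (l • V x.1 + x.2) * k x) (P.prod (stdGaussian E)) := fun hk =>
    hk.smul_of_top_right hfm
  have iV : Integrable V P := Integrable.of_bound hV.aestronglyMeasurable R hVR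
  have iV2 : Integrable (fun x : Ω × E => V x.1) (P.prod (stdGaussian E)) := iV.comp_fst _
  have iY2 : Integrable (fun x : Ω × E => Y x.1) (P.prod (stdGaussian E)) := hY.comp_fst _
  have iN := integrable_snd_stdGaussian (P := P) (E := E)
  have iT := integrable_adjoint_apply (P := P) (E := E) hT
  have ib : Integrable (fun x : Ω × E => condField (P.map V) l (l • V x.1 + x.2))
      (P.prod (stdGaussian E)) :=
    Integrable.of_bound (hbc.measurable.comp (by fun_prop)).aestronglyMeasurable R
      (Eventually.of_forall fun x => norm_condField_le hμ l _)
  -- replace the conditional expectation by `V`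
  have hV_cond : ∫ x, f (l • V x.1 + x.2) • (V x.1 - condField (P.map V) l (l • V x.1 + x.2))
      ∂(P.prod (stdGaussian E)) = 0 := by
    have h0 := integral_clm_sub_condField hμ hR l
      (F := fun u => f u • ContinuousLinearMap.id ℝ E) (by fun_prop) (M := B) (fun x => by
        rw [norm_smul]
        exact (mul_le_of_le_one_right (norm_nonneg _) ContinuousLinearMap.norm_id_le).trans (hB x))
    rw [← map_prod_stdGaussian hV, integral_map (by fun_prop)
      (Continuous.aestronglyMeasurable (by fun_prop))] at h0
    exact h0
  -- The Stein identity in `ω` with `n` frozen, applied to `v ↦ f (l • v + n)`, produces `l` times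
  -- the integral of `Df(U)(T w)`. Gaussian integration by parts in `n` with `ω` frozen turns that
  -- integral into the one of `f(U) ⟪N, T w⟫`.
  have key : ∫ x, f (l • V x.1 + x.2) • V x.1 ∂(P.prod (stdGaussian E)) =
      ∫ x, f (l • V x.1 + x.2) • (Y x.1 + l • ContinuousLinearMap.adjoint (T x.1) x.2)
        ∂(P.prod (stdGaussian E)) := by
    refine ext_inner_right ℝ fun w => ?_
    have iYT : Integrable (fun x : Ω × E => Y x.1 + l • ContinuousLinearMap.adjoint (T x.1) x.2)
      (P.prod (stdGaussian E)) := iY2.add (iT.smul l)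
    rw [real_inner_comm, ← integral_inner (fint iV2), real_inner_comm, ← integral_inner (fint iYT)]
    have e1 : ∀ x : Ω × E, ⟪w, f (l • V x.1 + x.2) • V x.1⟫ =
        f (l • V x.1 + x.2) * ⟪V x.1, w⟫ := fun x => by
      rw [real_inner_smul_right, real_inner_comm]
    have e2 : ∀ x : Ω × E, ⟪w, f (l • V x.1 + x.2) •
        (Y x.1 + l • ContinuousLinearMap.adjoint (T x.1) x.2)⟫ =
        f (l • V x.1 + x.2) * ⟪Y x.1, w⟫ + l * (f (l • V x.1 + x.2) * ⟪x.2, T x.1 w⟫) := fun x => by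
      rw [real_inner_smul_right, real_inner_comm, inner_add_left, real_inner_smul_left,
        ContinuousLinearMap.adjoint_inner_left]
      ring
    simp_rw [e1, e2]
    have j1 : Integrable (fun x : Ω × E => f (l • V x.1 + x.2) * ⟪V x.1, w⟫)
        (P.prod (stdGaussian E)) := fint' (iV2.inner_const w)
    have j2 : Integrable (fun x : Ω × E => f (l • V x.1 + x.2) * ⟪Y x.1, w⟫)
        (P.prod (stdGaussian E)) := fint' (iY2.inner_const w)
    have j3 : Integrable (fun x : Ω × E => f (l • V x.1 + x.2) * ⟪x.2, T x.1 w⟫)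
        (P.prod (stdGaussian E)) := by
      refine fint' ((iT.inner_const w).congr (Eventually.of_forall fun x => ?_))
      exact ContinuousLinearMap.adjoint_inner_left _ _ _
    have hfd : Continuous (fderiv ℝ f) := hf.continuous_fderiv (by simp)
    obtain ⟨B', hB'⟩ := (hfc.fderiv (𝕜 := ℝ)).exists_bound_of_continuous hfd
    have iTw : Integrable (fun x : Ω × E => T x.1 w) (P.prod (stdGaussian E)) :=
      (hT.apply_continuousLinearMap w).comp_fst _
    have j4 : Integrable (fun x : Ω × E => fderiv ℝ f (l • V x.1 + x.2) (T x.1 w))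
        (P.prod (stdGaussian E)) := by
      refine (iTw.norm.const_mul B').mono' ?_ (Eventually.of_forall fun x => ?_)
      · exact ContinuousLinearMap.aestronglyMeasurable_comp₂ (ContinuousLinearMap.id ℝ (E →L[ℝ] ℝ))
          (hfd.comp_aestronglyMeasurable (Measurable.aestronglyMeasurable (by fun_prop))) iTw.1
      · exact (ContinuousLinearMap.le_opNorm _ _).trans
          (mul_le_mul_of_nonneg_right (hB' _) (norm_nonneg _))
    rw [integral_add j2 (j3.const_mul l), integral_const_mul]
    rw [integral_prod_symm _ j1, integral_prod_symm _ j2, integral_prod _ j3]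
    have ibp : ∀ ω, ∫ n, f (l • V ω + n) * ⟪n, T ω w⟫ ∂(stdGaussian E) =
        ∫ n, fderiv ℝ f (l • V ω + n) (T ω w) ∂(stdGaussian E) := by
      intro ω
      have h1 : ContDiff ℝ (⊤ : ℕ∞) fun n => f (l • V ω + n) := hf.comp (contDiff_const.add contDiff_id)
      have h2 : HasCompactSupport fun n => f (l • V ω + n) :=
        hfc.comp_homeomorph (Homeomorph.addLeft (l • V ω))
      rw [← integral_fderiv_stdGaussian h1 h2]
      simp_rw [fderiv_comp_add_left]
    have stein : ∀ n, ∫ ω, f (l • V ω + n) * ⟪V ω, w⟫ ∂P = ∫ ω, f (l • V ω + n) * ⟪Y ω, w⟫ ∂P +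
        l * ∫ ω, fderiv ℝ f (l • V ω + n) (T ω w) ∂P := by
      intro n
      have h1 : ContDiff ℝ (⊤ : ℕ∞) fun v => f (l • v + n) :=
        hf.comp ((contDiff_id.const_smul l).add contDiff_const)
      have h2 := hS _ h1 w
      rw [h2, ← integral_const_mul]
      congr 2
      ext ω
      have h3 : HasFDerivAt (fun v : E => l • v + n) (l • ContinuousLinearMap.id ℝ E) (V ω) :=
        ((hasFDerivAt_id (V ω)).const_smul l).add_const n
      have h4 := (hf.differentiable (by simp) (l • V ω + n)).hasFDerivAt.comp (V ω) h3
      change fderiv ℝ (f ∘ fun v => l • v + n) (V ω) (T ω w) = _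
      rw [h4.fderiv]
      simp
    simp_rw [ibp, stein]
    rw [integral_add]
    · rw [integral_const_mul]
      congr 2
      rw [← integral_prod_symm _ j4, ← integral_prod _ j4]
    · exact j2.integral_prod_right
    · exact j4.integral_prod_right.const_mul l
  -- With `u = l V + n` and `b` the field at `u`, one has `(1 + l²) b - l u = V - l n - (1 + l²)(V -
  -- b)`, and the last term integrates to zero against `f(U)`.
  have eL : ∀ x : Ω × E, f (l • V x.1 + x.2) • rescaledVelocity (P.map V) l (l • V x.1 + x.2) =
      f (l • V x.1 + x.2) • V x.1 - f (l • V x.1 + x.2) • (l • x.2) -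
      (1 + l ^ 2) • (f (l • V x.1 + x.2) • (V x.1 - condField (P.map V) l (l • V x.1 + x.2))) := by
    intro x
    rw [rescaledVelocity]
    module
  have eR : ∀ x : Ω × E, f (l • V x.1 + x.2) •
      (Y x.1 + l • (ContinuousLinearMap.adjoint (T x.1) x.2 - x.2)) =
      f (l • V x.1 + x.2) • (Y x.1 + l • ContinuousLinearMap.adjoint (T x.1) x.2) -
        f (l • V x.1 + x.2) • (l • x.2) := by
    intro x
    module
  simp_rw [eL, eR]
  have k1 : Integrable (fun x : Ω × E => f (l • V x.1 + x.2) • (l • x.2))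
      (P.prod (stdGaussian E)) := fint (iN.smul l)
  have k2 : Integrable (fun x : Ω × E => f (l • V x.1 + x.2) • V x.1 -
      f (l • V x.1 + x.2) • (l • x.2)) (P.prod (stdGaussian E)) := (fint iV2).sub k1
  have k3 : Integrable (fun x : Ω × E => (1 + l ^ 2) • (f (l • V x.1 + x.2) •
      (V x.1 - condField (P.map V) l (l • V x.1 + x.2)))) (P.prod (stdGaussian E)) :=
    (fint (iV2.sub ib)).smul _
  have k4 : Integrable (fun x : Ω × E => f (l • V x.1 + x.2) •
      (Y x.1 + l • ContinuousLinearMap.adjoint (T x.1) x.2)) (P.prod (stdGaussian E)) :=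
    fint (iY2.add (iT.smul l))
  rw [integral_sub k2 k3, integral_sub (fint iV2) k1, integral_smul, hV_cond, smul_zero, sub_zero,
    key, integral_sub k4 k1]

/-- Conditional Jensen inequality for `Y + l (T* N - N)`, followed by the triangle inequality. The
map `S` is applied before taking norms, so that in the end the remainder `Σ⁻¹ Z` costs `‖Z‖` and not
`‖Σ‖ ‖Σ⁻¹ Z‖`. -/
theorem eLpNorm_rescaledVelocity_le (hV : Measurable V) (hR : 0 ≤ R) (hVR : ∀ᵐ ω ∂P, ‖V ω‖ ≤ R)
    (hY : Integrable Y P) (hT : Integrable T P) (hS : SteinIdentity P V Y T) {l : ℝ} (hl : 0 ≤ l)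
    (S : E →L[ℝ] E) {p : ℝ≥0∞} (hp : 1 ≤ p) :
    eLpNorm (fun x => S (rescaledVelocity (P.map V) l (l • V x.1 + x.2))) p
        (P.prod (stdGaussian E)) ≤
      eLpNorm (fun ω => S (Y ω)) p P + ENNReal.ofReal l *
        eLpNorm (fun x => S (ContinuousLinearMap.adjoint (T x.1) x.2 - x.2)) p
          (P.prod (stdGaussian E)) := by
  have hVp : IsProbabilityMeasure (P.map V) := Measure.isProbabilityMeasure_map hV.aemeasurable
  have hμ := ae_norm_le_map hV hVR
  have iY2 : Integrable (fun x : Ω × E => Y x.1) (P.prod (stdGaussian E)) := hY.comp_fst _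
  have iV2 : Integrable (fun x : Ω × E => V x.1) (P.prod (stdGaussian E)) :=
    (Integrable.of_bound hV.aestronglyMeasurable R hVR).comp_fst _
  have iN := integrable_snd_stdGaussian (P := P) (E := E)
  have iT := integrable_adjoint_apply (P := P) (E := E) hT
  have hcc : Continuous (rescaledVelocity (P.map V) l) :=
    (continuous_rescaledVelocity hμ hR).comp (by fun_prop : Continuous fun u : E => (l, u))
  have hbc : Continuous (condField (P.map V) l) :=
    (continuous_condField hμ hR).comp (by fun_prop : Continuous fun u : E => (l, u))
  have ib : Integrable (fun x : Ω × E => condField (P.map V) l (l • V x.1 + x.2))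
      (P.prod (stdGaussian E)) :=
    Integrable.of_bound (hbc.measurable.comp (by fun_prop)).aestronglyMeasurable R
      (Eventually.of_forall fun x => norm_condField_le hμ l _)
  have ic : Integrable (fun x : Ω × E => rescaledVelocity (P.map V) l (l • V x.1 + x.2))
      (P.prod (stdGaussian E)) := (ib.smul (1 + l ^ 2)).sub (((iV2.smul l).add iN).smul l)
  have iH : Integrable (fun x : Ω × E => Y x.1 +
      l • (ContinuousLinearMap.adjoint (T x.1) x.2 - x.2)) (P.prod (stdGaussian E)) :=
    iY2.add ((iT.sub iN).smul l)
  have h1 := eLpNorm_comp_le_of_integral_smul_eq (ρ := P.prod (stdGaussian E))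
    (U := fun x : Ω × E => l • V x.1 + x.2) (by fun_prop)
    (c := fun u => S (rescaledVelocity (P.map V) l u)) (by fun_prop)
    (S.integrable_comp ic) (S.integrable_comp iH) (fun f hf hfc => by
      obtain ⟨B, hB⟩ := hfc.exists_bound_of_continuous hf.continuous
      have hfm : MemLp (fun x : Ω × E => f (l • V x.1 + x.2)) ⊤ (P.prod (stdGaussian E)) :=
        memLp_top_of_bound (hf.continuous.measurable.comp (by fun_prop)).aestronglyMeasurable B
          (Eventually.of_forall fun x => hB _)
      simp_rw [← map_smul]
      have k1 : Integrable (fun x : Ω × E => f (l • V x.1 + x.2) •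
          rescaledVelocity (P.map V) l (l • V x.1 + x.2)) (P.prod (stdGaussian E)) :=
        ic.smul_of_top_right hfm
      have k2 : Integrable (fun x : Ω × E => f (l • V x.1 + x.2) •
          (Y x.1 + l • (ContinuousLinearMap.adjoint (T x.1) x.2 - x.2))) (P.prod (stdGaussian E)) :=
        iH.smul_of_top_right hfm
      rw [S.integral_comp_comm k1, S.integral_comp_comm k2]
      congr 1
      exact integral_smul_rescaledVelocity hV hR hVR hY hT hS l hf hfc) hp
  refine h1.trans ?_
  have e : (fun x : Ω × E => S (Y x.1 + l • (ContinuousLinearMap.adjoint (T x.1) x.2 - x.2))) =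
      (fun x : Ω × E => S (Y x.1)) +
        l • fun x : Ω × E => S (ContinuousLinearMap.adjoint (T x.1) x.2 - x.2) := by
    ext x
    simp
  have iK : Integrable (fun x : Ω × E => S (ContinuousLinearMap.adjoint (T x.1) x.2 - x.2))
      (P.prod (stdGaussian E)) := S.integrable_comp (iT.sub iN)
  have eY : eLpNorm (fun x : Ω × E => S (Y x.1)) p (P.prod (stdGaussian E)) =
      eLpNorm (fun ω => S (Y ω)) p P :=
    eLpNorm_comp_measurePreserving (g := fun ω => S (Y ω)) (S.integrable_comp hY).1
      (measurePreserving_fst (μ := P) (ν := stdGaussian E))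
  rw [e, ← eY]
  refine (eLpNorm_add_le (S.integrable_comp iY2).1 (iK.1.const_smul l) hp).trans ?_
  rw [eLpNorm_const_smul, Real.enorm_eq_ofReal hl]

end ConditionalVelocity

/-! ### Minkowski's integral inequality -/

section Minkowski

/-- A form of Minkowski's integral inequality. -/
theorem eLpNorm_le_of_enorm_le_lintegral {X Y F : Type*} [MeasurableSpace X] [MeasurableSpace Y]
    [NormedAddCommGroup F] {ρ : Measure X} [SFinite ρ] {θ : Measure Y} [IsFiniteMeasure θ] {p : ℝ}
    (hp : 1 ≤ p) {G : X → Y → ℝ≥0∞} (hG : Measurable (Function.uncurry G))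
    (h1 : ∀ᵐ y ∂θ, ∫⁻ x, G x y ^ p ∂ρ ≤ 1) {f : X → F} (hf : ∀ x, ‖f x‖ₑ ≤ ∫⁻ y, G x y ∂θ) :
    eLpNorm f (ENNReal.ofReal p) ρ ≤ θ Set.univ := by
  have hp0 : 0 < p := by linarith
  have hofp : (ENNReal.ofReal p).toReal = p := ENNReal.toReal_ofReal hp0.le
  have hofp0 : ENNReal.ofReal p ≠ 0 := by simpa using hp0
  -- Hölder's inequality for the finite measure `θ`. All the weight of the integrand sits in `θ`,
  -- and the slices of `G` are normalised in `L^p`.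
  have hpw : ∀ x, ‖f x‖ₑ ^ p ≤ (∫⁻ y, G x y ^ p ∂θ) * θ Set.univ ^ (p - 1) := by
    intro x
    have hm : Measurable (G x) := hG.of_uncurry_left
    have h := eLpNorm_le_eLpNorm_mul_rpow_measure_univ (μ := θ) (f := G x)
      (p := 1) (q := ENNReal.ofReal p) (by simpa using hp) hm.aestronglyMeasurable
    rw [eLpNorm_one_eq_lintegral_enorm, eLpNorm_eq_lintegral_rpow_enorm_toReal hofp0 (by simp),
      hofp] at h
    simp only [enorm_eq_self, ENNReal.toReal_one, div_one] at h
    calc ‖f x‖ₑ ^ p ≤ ((∫⁻ y, G x y ^ p ∂θ) ^ (1 / p) * θ Set.univ ^ (1 - 1 / p)) ^ p :=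
          ENNReal.rpow_le_rpow ((hf x).trans h) hp0.le
      _ = _ := by
          rw [ENNReal.mul_rpow_of_nonneg _ _ hp0.le, ← ENNReal.rpow_mul, ← ENNReal.rpow_mul,
            one_div_mul_cancel hp0.ne', ENNReal.rpow_one, sub_mul, one_mul,
            one_div_mul_cancel hp0.ne']
  rw [eLpNorm_eq_lintegral_rpow_enorm_toReal hofp0 (by simp), hofp, one_div, ENNReal.rpow_inv_le_iff hp0]
  calc ∫⁻ x, ‖f x‖ₑ ^ p ∂ρ ≤ ∫⁻ x, (∫⁻ y, G x y ^ p ∂θ) * θ Set.univ ^ (p - 1) ∂ρ :=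
        lintegral_mono hpw
    _ = (∫⁻ x, ∫⁻ y, G x y ^ p ∂θ ∂ρ) * θ Set.univ ^ (p - 1) :=
        lintegral_mul_const _ (Measurable.lintegral_prod_right'
          (f := fun z : X × Y => G z.1 z.2 ^ p) (hG.pow_const p))
    _ = (∫⁻ y, ∫⁻ x, G x y ^ p ∂ρ ∂θ) * θ Set.univ ^ (p - 1) := by
        rw [lintegral_lintegral_swap]
        exact (hG.pow_const p).aemeasurable
    _ ≤ (∫⁻ _, 1 ∂θ) * θ Set.univ ^ (p - 1) := by
        gcongr ?_ * _
        exact lintegral_mono_ae h1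
    _ = θ Set.univ ^ p := by
        rw [lintegral_one]
        rcases eq_or_ne (θ Set.univ) 0 with h0 | h0
        · rw [h0, zero_mul, ENNReal.zero_rpow_of_pos hp0]
        · nth_rw 1 [← ENNReal.rpow_one (θ Set.univ)]
          rw [← ENNReal.rpow_add _ _ h0 (measure_ne_top _ _), add_sub_cancel]

end Minkowski

/-! ### Elementary properties of the Wasserstein distance -/

section Wasserstein

variable {E : Type*} [NormedAddCommGroup E] [MeasurableSpace E] [BorelSpace E]
  [SecondCountableTopology E] {p : ℝ}

theorem lintegral_rpow_eq_eLpNorm {α F : Type*} [MeasurableSpace α] [NormedAddCommGroup F]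
    {ρ : Measure α} (hp : 1 ≤ p) (f : α → F) :
    (∫⁻ z, ‖f z‖ₑ ^ p ∂ρ) ^ (1 / p) = eLpNorm f (ENNReal.ofReal p) ρ := by
  have hp0 : 0 < p := by linarith
  rw [eLpNorm_eq_lintegral_rpow_enorm_toReal (by simpa using hp0) (by simp),
    ENNReal.toReal_ofReal hp0.le]

theorem wassersteinDist_le_of_coupling (hp : 1 ≤ p) {μ ν : Measure E} {π : Measure (E × E)}
    (h1 : π.map Prod.fst = μ) (h2 : π.map Prod.snd = ν) :
    wassersteinDist p μ ν ≤ eLpNorm (fun z => z.1 - z.2) (ENNReal.ofReal p) π := by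
  rw [← lintegral_rpow_eq_eLpNorm hp]
  exact iInf_le_of_le π (iInf₂_le h1 h2)

theorem wassersteinDist_map_le (hp : 1 ≤ p) {α : Type*} [MeasurableSpace α] {ρ : Measure α}
    {f g : α → E} (hf : AEMeasurable f ρ) (hg : AEMeasurable g ρ) :
    wassersteinDist p (ρ.map f) (ρ.map g) ≤ eLpNorm (fun x => f x - g x) (ENNReal.ofReal p) ρ := by
  refine (wassersteinDist_le_of_coupling hp (π := ρ.map fun x => (f x, g x)) ?_ ?_).trans_eq ?_
  · rw [AEMeasurable.map_map_of_aemeasurable (by fun_prop) (by fun_prop)]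
    rfl
  · rw [AEMeasurable.map_map_of_aemeasurable (by fun_prop) (by fun_prop)]
    rfl
  · rw [eLpNorm_map_measure (by fun_prop) (by fun_prop)]
    rfl

theorem le_wassersteinDist (hp : 1 ≤ p) {μ ν : Measure E} {a : ℝ≥0∞}
    (h : ∀ π : Measure (E × E), π.map Prod.fst = μ → π.map Prod.snd = ν →
      a ≤ eLpNorm (fun z => z.1 - z.2) (ENNReal.ofReal p) π) : a ≤ wassersteinDist p μ ν := by
  refine le_iInf fun π => le_iInf₂ fun h1 h2 => ?_
  rw [lintegral_rpow_eq_eLpNorm hp]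
  exact h π h1 h2

/-- The triangle inequality in `L^p` of any coupling. It serves to bound the moments of the
truncated vectors. -/
theorem eLpNorm_id_le_wassersteinDist_add (hp : 1 ≤ p) (μ ν : Measure E) :
    eLpNorm id (ENNReal.ofReal p) μ ≤ wassersteinDist p μ ν + eLpNorm id (ENNReal.ofReal p) ν := by
  rw [← tsub_le_iff_right]
  refine le_wassersteinDist hp fun π h1 h2 => ?_
  rw [tsub_le_iff_right, ← h1, ← h2, eLpNorm_map_measure (by fun_prop) (by fun_prop),
    eLpNorm_map_measure (by fun_prop) (by fun_prop)]
  refine le_trans (le_of_eq ?_) (eLpNorm_add_le (f := fun z : E × E => z.1 - z.2)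
    (g := fun z : E × E => z.2) (by fun_prop) (by fun_prop) (by simpa using hp))
  congr 1
  ext z
  simp

/-- Couplings can be glued along a common marginal. -/
theorem wassersteinDist_triangle [StandardBorelSpace E] (hp : 1 ≤ p) (μ ν ρ : Measure E)
    [IsFiniteMeasure ν] :
    wassersteinDist p μ ρ ≤ wassersteinDist p μ ν + wassersteinDist p ν ρ := by
  rw [← tsub_le_iff_right]
  refine le_wassersteinDist hp fun π₁ h1 h2 => ?_
  rw [tsub_le_iff_left, ← tsub_le_iff_right]
  refine le_wassersteinDist hp fun π₂ h3 h4 => ?_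
  rw [tsub_le_iff_right, add_comm]
  have fin1 : IsFiniteMeasure π₁ := by
    have : IsFiniteMeasure (π₁.map Prod.snd) := by rwa [h2]
    exact Measure.isFiniteMeasure_of_map (f := Prod.snd) (by fun_prop)
  have fin2 : IsFiniteMeasure π₂ := by
    have : IsFiniteMeasure (π₂.map Prod.fst) := by rwa [h3]
    exact Measure.isFiniteMeasure_of_map (f := Prod.fst) (by fun_prop)
  -- The third coordinate is drawn from the conditional law of `π₂` given the middle one,
  -- independently of the first. The last two coordinates then have law `π₂`, since the middle one
  -- has the common marginal `ν`.
  set π : Measure ((E × E) × E) := π₁.compProd (Kernel.prodMkLeft E π₂.condKernel) with hπ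
  have m1 : π.map Prod.fst = π₁ := Measure.fst_compProd _ _
  have m2 : π.map (fun z => (z.1.2, z.2)) = π₂ := by
    conv_rhs => rw [← π₂.disintegrate π₂.condKernel, Measure.fst, h3, ← h2]
    refine Measure.ext_of_lintegral _ fun f hf => ?_
    rw [lintegral_map hf (by fun_prop), hπ, Measure.lintegral_compProd (by fun_prop),
      Measure.lintegral_compProd hf, lintegral_map (by fun_prop) (by fun_prop)]
    rfl
  refine (wassersteinDist_le_of_coupling hp (π := π.map fun z => (z.1.1, z.2)) ?_ ?_).trans ?_
  · rw [Measure.map_map (by fun_prop) (by fun_prop), ← h1, ← m1,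
      Measure.map_map (by fun_prop) (by fun_prop)]
    rfl
  · rw [Measure.map_map (by fun_prop) (by fun_prop), ← h4, ← m2,
      Measure.map_map (by fun_prop) (by fun_prop)]
    rfl
  · rw [eLpNorm_map_measure (by fun_prop) (by fun_prop), ← m1]
    conv_rhs => rw [← m2]
    rw [m1, eLpNorm_map_measure (by fun_prop) (by fun_prop)]
    conv_rhs => rw [← m1]
    rw [eLpNorm_map_measure (by fun_prop) (by fun_prop)]
    refine le_trans (le_of_eq ?_) (eLpNorm_add_le (by fun_prop) (by fun_prop) (by simpa using hp))
    congr 1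
    ext z
    simp

end Wasserstein

/-! ### The Wasserstein bound for bounded vectors -/

section GaussianCoupling

open scoped RealInnerProductSpace

/-- The normalisation for which `flowScale l • (l • v + n)` is a rotation of `(v, n)`. -/
noncomputable def flowScale (l : ℝ) : ℝ := (Real.sqrt (1 + l ^ 2))⁻¹

theorem flowScale_pos (l : ℝ) : 0 < flowScale l := by
  unfold flowScale
  positivity

theorem flowScale_zero : flowScale 0 = 1 := by simp [flowScale]

theorem continuous_flowScale : Continuous flowScale := by
  unfold flowScale
  exact (by fun_prop : Continuous fun l : ℝ => Real.sqrt (1 + l ^ 2)).inv₀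
    fun l => (Real.sqrt_pos.2 (by positivity)).ne'

theorem one_add_sq_mul_flowScale_sq (l : ℝ) : (1 + l ^ 2) * flowScale l ^ 2 = 1 := by
  have h : 0 < 1 + l ^ 2 := by positivity
  rw [flowScale, inv_pow, Real.sq_sqrt h.le, mul_inv_cancel₀ h.ne']

theorem hasDerivAt_flowScale (l : ℝ) : HasDerivAt flowScale (-(l * flowScale l ^ 3)) l := by
  have h : 0 < 1 + l ^ 2 := by positivity
  have h1 : HasDerivAt (fun l : ℝ => 1 + l ^ 2) (2 * l) l := by
    simpa using (hasDerivAt_pow 2 l).const_add 1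
  have h2 := (h1.sqrt h.ne').inv (Real.sqrt_pos.2 h).ne'
  refine h2.congr_deriv ?_
  rw [flowScale]
  have := (Real.sqrt_pos.2 h).ne'
  field_simp

theorem hasDerivAt_mul_flowScale (l : ℝ) :
    HasDerivAt (fun l => l * flowScale l) (flowScale l ^ 3) l := by
  refine ((hasDerivAt_id l).mul (hasDerivAt_flowScale l)).congr_deriv ?_
  simp only [id]
  linear_combination (-flowScale l) * one_add_sq_mul_flowScale_sq l

theorem mul_flowScale_le_one (l : ℝ) : l * flowScale l ≤ 1 := by
  have := one_add_sq_mul_flowScale_sq l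
  nlinarith [sq_nonneg (l * flowScale l - 1), sq_nonneg (flowScale l)]

variable {E : Type*} [NormedAddCommGroup E] [InnerProductSpace ℝ E] [FiniteDimensional ℝ E]
  [MeasurableSpace E] [BorelSpace E]

/-- With `l = tan t` the integrand becomes `a cos t + b sin t`. In the variable `l`, an
antiderivative is `a l s - b s` with `s = flowScale l`. -/
theorem integral_flowScale_weight (a b L : ℝ) :
    ∫ l in (0 : ℝ)..L, flowScale l ^ 3 * (a + l * b) =
      a * (L * flowScale L) + b * (1 - flowScale L) := by
  have hc := continuous_flowScale
  rw [intervalIntegral.integral_eq_sub_of_hasDerivAt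
    (f := fun l => a * (l * flowScale l) - b * flowScale l)]
  · simp [flowScale_zero]
    ring
  · intro l _
    refine (((hasDerivAt_mul_flowScale l).const_mul a).sub
      ((hasDerivAt_flowScale l).const_mul b)).congr_deriv ?_
    ring
  · exact (by fun_prop : Continuous fun l => flowScale l ^ 3 * (a + l * b)).intervalIntegrable _ _

variable {Ω : Type*} [MeasurableSpace Ω] {P : Measure Ω} [IsProbabilityMeasure P]
  {V Y : Ω → E} {T : Ω → E →L[ℝ] E} {R : ℝ}

/-- The cost of the coupling by the flow, up to a finite time. -/
theorem wassersteinDist_flow_le (hV : Measurable V) (hR : 0 ≤ R) (hVR : ∀ᵐ ω ∂P, ‖V ω‖ ≤ R)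
    (hY : Integrable Y P) (hT : Integrable T P) (hS : SteinIdentity P V Y T) {L : ℝ} (hL : 0 ≤ L)
    (S : E →L[ℝ] E) {p : ℝ} (hp : 1 ≤ p) :
    wassersteinDist p ((P.prod (stdGaussian E)).map
        fun x => S (flowScale L • (L • V x.1 + x.2))) ((stdGaussian E).map S) ≤
      eLpNorm (fun ω => S (Y ω)) (ENNReal.ofReal p) P +
        eLpNorm (fun x => S (ContinuousLinearMap.adjoint (T x.1) x.2 - x.2)) (ENNReal.ofReal p)
          (P.prod (stdGaussian E)) := by
  have hp0 : 0 < p := by linarith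
  have hp1 : 1 ≤ ENNReal.ofReal p := by simpa using hp
  set K₁ := eLpNorm (fun ω => S (Y ω)) (ENNReal.ofReal p) P with hK₁
  set K₂ := eLpNorm (fun x => S (ContinuousLinearMap.adjoint (T x.1) x.2 - x.2))
    (ENNReal.ofReal p) (P.prod (stdGaussian E)) with hK₂
  rcases eq_or_ne K₁ ⊤ with h1 | h1
  · simp [h1]
  rcases eq_or_ne K₂ ⊤ with h2 | h2
  · simp [h2]
  have hVp : IsProbabilityMeasure (P.map V) := Measure.isProbabilityMeasure_map hV.aemeasurable
  have hμ := ae_norm_le_map hV hVR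
  have hvel : ∀ l, 0 ≤ l → eLpNorm (fun x => S (rescaledVelocity (P.map V) l (l • V x.1 + x.2)))
      (ENNReal.ofReal p) (P.prod (stdGaussian E)) ≤ K₁ + ENNReal.ofReal l * K₂ := fun l hl =>
    eLpNorm_rescaledVelocity_le hV hR hVR hY hT hS hl S hp1
  obtain ⟨φ₀, h0, hd, hm, hlaw⟩ := exists_flow_condField hμ hR hL
  -- Freezing the flow outside `[0, L]` makes it continuous on the whole line in `t` and measurable
  -- in `x`, hence jointly measurable.
  set φ : E → ℝ → E := fun x t => φ₀ x (Set.projIcc 0 L hL t) with hφ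
  have hφe : ∀ x, ∀ t ∈ Set.Icc 0 L, φ x t = φ₀ x t := fun x t ht => by
    rw [hφ]
    simp only
    rw [Set.projIcc_of_mem hL ht]
  have hφc : ∀ x, Continuous (φ x) := fun x => by
    have : ContinuousOn (φ₀ x) (Set.Icc 0 L) := fun t ht => (hd x t ht).continuousWithinAt
    exact this.domRestrict.comp continuous_projIcc
  have hφm : ∀ t, Measurable fun x => φ x t := fun t => hm _ (Set.projIcc 0 L hL t).2
  have hφd : ∀ x, ∀ t ∈ Set.Ioo 0 L, HasDerivAt (φ x) (condField (P.map V) t (φ x t)) t := by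
    intro x t ht
    have hmem := Icc_mem_nhds ht.1 ht.2
    rw [hφe x t (Set.Ioo_subset_Icc_self ht)]
    refine ((hd x t (Set.Ioo_subset_Icc_self ht)).hasDerivAt hmem).congr_of_eventuallyEq ?_
    filter_upwards [hmem] with s hs using hφe x s hs
  have hφjm : Measurable fun z : E × ℝ => φ z.1 z.2 := by
    have := measurable_uncurry_of_continuous_of_measurable (u := fun t x => φ x t) hφc hφm
    exact this.comp measurable_swap
  have hcc := continuous_rescaledVelocity hμ hR
  have hsc := continuous_flowScale
  have hlaw' : ∀ t ∈ Set.Icc 0 L, (stdGaussian E).map (fun x => φ x t) =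
      (P.prod (stdGaussian E)).map (fun x => t • V x.1 + x.2) := by
    intro t ht
    have : (fun x => φ x t) = fun x => φ₀ x t := funext fun x => hφe x t ht
    rw [this, hlaw t ht, ← map_prod_stdGaussian hV, Measure.map_map (by fun_prop) (by fun_prop)]
    rfl
  have hLmem : L ∈ Set.Icc 0 L := ⟨hL, le_rfl⟩
  -- the coupling
  have hcoup : wassersteinDist p ((P.prod (stdGaussian E)).map
        fun x => S (flowScale L • (L • V x.1 + x.2))) ((stdGaussian E).map S) ≤
      eLpNorm (fun x => S (flowScale L • φ x L) - S x) (ENNReal.ofReal p) (stdGaussian E) := by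
    have e : (P.prod (stdGaussian E)).map (fun x => S (flowScale L • (L • V x.1 + x.2))) =
        (stdGaussian E).map fun x => S (flowScale L • φ x L) := by
      have h3 : (fun x : Ω × E => S (flowScale L • (L • V x.1 + x.2))) =
        (fun u => S (flowScale L • u)) ∘ fun x : Ω × E => L • V x.1 + x.2 := rfl
      rw [h3, ← Measure.map_map (by fun_prop) (by fun_prop), ← hlaw' L hLmem,
        Measure.map_map (by fun_prop) (hφm L)]
      rfl
    rw [e]
    have := hφm L
    exact wassersteinDist_map_le hp (by fun_prop) (by fun_prop)
  refine hcoup.trans ?_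
  -- The slack `ε` makes `a` positive, so that the bound `a + l b` on the velocity can be divided
  -- out.
  refine ENNReal.le_of_forall_pos_le_add fun ε hε _ => ?_
  set a : ℝ := K₁.toReal + ε with ha
  set b : ℝ := K₂.toReal with hb
  have hb0 : 0 ≤ b := ENNReal.toReal_nonneg
  have ha0 : 0 < a := add_pos_of_nonneg_of_pos ENNReal.toReal_nonneg (by exact_mod_cast hε)
  have hab : ∀ l ∈ Set.Icc 0 L, 0 < a + l * b := fun l hl => by
    have := mul_nonneg hl.1 hb0
    linarith
  set θ : Measure ℝ := (volume.restrict (Set.Ioc 0 L)).withDensity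
    fun l => ENNReal.ofReal (flowScale l ^ 3 * (a + l * b)) with hθ
  have hθm : Measurable fun l => ENNReal.ofReal (flowScale l ^ 3 * (a + l * b)) := by fun_prop
  have hwc : Continuous fun l => flowScale l ^ 3 * (a + l * b) := by fun_prop
  have hθu : θ Set.univ ≤ K₁ + K₂ + ε := by
    rw [hθ, withDensity_apply _ MeasurableSet.univ, Measure.restrict_univ,
      ← ofReal_integral_eq_lintegral_ofReal (hwc.integrableOn_Ioc), ← intervalIntegral.integral_of_le hL,
      integral_flowScale_weight]
    · have e : K₁ + K₂ + ε = ENNReal.ofReal (a + b) := by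
        rw [ENNReal.ofReal_add ha0.le hb0, ha, ENNReal.ofReal_add ENNReal.toReal_nonneg ε.coe_nonneg, hb,
          ENNReal.ofReal_toReal h1, ENNReal.ofReal_toReal h2, ENNReal.ofReal_coe_nnreal]
        ring
      rw [e]
      refine ENNReal.ofReal_le_ofReal ?_
      have := mul_flowScale_le_one L
      have := flowScale_pos L
      nlinarith
    · filter_upwards [ae_restrict_mem measurableSet_Ioc] with l hl
      exact mul_nonneg (pow_nonneg (flowScale_pos l).le 3) (hab l ⟨hl.1.le, hl.2⟩).le
  have hθfin : IsFiniteMeasure θ := ⟨hθu.trans_lt (by simp [h1, h2, lt_top_iff_ne_top])⟩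
  -- `G` is the velocity divided by its bound `a + l b`, hence of norm at most `1` in `L^p`; the
  -- bound and the factor `flowScale l ^ 3` are carried by `θ`.
  refine le_trans (eLpNorm_le_of_enorm_le_lintegral (θ := θ) hp
    (G := fun x l => ENNReal.ofReal (a + l * b)⁻¹ * ‖S (rescaledVelocity (P.map V) l (φ x l))‖ₑ)
    ?_ ?_ ?_) hθu
  · have h3 : Measurable fun z : E × ℝ => S (rescaledVelocity (P.map V) z.2 (φ z.1 z.2)) :=
      (S.continuous.comp hcc).measurable.comp (measurable_snd.prodMk hφjm)
    exact Measurable.mul (by fun_prop) h3.enorm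
  · rw [hθ, ae_withDensity_iff hθm]
    filter_upwards [ae_restrict_mem measurableSet_Ioc] with l hl _
    have hl' : l ∈ Set.Icc 0 L := ⟨hl.1.le, hl.2⟩
    have hlc : Continuous fun u => S (rescaledVelocity (P.map V) l u) :=
      S.continuous.comp (hcc.comp (by fun_prop : Continuous fun u : E => (l, u)))
    have e1 : eLpNorm (fun x => S (rescaledVelocity (P.map V) l (φ x l))) (ENNReal.ofReal p)
        (stdGaussian E) ≤ ENNReal.ofReal (a + l * b) := by
      have e2 := eLpNorm_map_measure (p := ENNReal.ofReal p) (μ := stdGaussian E)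
        (f := fun x => φ x l) hlc.aestronglyMeasurable (hφm l).aemeasurable
      have e3 := eLpNorm_map_measure (p := ENNReal.ofReal p) (μ := P.prod (stdGaussian E))
        (f := fun x => l • V x.1 + x.2) hlc.aestronglyMeasurable (by fun_prop)
      rw [hlaw' l hl', e3] at e2
      have e4 := hvel l hl'.1
      change eLpNorm _ _ _ = eLpNorm _ _ _ at e2
      refine (le_of_eq e2.symm).trans (e4.trans ?_)
      rw [ENNReal.ofReal_add ha0.le (mul_nonneg hl'.1 hb0), ENNReal.ofReal_mul hl'.1, hb,
        ENNReal.ofReal_toReal h2]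
      gcongr
      rw [ha, ENNReal.ofReal_add ENNReal.toReal_nonneg ε.coe_nonneg, ENNReal.ofReal_toReal h1]
      exact le_self_add
    rw [← lintegral_rpow_eq_eLpNorm hp, one_div, ENNReal.rpow_inv_le_iff hp0] at e1
    simp_rw [ENNReal.mul_rpow_of_nonneg _ _ hp0.le]
    rw [lintegral_const_mul' _ _ (ENNReal.rpow_ne_top_of_nonneg hp0.le ENNReal.ofReal_ne_top)]
    calc _ ≤ ENNReal.ofReal (a + l * b)⁻¹ ^ p * ENNReal.ofReal (a + l * b) ^ p := by gcongr
      _ = 1 := by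
        rw [← ENNReal.mul_rpow_of_nonneg _ _ hp0.le,
          ← ENNReal.ofReal_mul (inv_nonneg.2 (hab l hl').le), inv_mul_cancel₀ (hab l hl').ne',
          ENNReal.ofReal_one, ENNReal.one_rpow]
  · intro x
    have hvc : Continuous fun l => flowScale l ^ 3 • S (rescaledVelocity (P.map V) l (φ x l)) := by
      have h3 : Continuous fun l => S (rescaledVelocity (P.map V) l (φ x l)) :=
        (S.continuous.comp hcc).comp (continuous_id.prodMk (hφc x))
      fun_prop
    -- The displacement along a trajectory is the integral of its velocity. Since `s' = -l s³` and
    -- `s = s³ (1 + l²)` for `s = flowScale l`, the derivative of `s • φ` is `s³` times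
    -- `rescaledVelocity`.
    have ftc := intervalIntegral.integral_eq_sub_of_hasDerivAt_of_le
      (f := fun l => S (flowScale l • φ x l))
      (f' := fun l => flowScale l ^ 3 • S (rescaledVelocity (P.map V) l (φ x l))) hL
      (by have := hφc x; fun_prop) (fun l hl => by
        have h3 := S.hasFDerivAt.comp_hasDerivAt l ((hasDerivAt_flowScale l).smul (hφd x l hl))
        refine h3.congr_deriv ?_
        rw [← map_smul, rescaledVelocity]
        congr 1
        have h4 := one_add_sq_mul_flowScale_sq l
        have h5 : flowScale l = flowScale l ^ 3 * (1 + l ^ 2) := by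
          linear_combination (-flowScale l) * h4
        rw [smul_sub, smul_smul, ← h5]
        module) (hvc.intervalIntegrable _ _)
    have hx0 : φ x 0 = x := by rw [hφe x 0 ⟨le_rfl, hL⟩]; exact h0 x
    simp only [flowScale_zero, one_smul, hx0] at ftc
    rw [← ftc, intervalIntegral.integral_of_le hL]
    refine (enorm_integral_le_lintegral_enorm _).trans ?_
    rw [hθ, lintegral_withDensity_eq_lintegral_mul_non_measurable _ hθm (by simp)]
    refine lintegral_mono_ae ?_
    filter_upwards [ae_restrict_mem measurableSet_Ioc] with l hl
    have hl' : l ∈ Set.Icc 0 L := ⟨hl.1.le, hl.2⟩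
    simp only [Pi.mul_apply]
    rw [← mul_assoc, ← ENNReal.ofReal_mul (by have := hab l hl'; have := flowScale_pos l; positivity),
      mul_assoc, mul_inv_cancel₀ (hab l hl').ne', mul_one, enorm_smul,
      Real.enorm_eq_ofReal (pow_nonneg (flowScale_pos l).le 3)]

theorem tendsto_flowScale : Tendsto flowScale atTop (𝓝 0) := by
  refine tendsto_inv_atTop_zero.comp (Real.tendsto_sqrt_atTop.comp ?_)
  exact tendsto_atTop_add_const_left _ _ (tendsto_pow_atTop (by norm_num))

theorem tendsto_mul_flowScale : Tendsto (fun l => l * flowScale l) atTop (𝓝 1) := by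
  -- The lower bound is the square of `l * flowScale l`, which does not exceed that number because
  -- it lies in `[0, 1]`.
  have h1 : Tendsto (fun l => 1 - flowScale l ^ 2) atTop (𝓝 1) := by
    simpa using (tendsto_flowScale.pow 2).const_sub 1
  refine tendsto_of_tendsto_of_tendsto_of_le_of_le' h1 tendsto_const_nhds ?_
    (Eventually.of_forall mul_flowScale_le_one)
  filter_upwards [eventually_ge_atTop 0] with l hl
  have h2 := one_add_sq_mul_flowScale_sq l
  have h3 := mul_flowScale_le_one l
  have h4 : 0 ≤ l * flowScale l := mul_nonneg hl (flowScale_pos l).le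
  nlinarith

/-- Wasserstein bound for a bounded random vector which satisfies a Stein identity. -/
theorem wassersteinDist_le_of_steinIdentity (hV : Measurable V) (hR : 0 ≤ R)
    (hVR : ∀ᵐ ω ∂P, ‖V ω‖ ≤ R) (hY : Integrable Y P) (hT : Integrable T P)
    (hS : SteinIdentity P V Y T) (S : E →L[ℝ] E) {p : ℝ} (hp : 1 ≤ p) :
    wassersteinDist p (P.map fun ω => S (V ω)) ((stdGaussian E).map S) ≤
      eLpNorm (fun ω => S (Y ω)) (ENNReal.ofReal p) P +
        eLpNorm (fun x => S (ContinuousLinearMap.adjoint (T x.1) x.2 - x.2)) (ENNReal.ofReal p)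
          (P.prod (stdGaussian E)) := by
  have hp1 : 1 ≤ ENNReal.ofReal p := by simpa using hp
  set K := eLpNorm (fun ω => S (Y ω)) (ENNReal.ofReal p) P +
        eLpNorm (fun x => S (ContinuousLinearMap.adjoint (T x.1) x.2 - x.2)) (ENNReal.ofReal p)
          (P.prod (stdGaussian E)) with hK
  set G := eLpNorm (fun x : Ω × E => S x.2) (ENNReal.ofReal p) (P.prod (stdGaussian E)) with hG
  have hGfin : G ≠ ⊤ := by
    have h1 : MemLp (fun x : E => S x) (ENNReal.ofReal p) (stdGaussian E) :=
      S.comp_memLp' (IsGaussian.memLp_id (stdGaussian E) _ ENNReal.ofReal_ne_top)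
    exact (h1.comp_measurePreserving (measurePreserving_snd (μ := P))).2.ne
  -- The flow stopped at `L` ends at the law of `s (L V + N)`, with `s = flowScale L`, which differs
  -- from `V` by `(1 - L s) V - s N`. This is negligible in `L^p` for large `L`, `V` being bounded.
  have hbound : ∀ L : ℝ, 0 ≤ L →
      wassersteinDist p (P.map fun ω => S (V ω)) ((stdGaussian E).map S) ≤
      (ENNReal.ofReal ((1 - L * flowScale L) * (‖S‖ * R)) + ENNReal.ofReal (flowScale L) * G) +
        K := by
    intro L hL
    have h1 := wassersteinDist_flow_le hV hR hVR hY hT hS hL S hp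
    rw [← hK] at h1
    have e : P.map (fun ω => S (V ω)) =
        (P.prod (stdGaussian E)).map (fun x : Ω × E => S (V x.1)) := by
      have := Measure.map_map (μ := P.prod (stdGaussian E)) (f := Prod.fst)
        (g := fun ω => S (V ω)) (by fun_prop) measurable_fst
      rw [(measurePreserving_fst (μ := P) (ν := stdGaussian E)).map_eq] at this
      exact this
    have hprob : IsProbabilityMeasure ((P.prod (stdGaussian E)).map
        fun x => S (flowScale L • (L • V x.1 + x.2))) :=
      Measure.isProbabilityMeasure_map (by fun_prop)
    refine le_trans (wassersteinDist_triangle hp (P.map fun ω => S (V ω))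
      ((P.prod (stdGaussian E)).map fun x => S (flowScale L • (L • V x.1 + x.2)))
      ((stdGaussian E).map S)) ?_
    refine add_le_add ?_ h1
    rw [e]
    have m1 : Measurable fun x : Ω × E => S (V x.1) := by fun_prop
    have m2 : Measurable fun x : Ω × E => S (flowScale L • (L • V x.1 + x.2)) := by fun_prop
    refine le_trans (wassersteinDist_map_le hp m1.aemeasurable m2.aemeasurable) ?_
    have e2 : (fun x : Ω × E => S (V x.1) - S (flowScale L • (L • V x.1 + x.2))) =
        (fun x : Ω × E => (1 - L * flowScale L) • S (V x.1)) +
          (-flowScale L) • fun x : Ω × E => S x.2 := by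
      ext x
      simp only [map_smul, map_add, Pi.add_apply, Pi.smul_apply]
      module
    rw [e2]
    refine (eLpNorm_add_le (m1.const_smul _).aestronglyMeasurable
      (Measurable.const_smul (by fun_prop : Measurable fun x : Ω × E => S x.2)
        _).aestronglyMeasurable hp1).trans (add_le_add ?_ ?_)
    · have h2 : 0 ≤ 1 - L * flowScale L := sub_nonneg.2 (mul_flowScale_le_one L)
      have h3 : ∀ᵐ x ∂(P.prod (stdGaussian E)), ‖V x.1‖ ≤ R :=
        (Measure.quasiMeasurePreserving_fst (μ := P)).ae hVR
      refine (eLpNorm_le_of_ae_bound (C := (1 - L * flowScale L) * (‖S‖ * R)) ?_).trans ?_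
      · filter_upwards [h3] with x hx
        rw [Pi.smul_apply, norm_smul, Real.norm_of_nonneg h2]
        gcongr
        exact (S.le_opNorm _).trans (by gcongr)
      · simp
    · rw [eLpNorm_const_smul, enorm_neg, Real.enorm_eq_ofReal (flowScale_pos L).le]
  have hlim : Tendsto (fun L => (ENNReal.ofReal ((1 - L * flowScale L) * (‖S‖ * R)) +
      ENNReal.ofReal (flowScale L) * G) + K) atTop (𝓝 K) := by
    have h1 : Tendsto (fun L => ENNReal.ofReal ((1 - L * flowScale L) * (‖S‖ * R))) atTop
        (𝓝 0) := by
      have := ENNReal.tendsto_ofReal ((tendsto_mul_flowScale.const_sub 1).mul_const (‖S‖ * R))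
      simpa using this
    have h2 : Tendsto (fun L => ENNReal.ofReal (flowScale L) * G) atTop (𝓝 0) := by
      have := ENNReal.Tendsto.mul_const (b := G) (ENNReal.tendsto_ofReal tendsto_flowScale)
        (Or.inr hGfin)
      simpa using this
    simpa using (h1.add h2).add_const K
  refine ge_of_tendsto hlim ?_
  filter_upwards [eventually_ge_atTop 0] with L hL using hbound L hL

end GaussianCoupling

/-! ### Smooth truncation of a Stein identity -/

section Truncation

open scoped RealInnerProductSpace

variable {E : Type*} [NormedAddCommGroup E] [InnerProductSpace ℝ E] [FiniteDimensional ℝ E]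

/-- Smooth cutoff functions at scale `r`, with the natural bounds on the gradient. -/
theorem exists_cutoff (E : Type*) [NormedAddCommGroup E] [InnerProductSpace ℝ E]
    [FiniteDimensional ℝ E] : ∃ C : ℝ, 0 ≤ C ∧ ∀ r : ℝ, 0 < r → ∃ χ : E → ℝ,
    ContDiff ℝ (⊤ : ℕ∞) χ ∧ HasCompactSupport χ ∧ (∀ x, 0 ≤ χ x) ∧ (∀ x, χ x ≤ 1) ∧
    (∀ x, ‖x‖ ≤ r → χ x = 1) ∧ (∀ x, 2 * r ≤ ‖x‖ → χ x = 0) ∧ ∀ x, ‖fderiv ℝ χ x‖ ≤ C / r := by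
  let b : ContDiffBump (0 : E) := ⟨1, 2, one_pos, one_lt_two⟩
  obtain ⟨C, hC⟩ := (b.hasCompactSupport.fderiv ℝ).exists_bound_of_continuous
    ((b.contDiff (n := 1)).continuous_fderiv (by norm_num))
  refine ⟨C, (norm_nonneg _).trans (hC 0), fun r hr => ⟨fun x => b (r⁻¹ • x), ?_, ?_,
    fun x => b.nonneg, fun x => b.le_one, fun x hx => b.one_of_mem_closedBall ?_,
    fun x hx => b.zero_of_le_dist ?_, fun x => ?_⟩⟩
  · exact b.contDiff.comp (contDiff_const_smul _)
  · exact b.hasCompactSupport.comp_smul (inv_ne_zero hr.ne')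
  · rw [mem_closedBall_zero_iff, norm_smul, Real.norm_of_nonneg (inv_nonneg.2 hr.le)]
    change r⁻¹ * ‖x‖ ≤ 1
    rw [inv_mul_le_iff₀ hr]
    linarith
  · rw [dist_zero_right, norm_smul, Real.norm_of_nonneg (inv_nonneg.2 hr.le)]
    change 2 ≤ r⁻¹ * ‖x‖
    rw [le_inv_mul_iff₀ hr]
    linarith
  · have h1 : HasFDerivAt (fun x : E => r⁻¹ • x) (r⁻¹ • ContinuousLinearMap.id ℝ E) x :=
      (hasFDerivAt_id x).const_smul _
    have h2 := ((b.contDiff (n := 1)).differentiable (by norm_num) (r⁻¹ • x)).hasFDerivAt.comp x h1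
    have h3 : fderiv ℝ (fun x => b (r⁻¹ • x)) x = r⁻¹ • fderiv ℝ b (r⁻¹ • x) := by
      refine h2.fderiv.trans ?_
      ext v
      simp
    rw [h3, norm_smul, Real.norm_of_nonneg (inv_nonneg.2 hr.le), div_eq_inv_mul]
    gcongr
    exact hC _

theorem hasFDerivAt_smul_self {χ : E → ℝ} (hχ : ContDiff ℝ (⊤ : ℕ∞) χ) (x : E) :
    HasFDerivAt (fun x => χ x • x)
      (χ x • ContinuousLinearMap.id ℝ E + (fderiv ℝ χ x).smulRight x) x :=
  ((hχ.differentiable (by simp)) x).hasFDerivAt.smul (hasFDerivAt_id x)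

/-- The gradient of the cutoff is of order `1 / r` and vanishes beyond radius `2r`, so its product
with `x` stays bounded uniformly in `r`. -/
theorem norm_fderiv_smul_self_le {χ : E → ℝ} {C r : ℝ} (hr : 0 < r)
    (hC : 0 ≤ C)
    (h0 : ∀ x, 0 ≤ χ x) (h1 : ∀ x, χ x ≤ 1) (h2 : ∀ x, 2 * r ≤ ‖x‖ → χ x = 0)
    (hd : ∀ x, ‖fderiv ℝ χ x‖ ≤ C / r) (x : E) :
    ‖χ x • ContinuousLinearMap.id ℝ E + (fderiv ℝ χ x).smulRight x‖ ≤ 1 + 2 * C := by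
  refine (norm_add_le _ _).trans (add_le_add ?_ ?_)
  · rw [norm_smul, Real.norm_of_nonneg (h0 x)]
    exact mul_le_one₀ (h1 x) (norm_nonneg _) ContinuousLinearMap.norm_id_le
  · rw [ContinuousLinearMap.norm_smulRight_apply]
    rcases le_or_gt ‖x‖ (2 * r) with h | h
    · calc _ ≤ C / r * (2 * r) := by
            gcongr
            exact hd x
        _ = 2 * C := by field_simp
    · have : χ =ᶠ[𝓝 x] fun _ => 0 := by
        filter_upwards [continuous_norm.continuousAt.eventually (lt_mem_nhds h)] with y hy
          using h2 y hy.le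
      rw [this.fderiv_eq]
      simp
      exact hC

theorem norm_smul_self_le {χ : E → ℝ} {r : ℝ} (hr : 0 < r)
    (h0 : ∀ x, 0 ≤ χ x) (h1 : ∀ x, χ x ≤ 1) (h2 : ∀ x, 2 * r ≤ ‖x‖ → χ x = 0) (x : E) :
    ‖χ x • x‖ ≤ 2 * r := by
  rcases le_or_gt (2 * r) ‖x‖ with h | h
  · rw [h2 x h, zero_smul, norm_zero]
    positivity
  · rw [norm_smul, Real.norm_of_nonneg (h0 x)]
    exact (mul_le_of_le_one_left (norm_nonneg _) (h1 x)).trans h.le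

variable [MeasurableSpace E] [BorelSpace E]
variable {Ω : Type*} [MeasurableSpace Ω] {P : Measure Ω} [IsProbabilityMeasure P]
  {X Z : Ω → E} {A : Ω → E →L[ℝ] E}

/-- A Stein identity for `X`, tested against compactly supported smooth functions. -/
def CompactSteinIdentity (P : Measure Ω) (X Z : Ω → E) (A : Ω → E →L[ℝ] E) : Prop :=
  ∀ k : E → ℝ, ContDiff ℝ (⊤ : ℕ∞) k → HasCompactSupport k → ∀ w : E,
    ∫ ω, k (X ω) * ⟪X ω, w⟫ ∂P =
      ∫ ω, k (X ω) * ⟪Z ω, w⟫ ∂P + ∫ ω, fderiv ℝ k (X ω) (A ω w) ∂P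

theorem integrable_comp_clm_apply (hX : Measurable X) (hA : Integrable A P)
    {Φ : E → E →L[ℝ] ℝ} (hΦ : Continuous Φ) (hc : HasCompactSupport Φ) (w : E) :
    Integrable (fun ω => Φ (X ω) (A ω w)) P := by
  obtain ⟨C, hC⟩ := hc.exists_bound_of_continuous hΦ
  have h1 : Integrable (fun ω => A ω w) P :=
    (ContinuousLinearMap.apply ℝ E w).integrable_comp hA
  refine (h1.norm.const_mul C).mono' ?_ (Eventually.of_forall fun ω => ?_)
  · exact (ContinuousLinearMap.id ℝ (E →L[ℝ] ℝ)).aestronglyMeasurable_comp₂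
      (hΦ.measurable.comp hX).aestronglyMeasurable h1.1
  · exact ((Φ (X ω)).le_opNorm _).trans (by gcongr; exact hC _)

theorem integrable_comp_mul_inner (hX : Measurable X) (hZ : Integrable Z P)
    {k : E → ℝ} (hk : Continuous k) (hc : HasCompactSupport k) (w : E) :
    Integrable (fun ω => k (X ω) * ⟪Z ω, w⟫) P := by
  obtain ⟨C, hC⟩ := hc.exists_bound_of_continuous hk
  exact (hZ.inner_const w).bdd_mul (hk.measurable.comp hX).aestronglyMeasurable
    (Eventually.of_forall fun ω => hC _)

/-- The identity for `X` is tested with `x ↦ χ x * f (B (χ x • x))` in the direction `B w`. The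
derivative falling on the outer `χ` goes into the remainder, the one falling on `f` into the kernel.
-/
theorem CompactSteinIdentity.truncate (h : CompactSteinIdentity P X Z A) (hX : Measurable X)
    (hZ : Integrable Z P) (hA : Integrable A P) {χ : E → ℝ} (hχ : ContDiff ℝ (⊤ : ℕ∞) χ)
    (hχc : HasCompactSupport χ) {B : E →L[ℝ] E} (hB : ∀ x y, ⟪B x, y⟫ = ⟪x, B y⟫) :
    SteinIdentity P (fun ω => B (χ (X ω) • X ω))
      (fun ω => B (χ (X ω) • Z ω + ContinuousLinearMap.adjoint (A ω)
        ((InnerProductSpace.toDual ℝ E).symm (fderiv ℝ χ (X ω)))))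
      (fun ω => χ (X ω) • B ∘L (χ (X ω) • ContinuousLinearMap.id ℝ E +
        (fderiv ℝ χ (X ω)).smulRight (X ω)) ∘L A ω ∘L B) := by
  intro f hf w
  have hχ' : Continuous (fderiv ℝ χ) := hχ.continuous_fderiv (by simp)
  have hf' : Continuous (fderiv ℝ f) := hf.continuous_fderiv (by simp)
  have hχ0 := hχ.continuous
  have hf0 := hf.continuous
  have hψ : ContDiff ℝ (⊤ : ℕ∞) fun x => f (B (χ x • x)) :=
    hf.comp (B.contDiff.comp (hχ.smul contDiff_id))
  have hk : ContDiff ℝ (⊤ : ℕ∞) fun x => χ x * f (B (χ x • x)) := hχ.mul hψ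
  have hkc : HasCompactSupport fun x => χ x * f (B (χ x • x)) := hχc.mul_right
  have hkd : ∀ x, fderiv ℝ (fun x => χ x * f (B (χ x • x))) x =
      f (B (χ x • x)) • fderiv ℝ χ x + χ x • fderiv ℝ f (B (χ x • x)) ∘L B ∘L
        (χ x • ContinuousLinearMap.id ℝ E + (fderiv ℝ χ x).smulRight x) := by
    intro x
    have h1 : HasFDerivAt (fun x => f (B (χ x • x))) _ x :=
      ((hf.differentiable (by simp)) _).hasFDerivAt.comp x
        (B.hasFDerivAt.comp x (hasFDerivAt_smul_self hχ x))
    refine (((hχ.differentiable (by simp)) x).hasFDerivAt.mul h1).fderiv.trans ?_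
    exact add_comm _ _
  have i0 := integrable_comp_mul_inner hX hZ hk.continuous hkc (B w)
  set Φ₁ : E → E →L[ℝ] ℝ := fun x => f (B (χ x • x)) • fderiv ℝ χ x with hΦ₁
  set Φ₂ : E → E →L[ℝ] ℝ := fun x => χ x • fderiv ℝ f (B (χ x • x)) ∘L B ∘L
        (χ x • ContinuousLinearMap.id ℝ E + (fderiv ℝ χ x).smulRight x) with hΦ₂
  have c1 : Continuous Φ₁ := by fun_prop
  have c2 : Continuous Φ₂ := by fun_prop
  have d1 : HasCompactSupport Φ₁ := (hχc.fderiv ℝ).mono fun x hx h0 => hx (by simp [Φ₁, h0])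
  have d2 : HasCompactSupport Φ₂ := hχc.mono fun x hx h0 => hx (by simp [Φ₂, h0])
  have i1 := integrable_comp_clm_apply hX hA c1 d1 (B w)
  have i2 := integrable_comp_clm_apply hX hA c2 d2 (B w)
  have key := h _ hk hkc (B w)
  have e0 : ∀ ω, f (B (χ (X ω) • X ω)) * ⟪B (χ (X ω) • X ω), w⟫ =
      χ (X ω) * f (B (χ (X ω) • X ω)) * ⟪X ω, B w⟫ := fun ω => by
    rw [hB, real_inner_smul_left]
    ring
  have e1 : ∀ ω, f (B (χ (X ω) • X ω)) * ⟪B (χ (X ω) • Z ω + ContinuousLinearMap.adjoint (A ω)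
        ((InnerProductSpace.toDual ℝ E).symm (fderiv ℝ χ (X ω)))), w⟫ =
      χ (X ω) * f (B (χ (X ω) • X ω)) * ⟪Z ω, B w⟫ +
        (f (B (χ (X ω) • X ω)) • fderiv ℝ χ (X ω)) (A ω (B w)) := fun ω => by
    rw [hB, inner_add_left, real_inner_smul_left, ContinuousLinearMap.adjoint_inner_left,
      InnerProductSpace.toDual_symm_apply]
    simp only [smul_apply, smul_eq_mul]
    ring
  have e2 : ∫ ω, fderiv ℝ (fun x => χ x * f (B (χ x • x))) (X ω) (A ω (B w)) ∂P = _ :=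
    (integral_congr_ae (Eventually.of_forall fun ω => by
      simp only [hkd, add_apply, Φ₁, Φ₂])).trans (integral_add i1 i2)
  rw [integral_congr_ae (Eventually.of_forall e0), integral_congr_ae (Eventually.of_forall e1), key,
    e2, integral_add i0 i1, add_assoc]
  congr 2
  refine integral_congr_ae (Eventually.of_forall fun ω => ?_)
  simp only [Φ₂, smul_apply, ContinuousLinearMap.comp_apply, map_smul]

end Truncation

/-! ### Removing the truncation -/

section TruncationLimit

open scoped RealInnerProductSpace

variable {E : Type*} [NormedAddCommGroup E] [InnerProductSpace ℝ E] [FiniteDimensional ℝ E]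
  [MeasurableSpace E] [BorelSpace E]
variable {Ω : Type*} [MeasurableSpace Ω] {P : Measure Ω} [IsProbabilityMeasure P]
  {X Z : Ω → E} {A : Ω → E →L[ℝ] E}

/-- The sets decrease to the empty set, and a single `L^q` function is uniformly integrable. The `+
1` matches truncation radii that are positive already for `n = 0`. -/
theorem tendsto_eLpNorm_indicator_norm_ge {F : Type*} [NormedAddCommGroup F] (hX : Measurable X)
    {f : Ω → F} {q : ℝ≥0∞} (hq : 1 ≤ q) (hq' : q ≠ ⊤) (hf : MemLp f q P) :
    Tendsto (fun n : ℕ => eLpNorm ({ω | (n : ℝ) + 1 ≤ ‖X ω‖}.indicator f) q P) atTop (𝓝 0) := by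
  have hm : ∀ n : ℕ, MeasurableSet {ω | (n : ℝ) + 1 ≤ ‖X ω‖} := fun n =>
    measurableSet_le measurable_const hX.norm
  have h1 : Tendsto (P ∘ fun n : ℕ => {ω | (n : ℝ) + 1 ≤ ‖X ω‖}) atTop (𝓝 0) := by
    have h2 := tendsto_measure_iInter_atTop (μ := P) (s := fun n : ℕ => {ω | (n : ℝ) + 1 ≤ ‖X ω‖})
      (fun n => (hm n).nullMeasurableSet)
      (fun m n hmn ω hω => by
        have : (m : ℝ) ≤ n := by exact_mod_cast hmn
        simp only [Set.mem_ofPred_eq] at hω ⊢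
        linarith) ⟨0, measure_ne_top _ _⟩
    have h3 : ⋂ n : ℕ, {ω | (n : ℝ) + 1 ≤ ‖X ω‖} = ∅ := by
      refine Set.eq_empty_of_forall_notMem fun ω hω => ?_
      obtain ⟨n, hn⟩ := exists_nat_gt ‖X ω‖
      have := Set.mem_iInter.1 hω n
      simp only [Set.mem_ofPred_eq] at this
      linarith
    rwa [h3, measure_empty] at h2
  refine ENNReal.tendsto_nhds_zero.2 fun ε hε => ?_
  rcases eq_or_ne ε ⊤ with rfl | hεt
  · simp
  obtain ⟨δ, hδ, h⟩ := hf.eLpNorm_indicator_le hq hq' (ENNReal.toReal_pos hε.ne' hεt)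
  filter_upwards [ENNReal.tendsto_nhds_zero.1 h1 _ (ENNReal.ofReal_pos.2 hδ)] with n hn
  exact (h _ (hm n) hn).trans ENNReal.ofReal_toReal_le

/-- The norm of an independent product. -/
theorem eLpNorm_apply_prod_le {F : Type*} [NormedAddCommGroup F] {f : Ω → F} {ν : Measure E}
    [SFinite ν] (hf : AEStronglyMeasurable f P) {G : Type*} [NormedAddCommGroup G] {g : Ω × E → G}
    {c : ℝ} (hc : 0 ≤ c) (hg : ∀ x, ‖g x‖ ≤ c * (‖f x.1‖ * ‖x.2‖)) {p : ℝ} (hp : 1 ≤ p) :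
    eLpNorm g (ENNReal.ofReal p) (P.prod ν) ≤
      ENNReal.ofReal c * (eLpNorm f (ENNReal.ofReal p) P * eLpNorm id (ENNReal.ofReal p) ν) := by
  have hp0 : 0 < p := by linarith
  have h1 : ∀ x, ‖g x‖ₑ ≤ ENNReal.ofReal c * (‖f x.1‖ₑ * ‖x.2‖ₑ) := fun x => by
    rw [← ofReal_norm, ← ofReal_norm, ← ofReal_norm, ← ENNReal.ofReal_mul (norm_nonneg _),
      ← ENNReal.ofReal_mul hc]
    exact ENNReal.ofReal_le_ofReal (hg x)
  rw [← lintegral_rpow_eq_eLpNorm hp, ← lintegral_rpow_eq_eLpNorm hp,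
    ← lintegral_rpow_eq_eLpNorm hp, ← ENNReal.mul_rpow_of_nonneg _ _ (by positivity),
    ← lintegral_prod_mul (hf.enorm.pow_const p) (by fun_prop), one_div, ENNReal.rpow_inv_le_iff hp0,
    ENNReal.mul_rpow_of_nonneg _ _ hp0.le, ENNReal.rpow_inv_rpow hp0.ne',
    ← lintegral_const_mul' _ _ (ENNReal.rpow_ne_top_of_nonneg hp0.le ENNReal.ofReal_ne_top)]
  refine lintegral_mono fun x => ?_
  simp only [id]
  rw [← ENNReal.mul_rpow_of_nonneg _ _ hp0.le, ← ENNReal.mul_rpow_of_nonneg _ _ hp0.le]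
  exact ENNReal.rpow_le_rpow (h1 x) hp0.le

theorem norm_adjoint_sub_le (S T : E →L[ℝ] E) (x : E) :
    ‖S (ContinuousLinearMap.adjoint T x - x)‖ ≤ ‖S‖ * (‖T - 1‖ * ‖x‖) := by
  have h : ContinuousLinearMap.adjoint T x - x = ContinuousLinearMap.adjoint (T - 1) x := by
    rw [map_sub]
    have : ContinuousLinearMap.adjoint (1 : E →L[ℝ] E) = 1 := ContinuousLinearMap.adjoint_id
    rw [this]
    simp
  rw [h]
  refine (S.le_opNorm _).trans (mul_le_mul_of_nonneg_left ?_ (norm_nonneg _))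
  refine (ContinuousLinearMap.le_opNorm _ _).trans ?_
  rw [LinearIsometryEquiv.norm_map]

theorem eLpNorm_le_add_const_mul {F G H : Type*} [NormedAddCommGroup F] [NormedAddCommGroup G]
    [NormedAddCommGroup H] {f : Ω → F} {a : Ω → G} {b : Ω → H} {c : ℝ} (hc : 0 ≤ c)
    (ha : AEStronglyMeasurable a P) (hb : AEStronglyMeasurable b P)
    (h : ∀ ω, ‖f ω‖ ≤ ‖a ω‖ + c * ‖b ω‖) {q : ℝ≥0∞} (hq : 1 ≤ q) :
    eLpNorm f q P ≤ eLpNorm a q P + ENNReal.ofReal c * eLpNorm b q P := by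
  refine (eLpNorm_mono_real (g := fun ω => ‖a ω‖ + c * ‖b ω‖) h).trans ?_
  refine (eLpNorm_add_le ha.norm (hb.norm.const_mul c) hq).trans ?_
  rw [eLpNorm_norm]
  refine add_le_add le_rfl ?_
  have := eLpNorm_const_smul c (fun ω => ‖b ω‖) q P
  rw [eLpNorm_norm, Real.enorm_eq_ofReal hc] at this
  exact this.le

/-- Where `‖X‖ < r` the cutoff is locally constant equal to `1`, and the kernel is exactly `B A B`.
Elsewhere the deviation is at most a constant, independent of `r`, times `‖A‖`. -/
theorem norm_truncation_sub_one_le {χ : E → ℝ} {C r : ℝ} (hr : 0 < r) (hC : 0 ≤ C)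
    (h0 : ∀ x, 0 ≤ χ x) (h1 : ∀ x, χ x ≤ 1) (h2 : ∀ x, 2 * r ≤ ‖x‖ → χ x = 0)
    (h3 : ∀ x, ‖x‖ ≤ r → χ x = 1) (hd : ∀ x, ‖fderiv ℝ χ x‖ ≤ C / r) (B : E →L[ℝ] E) (ω : Ω) :
    ‖χ (X ω) • B ∘L (χ (X ω) • ContinuousLinearMap.id ℝ E + (fderiv ℝ χ (X ω)).smulRight (X ω)) ∘L
        A ω ∘L B - 1‖ ≤ ‖1 - B ∘L A ω ∘L B‖ +
      ‖B‖ * (2 + 2 * C) * ‖B‖ * ‖({ω | r ≤ ‖X ω‖}.indicator fun ω => ‖A ω‖) ω‖ := by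
  have e : χ (X ω) • B ∘L (χ (X ω) • ContinuousLinearMap.id ℝ E + (fderiv ℝ χ (X ω)).smulRight (X ω)) ∘L A ω ∘L B - 1 = -(1 - B ∘L A ω ∘L B) +
      B ∘L (χ (X ω) • (χ (X ω) • ContinuousLinearMap.id ℝ E + (fderiv ℝ χ (X ω)).smulRight (X ω)) - ContinuousLinearMap.id ℝ E) ∘L A ω ∘L B := by
    ext x
    simp
  rw [e]
  refine (norm_add_le _ _).trans (add_le_add (norm_neg _).le ?_)
  by_cases hω : ω ∈ {ω | r ≤ ‖X ω‖}
  · rw [Set.indicator_of_mem hω, norm_norm]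
    calc _ ≤ ‖B‖ * ((2 + 2 * C) * (‖A ω‖ * ‖B‖)) := by
          refine (ContinuousLinearMap.opNorm_comp_le _ _).trans ?_
          refine mul_le_mul_of_nonneg_left ?_ (norm_nonneg _)
          refine (ContinuousLinearMap.opNorm_comp_le _ _).trans ?_
          refine mul_le_mul ?_ (ContinuousLinearMap.opNorm_comp_le _ _) (norm_nonneg _)
            (by positivity)
          refine (norm_sub_le _ _).trans ?_
          have n1 : ‖χ (X ω) • (χ (X ω) • ContinuousLinearMap.id ℝ E + (fderiv ℝ χ (X ω)).smulRight (X ω))‖ ≤ 1 + 2 * C := by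
            rw [norm_smul, Real.norm_of_nonneg (h0 _)]
            exact (mul_le_of_le_one_left (norm_nonneg _) (h1 _)).trans (norm_fderiv_smul_self_le hr hC h0 h1 h2 hd _)
          have n2 := ContinuousLinearMap.norm_id_le (𝕜 := ℝ) (E := E)
          linarith
      _ = _ := by ring
  · rw [Set.indicator_of_notMem hω]
    have hlt : ‖X ω‖ < r := not_le.1 hω
    have hev : χ =ᶠ[𝓝 (X ω)] fun _ => 1 := by
      filter_upwards [continuous_norm.continuousAt.eventually (gt_mem_nhds hlt)] with y hy
        using h3 y hy.le
    have : χ (X ω) • (χ (X ω) • ContinuousLinearMap.id ℝ E + (fderiv ℝ χ (X ω)).smulRight (X ω)) - ContinuousLinearMap.id ℝ E = 0 := by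
      rw [hev.fderiv_eq, h3 _ hlt.le]
      ext x
      simp
    rw [this]
    simp

/-- Wasserstein bound at a fixed truncation level. -/
theorem CompactSteinIdentity.wassersteinDist_truncate_le (h : CompactSteinIdentity P X Z A)
    (hX : Measurable X) {p : ℝ} (hp : 1 ≤ p) (hZ : MemLp Z (ENNReal.ofReal p) P)
    (hA : MemLp A (ENNReal.ofReal p) P) {χ : E → ℝ} (hχ : ContDiff ℝ (⊤ : ℕ∞) χ)
    (hχc : HasCompactSupport χ) {C r : ℝ} (hr : 0 < r) (hC : 0 ≤ C)
    (h0 : ∀ x, 0 ≤ χ x) (h1 : ∀ x, χ x ≤ 1) (h2 : ∀ x, 2 * r ≤ ‖x‖ → χ x = 0)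
    (h3 : ∀ x, ‖x‖ ≤ r → χ x = 1)
    (hd : ∀ x, ‖fderiv ℝ χ x‖ ≤ C / r)
    {S B : E →L[ℝ] E} (hSB : ∀ x, S (B x) = x) (hB : ∀ x y, ⟪B x, y⟫ = ⟪x, B y⟫) :
    wassersteinDist p (P.map fun ω => χ (X ω) • X ω) ((stdGaussian E).map S) ≤
      (eLpNorm Z (ENNReal.ofReal p) P + ENNReal.ofReal (C / r) * eLpNorm A (ENNReal.ofReal p) P) +
        ENNReal.ofReal ‖S‖ * ((eLpNorm (fun ω => 1 - B ∘L A ω ∘L B) (ENNReal.ofReal p) P +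
          ENNReal.ofReal (‖B‖ * (2 + 2 * C) * ‖B‖) *
            eLpNorm ({ω | r ≤ ‖X ω‖}.indicator fun ω => ‖A ω‖) (ENNReal.ofReal p) P) *
          eLpNorm id (ENNReal.ofReal p) (stdGaussian E)) := by
  have hp1 : 1 ≤ ENNReal.ofReal p := by simpa using hp
  have iZ : Integrable Z P := hZ.integrable hp1
  have iA : Integrable A P := hA.integrable hp1
  have hχ0 : Continuous χ := hχ.continuous
  have hχ' : Continuous (fderiv ℝ χ) := hχ.continuous_fderiv (by simp)
  set D : E → E →L[ℝ] E := fun x => χ x • ContinuousLinearMap.id ℝ E + (fderiv ℝ χ x).smulRight x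
    with hD
  have hDc : Continuous D := by fun_prop
  have hDn : ∀ x, ‖D x‖ ≤ 1 + 2 * C := norm_fderiv_smul_self_le hr hC h0 h1 h2 hd
  set V : Ω → E := fun ω => B (χ (X ω) • X ω) with hV
  set Y₀ : Ω → E := fun ω => χ (X ω) • Z ω + ContinuousLinearMap.adjoint (A ω)
        ((InnerProductSpace.toDual ℝ E).symm (fderiv ℝ χ (X ω))) with hY₀
  set T : Ω → E →L[ℝ] E := fun ω => χ (X ω) • B ∘L D (X ω) ∘L A ω ∘L B with hT
  have hst : SteinIdentity P V (fun ω => B (Y₀ ω)) T := h.truncate hX iZ iA hχ hχc hB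
  have hY₀n : ∀ ω, ‖Y₀ ω‖ ≤ ‖Z ω‖ + C / r * ‖A ω‖ := by
    intro ω
    refine (norm_add_le _ _).trans (add_le_add ?_ ?_)
    · rw [norm_smul, Real.norm_of_nonneg (h0 _)]
      exact mul_le_of_le_one_left (norm_nonneg _) (h1 _)
    · refine (ContinuousLinearMap.le_opNorm _ _).trans ?_
      rw [LinearIsometryEquiv.norm_map, LinearIsometryEquiv.norm_map, mul_comm]
      exact mul_le_mul_of_nonneg_right (hd _) (norm_nonneg _)
  have hY₀m : AEStronglyMeasurable Y₀ P := by
    have hg : Continuous fun q : E × E × (E →L[ℝ] E) => χ q.1 • q.2.1 +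
        ContinuousLinearMap.adjoint q.2.2
          ((InnerProductSpace.toDual ℝ E).symm (fderiv ℝ χ q.1)) := by
      have c1 : Continuous fun q : E × E × (E →L[ℝ] E) => ContinuousLinearMap.adjoint q.2.2 :=
        ContinuousLinearMap.adjoint.continuous.comp (by fun_prop)
      have c2 : Continuous fun q : E × E × (E →L[ℝ] E) =>
          (InnerProductSpace.toDual ℝ E).symm (fderiv ℝ χ q.1) :=
        (InnerProductSpace.toDual ℝ E).symm.continuous.comp (by fun_prop)
      exact (by fun_prop : Continuous fun q : E × E × (E →L[ℝ] E) => χ q.1 • q.2.1).add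
        (c1.clm_apply c2)
    exact hg.comp_aestronglyMeasurable (hX.aestronglyMeasurable.prodMk (iZ.1.prodMk iA.1))
  have hTm : AEStronglyMeasurable T P := by
    have hg : Continuous fun q : E × (E →L[ℝ] E) => χ q.1 • B ∘L D q.1 ∘L q.2 ∘L B := by
      fun_prop
    exact hg.comp_aestronglyMeasurable (hX.aestronglyMeasurable.prodMk iA.1)
  have iY₀ : Integrable Y₀ P := (iZ.norm.add (iA.norm.const_mul (C / r))).mono' hY₀m
    (Eventually.of_forall hY₀n)
  have hTn : ∀ ω, ‖T ω - 1‖ ≤ ‖1 - B ∘L A ω ∘L B‖ +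
      ‖B‖ * (2 + 2 * C) * ‖B‖ * ‖({ω | r ≤ ‖X ω‖}.indicator fun ω => ‖A ω‖) ω‖ :=
    norm_truncation_sub_one_le hr hC h0 h1 h2 h3 hd B
  have hrm : MeasurableSet {ω | r ≤ ‖X ω‖} := measurableSet_le measurable_const hX.norm
  have iT : Integrable T P := by
    have i1 : Integrable (fun ω => (1 : E →L[ℝ] E) - B ∘L A ω ∘L B) P := by
      have : Integrable (fun ω => B ∘L A ω ∘L B) P :=
        ((ContinuousLinearMap.compL ℝ E E E B).comp
          ((ContinuousLinearMap.compL ℝ E E E).flip B)).integrable_comp iA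
      exact (integrable_const _).sub this
    have i2 : Integrable ({ω | r ≤ ‖X ω‖}.indicator fun ω => ‖A ω‖) P :=
      iA.norm.indicator hrm
    have i3 : Integrable (fun ω => T ω - 1) P :=
      (i1.norm.add (i2.norm.const_mul (‖B‖ * (2 + 2 * C) * ‖B‖))).mono'
        (hTm.sub aestronglyMeasurable_const) (Eventually.of_forall hTn)
    have e : T = fun ω => (T ω - 1) + 1 := funext fun ω => (sub_add_cancel _ _).symm
    rw [e]
    exact i3.add (integrable_const (1 : E →L[ℝ] E))
  have hVm : Measurable V := B.continuous.measurable.comp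
    ((hχ0.measurable.comp hX).smul hX)
  have hVR : ∀ᵐ ω ∂P, ‖V ω‖ ≤ ‖B‖ * (2 * r) := Eventually.of_forall fun ω =>
    (B.le_opNorm _).trans (mul_le_mul_of_nonneg_left (norm_smul_self_le hr h0 h1 h2 _)
      (norm_nonneg _))
  -- `S` undoes the normalisation: it sends `V` to the truncated `X`, and the remainder `B Y₀` to
  -- `Y₀`.
  have main := wassersteinDist_le_of_steinIdentity hVm (by positivity) hVR
    (B.integrable_comp iY₀) iT hst S hp
  simp only [hV, hSB] at main
  refine main.trans (add_le_add ?_ ?_)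
  · exact eLpNorm_le_add_const_mul (by positivity) iZ.1 iA.1 hY₀n hp1
  · refine (eLpNorm_apply_prod_le (f := fun ω => T ω - 1) (hTm.sub aestronglyMeasurable_const)
      (norm_nonneg S) (fun x => norm_adjoint_sub_le S (T x.1) x.2) hp).trans ?_
    refine mul_le_mul_right (mul_le_mul_left ?_ _) _
    have m1 : AEStronglyMeasurable (fun ω => (1 : E →L[ℝ] E) - B ∘L A ω ∘L B) P := by
      have hg : Continuous fun a : E →L[ℝ] E => (1 : E →L[ℝ] E) - B ∘L a ∘L B := by fun_prop
      exact hg.comp_aestronglyMeasurable iA.1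
    exact eLpNorm_le_add_const_mul (by positivity) m1 (iA.1.norm.indicator hrm) hTn hp1

/-- Wasserstein bound for a random vector which satisfies a Stein identity. -/
theorem CompactSteinIdentity.wassersteinDist_le (h : CompactSteinIdentity P X Z A)
    (hX : Measurable X) {p : ℝ} (hp : 1 ≤ p) (hZ : MemLp Z (ENNReal.ofReal p) P)
    {S B : E →L[ℝ] E} (hSB : ∀ x, S (B x) = x) (hBS : ∀ x, B (S x) = x)
    (hB : ∀ x y, ⟪B x, y⟫ = ⟪x, B y⟫)
    (hA : MemLp (fun ω => 1 - B ∘L A ω ∘L B) (ENNReal.ofReal p) P) :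
    wassersteinDist p (P.map X) ((stdGaussian E).map S) ≤
      ENNReal.ofReal ‖S‖ * (eLpNorm (fun ω => 1 - B ∘L A ω ∘L B) (ENNReal.ofReal p) P *
          eLpNorm id (ENNReal.ofReal p) (stdGaussian E)) + eLpNorm Z (ENNReal.ofReal p) P := by
  have hp1 : 1 ≤ ENNReal.ofReal p := by simpa using hp
  -- Integrability of `A` is recovered from that of `1 - B A B`, by conjugating back with `S`.
  have hA' : MemLp A (ENNReal.ofReal p) P := by
    have e : A = fun ω => S ∘L (1 - (1 - B ∘L A ω ∘L B)) ∘L S := by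
      ext ω x
      simp [hSB, hBS]
    have h1 : MemLp (fun ω => (1 : E →L[ℝ] E) - (1 - B ∘L A ω ∘L B)) (ENNReal.ofReal p) P :=
      (memLp_const _).sub hA
    rw [e]
    exact ((ContinuousLinearMap.compL ℝ E E E S).comp
      ((ContinuousLinearMap.compL ℝ E E E).flip S)).comp_memLp' h1
  obtain ⟨C, hC, hcut⟩ := exists_cutoff E
  choose χ hχ hχc h0 h1 h3 h2 hd using fun n : ℕ => hcut ((n : ℝ) + 1) (by positivity)
  have hW := fun n : ℕ => h.wassersteinDist_truncate_le hX hp hZ hA' (hχ n) (hχc n) (by positivity)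
    hC (h0 n) (h1 n) (h2 n) (h3 n) (hd n) hSB hB
  set N := eLpNorm id (ENNReal.ofReal p) (stdGaussian E) with hN
  have hNfin : N ≠ ⊤ :=
    (IsGaussian.memLp_id (stdGaussian E) (ENNReal.ofReal p) ENNReal.ofReal_ne_top).2.ne
  set a := eLpNorm (fun ω => 1 - B ∘L A ω ∘L B) (ENNReal.ofReal p) P with ha
  set z := eLpNorm Z (ENNReal.ofReal p) P with hz
  set K : ℕ → ℝ≥0∞ := fun n => (z + ENNReal.ofReal (C / ((n : ℝ) + 1)) *
        eLpNorm A (ENNReal.ofReal p) P) +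
        ENNReal.ofReal ‖S‖ * ((a + ENNReal.ofReal (‖B‖ * (2 + 2 * C) * ‖B‖) *
            eLpNorm ({ω | (n : ℝ) + 1 ≤ ‖X ω‖}.indicator fun ω => ‖A ω‖) (ENNReal.ofReal p) P) * N) with hK
  have hKlim : Tendsto K atTop (𝓝 ((z + 0) + ENNReal.ofReal ‖S‖ * ((a + 0) * N))) := by
    refine (tendsto_const_nhds.add ?_).add (ENNReal.Tendsto.const_mul
      (ENNReal.Tendsto.mul_const (tendsto_const_nhds.add ?_) (Or.inr hNfin))
      (Or.inr ENNReal.ofReal_ne_top))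
    · have t1 : Tendsto (fun n : ℕ => ENNReal.ofReal (C / ((n : ℝ) + 1))) atTop (𝓝 0) := by
        have := ENNReal.tendsto_ofReal (tendsto_const_div_atTop_nhds_zero_nat C |>.comp
          (tendsto_add_atTop_nat 1))
        simpa [Function.comp_def] using this
      simpa using ENNReal.Tendsto.mul_const t1 (Or.inr hA'.2.ne)
    · simpa using ENNReal.Tendsto.const_mul (a := ENNReal.ofReal (‖B‖ * (2 + 2 * C) * ‖B‖))
        (tendsto_eLpNorm_indicator_norm_ge hX hp1 ENNReal.ofReal_ne_top hA'.norm)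
        (Or.inr ENNReal.ofReal_ne_top)
  rw [add_zero, add_zero] at hKlim
  set K₀ := z + ENNReal.ofReal ‖S‖ * (a * N) with hK₀
  have hK₀fin : K₀ ≠ ⊤ := by
    have := hZ.2.ne
    have := hA.2.ne
    exact ENNReal.add_ne_top.2 ⟨hZ.2.ne, ENNReal.mul_ne_top ENNReal.ofReal_ne_top
      (ENNReal.mul_ne_top hA.2.ne hNfin)⟩
  have hWm : ∀ n, Measurable fun ω => χ n (X ω) • X ω := fun n =>
    ((hχ n).continuous.measurable.comp hX).smul hX
  have hSN : eLpNorm id (ENNReal.ofReal p) ((stdGaussian E).map S) ≠ ⊤ := by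
    rw [eLpNorm_map_measure (by fun_prop) (by fun_prop)]
    exact (S.comp_memLp' (IsGaussian.memLp_id (stdGaussian E) _ ENNReal.ofReal_ne_top)).2.ne
  -- The vector `X` is not assumed to be in `L^p`. The Wasserstein bounds control the `p`-th moments
  -- of the truncations uniformly, and Fatou's lemma passes this to the limit.
  have hXp : MemLp X (ENNReal.ofReal p) P := by
    refine ⟨hX.aestronglyMeasurable, lt_of_le_of_lt (Lp.eLpNorm_le_of_ae_tendsto
      (C := K₀ + 1 + eLpNorm id (ENNReal.ofReal p) ((stdGaussian E).map S)) (u := atTop)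
      (f := fun n ω => χ n (X ω) • X ω) ?_ (fun n => (hWm n).aestronglyMeasurable) ?_) ?_⟩
    · filter_upwards [hKlim.eventually_le_const (ENNReal.lt_add_right hK₀fin one_ne_zero)] with n hn
      have e := eLpNorm_map_measure (p := ENNReal.ofReal p) (μ := P) (g := (id : E → E))
        (by fun_prop) (hWm n).aemeasurable
      change _ = eLpNorm (fun ω => χ n (X ω) • X ω) _ _ at e
      rw [← e]
      exact (eLpNorm_id_le_wassersteinDist_add hp _ _).trans
        (add_le_add ((hW n).trans hn) le_rfl)
    · refine Eventually.of_forall fun ω => tendsto_const_nhds.congr' ?_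
      filter_upwards [eventually_ge_atTop ⌈‖X ω‖⌉₊] with n hn
      have := Nat.le_of_ceil_le hn
      rw [h3 n _ (by linarith), one_smul]
    · exact lt_top_iff_ne_top.2 (by simp [hK₀fin, hSN])
  -- Coupling `X` with its own truncation costs at most the `L^p` norm of `X` on the event where the
  -- cutoff may act.
  have hfin : ∀ n : ℕ, wassersteinDist p (P.map X) ((stdGaussian E).map S) ≤
      eLpNorm ({ω | (n : ℝ) + 1 ≤ ‖X ω‖}.indicator X) (ENNReal.ofReal p) P + K n := by
    intro n
    have hprob : IsProbabilityMeasure (P.map fun ω => χ n (X ω) • X ω) :=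
      Measure.isProbabilityMeasure_map (hWm n).aemeasurable
    refine le_trans (wassersteinDist_triangle hp _ (P.map fun ω => χ n (X ω) • X ω) _)
      (add_le_add ?_ (hW n))
    refine le_trans (wassersteinDist_map_le hp hX.aemeasurable (hWm n).aemeasurable) ?_
    refine eLpNorm_mono fun ω => ?_
    by_cases hω : ω ∈ {ω | (n : ℝ) + 1 ≤ ‖X ω‖}
    · rw [Set.indicator_of_mem hω]
      have : X ω - χ n (X ω) • X ω = (1 - χ n (X ω)) • X ω := by module
      rw [this, norm_smul, Real.norm_of_nonneg (sub_nonneg.2 (h1 n _))]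
      exact mul_le_of_le_one_left (norm_nonneg _) (by linarith [h0 n (X ω)])
    · rw [Set.indicator_of_notMem hω, h3 n _ (not_le.1 hω).le]
      simp
  have hlim := (tendsto_eLpNorm_indicator_norm_ge hX hp1 ENNReal.ofReal_ne_top hXp).add hKlim
  rw [zero_add] at hlim
  rw [add_comm]
  exact ge_of_tendsto' hlim hfin

end TruncationLimit

/-! ### Operator and Hilbert–Schmidt norms -/

section MatrixNorms

variable {d : ℕ}

theorem hsNorm_nonneg (A : Matrix (Fin d) (Fin d) ℝ) : 0 ≤ hsNorm A := Real.sqrt_nonneg _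

theorem hsNorm_sq (A : Matrix (Fin d) (Fin d) ℝ) : hsNorm A ^ 2 = ∑ i, ∑ j, A i j ^ 2 :=
  Real.sq_sqrt (Finset.sum_nonneg fun _ _ => Finset.sum_nonneg fun _ _ => sq_nonneg _)

theorem hsNorm_transpose (A : Matrix (Fin d) (Fin d) ℝ) : hsNorm A.transpose = hsNorm A := by
  unfold hsNorm
  rw [Finset.sum_comm]
  rfl

theorem opNorm_le_hsNorm (A : Matrix (Fin d) (Fin d) ℝ) : opNorm A ≤ hsNorm A := by
  refine ContinuousLinearMap.opNorm_le_bound _ (hsNorm_nonneg A) fun v => ?_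
  refine le_of_sq_le_sq ?_ (mul_nonneg (hsNorm_nonneg A) (norm_nonneg v))
  rw [mul_pow, hsNorm_sq, EuclideanSpace.norm_sq_eq, EuclideanSpace.norm_sq_eq, Finset.sum_mul]
  refine Finset.sum_le_sum fun i _ => ?_
  simp only [Matrix.ofLp_toEuclideanCLM, Real.norm_eq_abs, sq_abs]
  exact Finset.sum_mul_sq_le_sq_mul_sq Finset.univ (fun j => A i j) v.ofLp

/-- The columns of the product are the images under `A` of the columns of `B`, and the squared
Hilbert–Schmidt norm is the sum of the squared norms of the columns. -/
theorem hsNorm_mul_le (A B : Matrix (Fin d) (Fin d) ℝ) : hsNorm (A * B) ≤ opNorm A * hsNorm B := by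
  have hA : 0 ≤ opNorm A := norm_nonneg _
  refine le_of_sq_le_sq ?_ (mul_nonneg hA (hsNorm_nonneg B))
  have e : ∀ M : Matrix (Fin d) (Fin d) ℝ, hsNorm M ^ 2 = ∑ j, ∑ i, M i j ^ 2 := fun M => by
    rw [hsNorm_sq, Finset.sum_comm]
  rw [mul_pow, e, e, Finset.mul_sum]
  refine Finset.sum_le_sum fun j _ => ?_
  have h := (Matrix.toEuclideanCLM (n := Fin d) (𝕜 := ℝ) A).le_opNorm
    (WithLp.toLp 2 fun i => B i j)
  have h2 := pow_le_pow_left₀ (norm_nonneg _) h 2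
  rw [mul_pow, EuclideanSpace.norm_sq_eq, EuclideanSpace.norm_sq_eq] at h2
  simp only [Matrix.ofLp_toEuclideanCLM, Real.norm_eq_abs, sq_abs] at h2
  exact h2

theorem hsNorm_conj_le {S : Matrix (Fin d) (Fin d) ℝ} (hS : S.transpose = S)
    (M : Matrix (Fin d) (Fin d) ℝ) : hsNorm (S * M * S) ≤ opNorm S ^ 2 * hsNorm M := by
  have hn : 0 ≤ opNorm S := norm_nonneg _
  calc hsNorm (S * M * S) = hsNorm (S * (M * S)) := by rw [mul_assoc]
    _ ≤ opNorm S * hsNorm (M * S) := hsNorm_mul_le _ _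
    _ = opNorm S * hsNorm (S * M.transpose) := by
      rw [← hsNorm_transpose (M * S), Matrix.transpose_mul, hS]
    _ ≤ opNorm S * (opNorm S * hsNorm M.transpose) := by
      gcongr
      exact hsNorm_mul_le _ _
    _ = _ := by rw [hsNorm_transpose]; ring

/-- The C*-identity for a self-adjoint operator. -/
theorem opNorm_mul_self {S : Matrix (Fin d) (Fin d) ℝ} (hS : S.transpose = S) :
    opNorm (S * S) = opNorm S ^ 2 := by
  have h : IsSelfAdjoint (Matrix.toEuclideanCLM (n := Fin d) (𝕜 := ℝ) S) := by
    rw [IsSelfAdjoint, ← map_star, Matrix.star_eq_conjTranspose,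
      Matrix.conjTranspose_eq_transpose_of_trivial, hS]
  unfold opNorm
  rw [map_mul, h.norm_mul_self]

theorem hsNorm_of_dim_zero (A : Matrix (Fin 0) (Fin 0) ℝ) : hsNorm A = 0 := by
  simp [hsNorm]

end MatrixNorms

/-! ### From the carré du champ to a Stein identity -/

namespace DiffusiveMarkov

variable {Ω : Type*} [MeasurableSpace Ω] {P : Measure Ω} [IsProbabilityMeasure P]
  (D : DiffusiveMarkov P)

/-- Integration by parts. -/
theorem integral_comp_mul_L {k : ℕ} (X : Fin k → D.domE) (f : D.domL) {ψ : (Fin k → ℝ) → ℝ}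
    (hψ : ContDiff ℝ (⊤ : ℕ∞) ψ) (hL : ∃ K, LipschitzWith K ψ) :
    ∫ ω, ψ (fun i => (X i : Lp ℝ 2 P) ω) * D.L f ω ∂P =
      ∫ ω, ∑ i, fderiv ℝ ψ (fun j => (X j : Lp ℝ 2 P) ω) (Pi.single i 1) *
        D.Γ (X i) (-(f : D.domE)) ω ∂P := by
  -- The chain rule places `ψ(X)` in the domain of the form, so it may be paired with the generator.
  obtain ⟨h, hh, hΓ⟩ := D.chain_rule k X ψ hψ hL
  have h1 := D.energy_eq_neg_inner_L f h
  rw [L2.inner_def] at h1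
  have h2 : ∫ ω, ψ (fun i => (X i : Lp ℝ 2 P) ω) * D.L f ω ∂P =
      ∫ ω, inner ℝ (D.L f ω) ((h : Lp ℝ 2 P) ω) ∂P := by
    refine integral_congr_ae ?_
    filter_upwards [hh] with ω hω
    rw [hω]
    simp [inner]
  rw [h2, ← neg_eq_iff_eq_neg.2 h1, energy, D.symm, ← integral_neg]
  refine integral_congr_ae ?_
  have h3 : ∀ i, ∀ᵐ ω ∂P, D.Γ (X i) (-(f : D.domE)) ω = -D.Γ (X i) f ω := fun i => by
    rw [map_neg]
    exact Lp.coeFn_neg _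
  filter_upwards [hΓ f, ae_all_iff.2 h3] with ω h4 h5
  rw [h4, ← Finset.sum_neg_distrib]
  exact Finset.sum_congr rfl fun i _ => by rw [h5]; ring

variable {d : ℕ}

/-- The vector with the given components. -/
noncomputable def vector (X : Fin d → D.domE) (ω : Ω) : EuclideanSpace ℝ (Fin d) :=
  WithLp.toLp 2 fun i => (X i : Lp ℝ 2 P) ω

theorem measurable_vector (X : Fin d → D.domE) : Measurable (D.vector X) :=
  (PiLp.continuous_toLp 2 _).measurable.comp
    (measurable_pi_lambda _ fun _ => (Lp.stronglyMeasurable _).measurable)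

/-- The matrix-valued carré du champ as an operator. -/
noncomputable def gammaCLM (X G : Fin d → D.domE) (ω : Ω) :
    EuclideanSpace ℝ (Fin d) →L[ℝ] EuclideanSpace ℝ (Fin d) :=
  Matrix.toEuclideanCLM (n := Fin d) (𝕜 := ℝ) (D.gammaMatrix X G ω)

theorem integrable_gammaCLM (X G : Fin d → D.domE) : Integrable (D.gammaCLM X G) P := by
  let Λ : (Fin d → Fin d → ℝ) →ₗ[ℝ] EuclideanSpace ℝ (Fin d) →L[ℝ] EuclideanSpace ℝ (Fin d) :=
    { toFun := fun M => Matrix.toEuclideanCLM (n := Fin d) (𝕜 := ℝ) (Matrix.of M)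
      map_add' := fun M N => map_add (Matrix.toEuclideanCLM (n := Fin d) (𝕜 := ℝ)) _ _
      map_smul' := fun c M => map_smul (Matrix.toEuclideanCLM (n := Fin d) (𝕜 := ℝ)) _ _ }
  have h1 : Integrable (fun ω (i j : Fin d) => D.Γ (X i) (G j) ω) P :=
    Integrable.of_eval fun i => Integrable.of_eval fun j => L1.integrable_coeFn _
  exact (LinearMap.toContinuousLinearMap Λ).integrable_comp h1

/-- A smooth function with compact support is Lipschitz, hence admissible in the chain rule.
Integration by parts against `L (F j)` produces the `j`-th column of the matrix `Γ[X, -F]`; a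
general `w` follows by linearity. -/
theorem compactSteinIdentity (F : Fin d → D.domL) (X : Fin d → D.domE) {Z : Fin d → Ω → ℝ}
    (hZ : ∀ i, Integrable (Z i) P)
    (h : ∀ i, ((X i : Lp ℝ 2 P) : Ω → ℝ) =ᵐ[P] fun ω => D.L (F i) ω + Z i ω) :
    CompactSteinIdentity P (D.vector X) (fun ω => WithLp.toLp 2 fun i => Z i ω)
      (D.gammaCLM X fun j => -(F j : D.domE)) := by
  intro k hk hkc w
  set ψ : (Fin d → ℝ) → ℝ := fun y => k (WithLp.toLp 2 y) with hψ
  let e : (Fin d → ℝ) ≃L[ℝ] EuclideanSpace ℝ (Fin d) :=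
    (PiLp.continuousLinearEquiv 2 ℝ fun _ : Fin d => ℝ).symm
  have hψs : ContDiff ℝ (⊤ : ℕ∞) ψ := hk.comp e.contDiff
  have hψL : ∃ K, LipschitzWith K ψ := by
    obtain ⟨K, hK⟩ := hk.lipschitzWith_of_hasCompactSupport hkc (by simp)
    exact ⟨_, hK.comp (e : (Fin d → ℝ) →L[ℝ] EuclideanSpace ℝ (Fin d)).lipschitz⟩
  have hψd : ∀ ω v, fderiv ℝ ψ (fun j => (X j : Lp ℝ 2 P) ω) v =
      fderiv ℝ k (D.vector X ω) (WithLp.toLp 2 v) := by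
    intro ω v
    have h1 : HasFDerivAt ψ _ (fun j => (X j : Lp ℝ 2 P) ω) :=
      HasFDerivAt.comp (fun j => (X j : Lp ℝ 2 P) ω)
        ((hk.differentiable (by simp)) (D.vector X ω)).hasFDerivAt e.hasFDerivAt
    rw [h1.fderiv]
    rfl
  have hkm : Measurable fun ω => k (D.vector X ω) :=
    hk.continuous.measurable.comp (D.measurable_vector X)
  obtain ⟨C, hC⟩ := hkc.exists_bound_of_continuous hk.continuous
  have iZ : ∀ j, Integrable (fun ω => k (D.vector X ω) * Z j ω) P := fun j =>
    (hZ j).bdd_mul hkm.aestronglyMeasurable (Eventually.of_forall fun ω => hC _)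
  have iL : ∀ j, Integrable (fun ω => k (D.vector X ω) * D.L (F j) ω) P := fun j =>
    ((Lp.memLp (D.L (F j))).integrable (by norm_num)).bdd_mul hkm.aestronglyMeasurable
      (Eventually.of_forall fun ω => hC _)
  have iΓ : ∀ j, Integrable (fun ω => fderiv ℝ k (D.vector X ω)
      (D.gammaCLM X (fun j => -(F j : D.domE)) ω (EuclideanSpace.single j 1))) P := fun j =>
    integrable_comp_clm_apply (D.measurable_vector X) (D.integrable_gammaCLM X _)
      (hk.continuous_fderiv (by simp)) (hkc.fderiv ℝ) _
  have hcol : ∀ j ω, fderiv ℝ k (D.vector X ω)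
      (D.gammaCLM X (fun j => -(F j : D.domE)) ω (EuclideanSpace.single j 1)) =
      ∑ i, fderiv ℝ ψ (fun j => (X j : Lp ℝ 2 P) ω) (Pi.single i 1) *
        D.Γ (X i) (-(F j : D.domE)) ω := by
    intro j ω
    have e1 : D.gammaCLM X (fun j => -(F j : D.domE)) ω (EuclideanSpace.single j 1) =
        ∑ i, D.Γ (X i) (-(F j : D.domE)) ω • WithLp.toLp 2 (Pi.single i (1 : ℝ)) := by
      ext i
      simp [gammaCLM, gammaMatrix, Pi.single_apply]
    rw [e1, map_sum]
    refine Finset.sum_congr rfl fun i _ => ?_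
    rw [map_smul, hψd, smul_eq_mul, mul_comm]
  have hj : ∀ j, ∫ ω, k (D.vector X ω) * (X j : Lp ℝ 2 P) ω ∂P =
      ∫ ω, k (D.vector X ω) * Z j ω ∂P + ∫ ω, fderiv ℝ k (D.vector X ω)
      (D.gammaCLM X (fun j => -(F j : D.domE)) ω (EuclideanSpace.single j 1)) ∂P := by
    intro j
    simp_rw [hcol]
    rw [← D.integral_comp_mul_L X (F j) hψs hψL]
    refine Eq.trans ?_ (integral_add (iZ j) (iL j))
    refine integral_congr_ae ?_
    filter_upwards [h j] with ω hω
    rw [hω, mul_add, add_comm]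
    congr 1
  have hw : w = ∑ j, w j • EuclideanSpace.single j (1 : ℝ) := by
    ext i
    simp [Pi.single_apply]
  have e1 : ∀ ω, k (D.vector X ω) * inner ℝ (D.vector X ω) w =
      ∑ j, w j * (k (D.vector X ω) * (X j : Lp ℝ 2 P) ω) := fun ω => by
    rw [PiLp.inner_apply, Finset.mul_sum]
    refine Finset.sum_congr rfl fun j _ => ?_
    simp [vector, inner]
    ring
  have e2 : ∀ ω, k (D.vector X ω) * inner ℝ (WithLp.toLp 2 fun i => Z i ω) w =
      ∑ j, w j * (k (D.vector X ω) * Z j ω) := fun ω => by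
    rw [PiLp.inner_apply, Finset.mul_sum]
    refine Finset.sum_congr rfl fun j _ => ?_
    simp [inner]
    ring
  have e3 : ∀ ω, fderiv ℝ k (D.vector X ω) (D.gammaCLM X (fun j => -(F j : D.domE)) ω w) =
      ∑ j, w j * fderiv ℝ k (D.vector X ω)
        (D.gammaCLM X (fun j => -(F j : D.domE)) ω (EuclideanSpace.single j 1)) := fun ω => by
    conv_lhs => rw [hw]
    simp only [map_sum, map_smul, smul_eq_mul]
  have iX : ∀ j, Integrable (fun ω => k (D.vector X ω) * (X j : Lp ℝ 2 P) ω) P := fun j =>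
    ((Lp.memLp _).integrable (by norm_num)).bdd_mul hkm.aestronglyMeasurable
      (Eventually.of_forall fun ω => hC _)
  simp_rw [e1, e2, e3]
  rw [integral_finsetSum _ fun j _ => (iX j).const_mul _,
    integral_finsetSum _ fun j _ => (iZ j).const_mul _,
    integral_finsetSum _ fun j _ => (iΓ j).const_mul _, ← Finset.sum_add_distrib]
  refine Finset.sum_congr rfl fun j _ => ?_
  rw [integral_const_mul, integral_const_mul, integral_const_mul, hj]
  ring

end DiffusiveMarkov

/-- Otherwise the Gaussian law would be concentrated at `0` and have characteristic function `1`.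
This is needed in order that an infinite norm, multiplied by that of `N`, remains infinite. -/
theorem eLpNorm_id_stdGaussian_ne_zero {E : Type*} [NormedAddCommGroup E] [InnerProductSpace ℝ E]
    [FiniteDimensional ℝ E] [MeasurableSpace E] [BorelSpace E] [Nontrivial E] {q : ℝ≥0∞}
    (hq : q ≠ 0) : eLpNorm id q (stdGaussian E) ≠ 0 := by
  intro h
  rw [eLpNorm_eq_zero_iff (by fun_prop) hq] at h
  obtain ⟨t, ht⟩ := exists_ne (0 : E)
  have h1 := charFun_stdGaussian t
  rw [charFun_apply] at h1
  have h2 : ∫ x, Complex.exp (inner ℝ x t * Complex.I) ∂(stdGaussian E) = 1 := by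
    rw [integral_congr_ae (g := fun _ => (1 : ℂ))]
    · simp
    · filter_upwards [h] with x hx
      simp only [id, Pi.zero_apply] at hx
      simp [hx]
  rw [h2] at h1
  have h3 : Complex.exp (-(‖t‖ : ℂ) ^ 2 / 2) = ((Real.exp (-‖t‖ ^ 2 / 2) : ℝ) : ℂ) := by
    push_cast
    rfl
  rw [h3] at h1
  have h4 : Real.exp (-‖t‖ ^ 2 / 2) = 1 := by exact_mod_cast h1.symm
  have h5 : 0 < ‖t‖ := norm_pos_iff.2 ht
  rw [Real.exp_eq_one_iff] at h4
  nlinarith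

/-! ### The multivariate Wasserstein bounds -/

namespace DiffusiveMarkov

variable {Ω : Type*} [MeasurableSpace Ω] {P : Measure Ω} [IsProbabilityMeasure P]
  (D : DiffusiveMarkov P) {d : ℕ}

theorem wassersteinDist_le {p : ℝ} (hp : 1 ≤ p) (F : Fin d → D.domL) (X : Fin d → D.domE)
    {Z : Fin d → Ω → ℝ} (hZ : ∀ i, MemLp (Z i) (ENNReal.ofReal p) P)
    (h : ∀ i, ((X i : Lp ℝ 2 P) : Ω → ℝ) =ᵐ[P] fun ω => D.L (F i) ω + Z i ω)
    {S : Matrix (Fin d) (Fin d) ℝ} (hS : S.PosDef) :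
    wassersteinDist p (P.map (D.vector X))
        ((stdGaussian (EuclideanSpace ℝ (Fin d))).map (Matrix.toEuclideanCLM (n := Fin d) (𝕜 := ℝ) S))
      ≤ ENNReal.ofReal (opNorm S)
            * eLpNorm id (ENNReal.ofReal p) (stdGaussian (EuclideanSpace ℝ (Fin d)))
            * eLpNorm (fun ω => hsNorm
                (1 - S⁻¹ * D.gammaMatrix X (fun j => -(F j : D.domE)) ω * S⁻¹))
                (ENNReal.ofReal p) P
          + eLpNorm (fun ω => WithLp.toLp 2 fun i => Z i ω) (ENNReal.ofReal p) P := by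
  have hp1 : 1 ≤ ENNReal.ofReal p := by simpa using hp
  have hdet : IsUnit S.det := (Matrix.isUnit_iff_isUnit_det S).1 hS.isUnit
  set φ := Matrix.toEuclideanCLM (n := Fin d) (𝕜 := ℝ) with hφ
  have hSB : ∀ x, φ S (φ S⁻¹ x) = x := fun x => by
    rw [← mul_apply_eq_comp, ← map_mul, Matrix.mul_nonsing_inv _ hdet, map_one]
    rfl
  have hBS : ∀ x, φ S⁻¹ (φ S x) = x := fun x => by
    rw [← mul_apply_eq_comp, ← map_mul, Matrix.nonsing_inv_mul _ hdet, map_one]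
    rfl
  have hsa : IsSelfAdjoint (φ S⁻¹) := by
    rw [IsSelfAdjoint, ← map_star]
    congr 1
    exact hS.isHermitian.inv
  have hB : ∀ x y, inner ℝ (φ S⁻¹ x) y = inner ℝ x (φ S⁻¹ y) := fun x y =>
    hsa.isSymmetric x y
  have e : ∀ ω, 1 - φ S⁻¹ ∘L D.gammaCLM X (fun j => -(F j : D.domE)) ω ∘L φ S⁻¹ =
      φ (1 - S⁻¹ * D.gammaMatrix X (fun j => -(F j : D.domE)) ω * S⁻¹) := fun ω => by
    rw [map_sub, map_one, map_mul, map_mul, mul_assoc]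
    rfl
  have hn : ∀ ω, ‖1 - φ S⁻¹ ∘L D.gammaCLM X (fun j => -(F j : D.domE)) ω ∘L φ S⁻¹‖ ≤
      ‖hsNorm (1 - S⁻¹ * D.gammaMatrix X (fun j => -(F j : D.domE)) ω * S⁻¹)‖ := fun ω => by
    rw [e, Real.norm_of_nonneg (hsNorm_nonneg _)]
    exact opNorm_le_hsNorm _
  have hle := eLpNorm_mono (p := ENNReal.ofReal p) (μ := P) hn
  set K := eLpNorm (fun ω => hsNorm
    (1 - S⁻¹ * D.gammaMatrix X (fun j => -(F j : D.domE)) ω * S⁻¹)) (ENNReal.ofReal p) P with hK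
  -- With the convention `0 * ⊤ = 0`, an infinite `K` makes the bound trivial only if the other
  -- factors are nonzero. They are in positive dimension, and in dimension `0` the norm `K` is zero.
  rcases eq_or_ne K ⊤ with hKt | hKt
  · have hd : d ≠ 0 := by
      rintro rfl
      simp [hK, hsNorm_of_dim_zero] at hKt
    have : Nonempty (Fin d) := ⟨⟨0, Nat.pos_of_ne_zero hd⟩⟩
    have hN := eLpNorm_id_stdGaussian_ne_zero (E := EuclideanSpace ℝ (Fin d))
      (q := ENNReal.ofReal p) (by simp; linarith)
    have hop : 0 < opNorm S := by
      refine norm_pos_iff.2 fun h0 => ?_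
      obtain ⟨x, hx⟩ := exists_ne (0 : EuclideanSpace ℝ (Fin d))
      refine hx ?_
      rw [← hSB x, hφ, h0]
      rfl
    rw [hKt, ENNReal.mul_top, top_add]
    · exact le_top
    · exact mul_ne_zero (ENNReal.ofReal_pos.2 hop).ne' hN
  · have hm : AEStronglyMeasurable (fun ω => 1 - φ S⁻¹ ∘L
        D.gammaCLM X (fun j => -(F j : D.domE)) ω ∘L φ S⁻¹) P := by
      have hg : Continuous fun a : EuclideanSpace ℝ (Fin d) →L[ℝ] EuclideanSpace ℝ (Fin d) =>
        1 - φ S⁻¹ ∘L a ∘L φ S⁻¹ := by fun_prop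
      exact hg.comp_aestronglyMeasurable (D.integrable_gammaCLM X _).1
    have hst := D.compactSteinIdentity F X (fun i => (hZ i).integrable hp1) h
    refine (hst.wassersteinDist_le (D.measurable_vector X) hp (MemLp.of_eval_piLp hZ) hSB hBS hB
      ⟨hm, hle.trans_lt (lt_top_iff_ne_top.2 hKt)⟩).trans ?_
    refine add_le_add ?_ le_rfl
    rw [mul_assoc]
    refine mul_le_mul_right ?_ _
    rw [mul_comm]
    exact mul_le_mul_right hle _

/-- One has `1 - S⁻¹ Γ S⁻¹ = S⁻¹ (S² - Γ) S⁻¹`. As `S⁻¹` is symmetric, the conjugation costs `‖S⁻¹‖²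
= ‖S⁻²‖` in operator norm. -/
theorem eLpNorm_hsNorm_conj_le (X G : Fin d → D.domE) {S : Matrix (Fin d) (Fin d) ℝ}
    (hS : S.PosDef) (q : ℝ≥0∞) :
    eLpNorm (fun ω => hsNorm (1 - S⁻¹ * D.gammaMatrix X G ω * S⁻¹)) q P ≤
      ENNReal.ofReal (opNorm (S ^ 2)⁻¹) *
        eLpNorm (fun ω => hsNorm (S ^ 2 - D.gammaMatrix X G ω)) q P := by
  have hdet : IsUnit S.det := (Matrix.isUnit_iff_isUnit_det S).1 hS.isUnit
  have hinv : S⁻¹.transpose = S⁻¹ := by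
    have := hS.isHermitian.inv
    rwa [Matrix.IsHermitian, Matrix.conjTranspose_eq_transpose_of_trivial] at this
  have h1 : opNorm (S ^ 2)⁻¹ = opNorm S⁻¹ ^ 2 := by
    rw [sq, Matrix.mul_inv_rev, opNorm_mul_self hinv]
  have h2 : ∀ ω, ‖hsNorm (1 - S⁻¹ * D.gammaMatrix X G ω * S⁻¹)‖ ≤
      ‖(opNorm (S ^ 2)⁻¹ • fun ω => hsNorm (S ^ 2 - D.gammaMatrix X G ω)) ω‖ := fun ω => by
    have e : 1 - S⁻¹ * D.gammaMatrix X G ω * S⁻¹ =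
        S⁻¹ * (S ^ 2 - D.gammaMatrix X G ω) * S⁻¹ := by
      rw [mul_sub, sub_mul, sq, ← mul_assoc S⁻¹ S S, Matrix.nonsing_inv_mul _ hdet, one_mul,
        Matrix.mul_nonsing_inv _ hdet]
    rw [e, Pi.smul_apply, smul_eq_mul, h1, Real.norm_of_nonneg (hsNorm_nonneg _),
      Real.norm_of_nonneg (mul_nonneg (sq_nonneg _) (hsNorm_nonneg _))]
    exact hsNorm_conj_le hinv _
  refine (eLpNorm_mono h2).trans ?_
  rw [eLpNorm_const_smul, Real.enorm_eq_ofReal (show 0 ≤ opNorm (S ^ 2)⁻¹ from norm_nonneg _)]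

end DiffusiveMarkov

/-! ### Inequalities for Gaussian tails -/

section GaussianTails

theorem hasDerivAt_integral_Iic {φ : ℝ → ℝ} (hc : Continuous φ) (hi : Integrable φ) (x : ℝ) :
    HasDerivAt (fun x => ∫ t in Set.Iic x, φ t) (φ x) x := by
  have h1 : (fun x => ∫ t in Set.Iic x, φ t) =
      fun x => (∫ t in Set.Iic 0, φ t) + ∫ t in (0 : ℝ)..x, φ t := by
    ext x
    rw [← intervalIntegral.integral_Iic_sub_Iic hi.integrableOn hi.integrableOn]
    ring
  rw [h1]
  exact (intervalIntegral.integral_hasDerivAt_right (hc.intervalIntegrable _ _)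
    hc.aestronglyMeasurable.stronglyMeasurableAtFilter hc.continuousAt).const_add _

/-- The unnormalised Gaussian weight. -/
noncomputable def gaussWeight (x : ℝ) : ℝ := Real.exp (-x ^ 2 / 2)

theorem gaussWeight_pos (x : ℝ) : 0 < gaussWeight x := Real.exp_pos _

theorem gaussWeight_neg (x : ℝ) : gaussWeight (-x) = gaussWeight x := by simp [gaussWeight]

theorem contDiff_gaussWeight : ContDiff ℝ (⊤ : ℕ∞) gaussWeight := by
  unfold gaussWeight
  fun_prop

theorem continuous_gaussWeight : Continuous gaussWeight := contDiff_gaussWeight.continuous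

theorem hasDerivAt_gaussWeight (x : ℝ) : HasDerivAt gaussWeight (-(x * gaussWeight x)) x := by
  have h1 : HasDerivAt (fun x : ℝ => -x ^ 2 / 2) (-x) x := by
    refine ((hasDerivAt_pow 2 x).neg.div_const 2).congr_deriv ?_
    simp
    ring
  refine h1.exp.congr_deriv ?_
  rw [gaussWeight]
  ring

theorem integrable_gaussWeight : Integrable gaussWeight := by
  refine (integrable_exp_neg_mul_sq (b := 1 / 2) (by norm_num)).congr (Eventually.of_forall ?_)
  intro x
  simp only [gaussWeight]
  congr 1
  ring

theorem integral_gaussWeight : ∫ x, gaussWeight x = Real.sqrt (2 * Real.pi) := by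
  have h := integral_gaussian (1 / 2)
  rw [show Real.pi / (1 / 2) = 2 * Real.pi by ring] at h
  rw [← h]
  refine integral_congr_ae (Eventually.of_forall fun x => ?_)
  simp only [gaussWeight]
  congr 1
  ring

theorem tendsto_gaussWeight : Tendsto gaussWeight atTop (𝓝 0) := by
  refine Real.tendsto_exp_atBot.comp ?_
  have h : Tendsto (fun x : ℝ => x ^ 2 / 2) atTop atTop :=
    (tendsto_pow_atTop (by norm_num)).atTop_div_const (by norm_num)
  simpa [neg_div, Function.comp_def] using tendsto_neg_atTop_atBot.comp h

/-- The lower Gaussian tail, unnormalised. -/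
noncomputable def lowerTail (x : ℝ) : ℝ := ∫ t in Set.Iic x, gaussWeight t

/-- The upper Gaussian tail, unnormalised. -/
noncomputable def upperTail (x : ℝ) : ℝ := ∫ t in Set.Ioi x, gaussWeight t

theorem lowerTail_add_upperTail (x : ℝ) : lowerTail x + upperTail x = Real.sqrt (2 * Real.pi) := by
  rw [← integral_gaussWeight]
  exact intervalIntegral.integral_Iic_add_Ioi integrable_gaussWeight.integrableOn
    integrable_gaussWeight.integrableOn

theorem lowerTail_neg (x : ℝ) : lowerTail (-x) = upperTail x := by
  rw [lowerTail, upperTail, ← integral_comp_neg_Ioi x gaussWeight]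
  simp_rw [gaussWeight_neg]

theorem upperTail_neg (x : ℝ) : upperTail (-x) = lowerTail x := by
  rw [← lowerTail_neg, neg_neg]

theorem lowerTail_nonneg (x : ℝ) : 0 ≤ lowerTail x :=
  integral_nonneg fun t => (gaussWeight_pos t).le

theorem upperTail_nonneg (x : ℝ) : 0 ≤ upperTail x :=
  integral_nonneg fun t => (gaussWeight_pos t).le

theorem hasDerivAt_lowerTail (x : ℝ) : HasDerivAt lowerTail (gaussWeight x) x :=
  hasDerivAt_integral_Iic continuous_gaussWeight integrable_gaussWeight x

theorem upperTail_eq (x : ℝ) : upperTail x = Real.sqrt (2 * Real.pi) - lowerTail x := by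
  rw [← lowerTail_add_upperTail x]
  ring

theorem hasDerivAt_upperTail (x : ℝ) : HasDerivAt upperTail (-gaussWeight x) x := by
  rw [show upperTail = fun x => Real.sqrt (2 * Real.pi) - lowerTail x from funext upperTail_eq]
  exact (hasDerivAt_lowerTail x).const_sub _

theorem tendsto_upperTail : Tendsto upperTail atTop (𝓝 0) := by
  have h : Tendsto lowerTail atTop (𝓝 (∫ x, gaussWeight x)) :=
    (aecover_Iic tendsto_id).integral_tendsto_of_countably_generated integrable_gaussWeight
  rw [integral_gaussWeight] at h
  rw [show upperTail = fun x => Real.sqrt (2 * Real.pi) - lowerTail x from funext upperTail_eq]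
  simpa using h.const_sub (Real.sqrt (2 * Real.pi))

/-- Mills' inequality. -/
theorem mul_upperTail_le (x : ℝ) : x * upperTail x ≤ gaussWeight x := by
  -- The derivative is `(x - y)` times the weight, and the function tends to `0` at infinity, hence
  -- is nonnegative at `x`.
  have hanti : AntitoneOn (fun y => gaussWeight y - x * upperTail y) (Set.Ici x) := by
    refine antitoneOn_of_deriv_nonpos (convex_Ici x) ?_ ?_ fun y hy => ?_
    · exact fun y _ => ((hasDerivAt_gaussWeight y).sub
        ((hasDerivAt_upperTail y).const_mul x)).continuousAt.continuousWithinAt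
    · exact fun y _ => ((hasDerivAt_gaussWeight y).sub
        ((hasDerivAt_upperTail y).const_mul x)).differentiableAt.differentiableWithinAt
    · have h1 : HasDerivAt (fun y => gaussWeight y - x * upperTail y) _ y :=
        (hasDerivAt_gaussWeight y).sub ((hasDerivAt_upperTail y).const_mul x)
      rw [h1.deriv]
      rw [interior_Ici, Set.mem_Ioi] at hy
      have := gaussWeight_pos y
      nlinarith
  have hlim : Tendsto (fun y => gaussWeight y - x * upperTail y) atTop (𝓝 (0 - x * 0)) :=
    tendsto_gaussWeight.sub (tendsto_upperTail.const_mul x)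
  have h1 : (0 : ℝ) - x * 0 ≤ gaussWeight x - x * upperTail x := by
    refine le_of_tendsto hlim ?_
    filter_upwards [eventually_ge_atTop x] with y hy
      using hanti Set.self_mem_Ici hy hy
  linarith

/-- The difference `g` of the two sides vanishes at `0` and at infinity, and its derivative is the
weight times a function `k` which is concave on `[0, ∞)` with `k 0 = 0`. If `g x < 0`, then `k` is
negative at some `ξ` before `x`, hence nonpositive from `ξ` on. So `g` decreases to `0` on `[ξ, ∞)`
and cannot be negative at `x`. -/
theorem four_mul_tails_le_of_nonneg {x : ℝ} (hx : 0 ≤ x) :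
    4 * (lowerTail x * upperTail x) ≤ 2 * Real.pi * gaussWeight x := by
  have hc2 : Real.sqrt (2 * Real.pi) ^ 2 = 2 * Real.pi := Real.sq_sqrt (by positivity)
  set g : ℝ → ℝ := fun x => 2 * Real.pi * gaussWeight x - 4 * (lowerTail x * upperTail x) with hg
  set k : ℝ → ℝ := fun x => 4 * (lowerTail x - upperTail x) - 2 * Real.pi * x with hk
  have hgd : ∀ y, HasDerivAt g (gaussWeight y * k y) y := fun y => by
    refine (((hasDerivAt_gaussWeight y).const_mul _).sub
      (((hasDerivAt_lowerTail y).mul (hasDerivAt_upperTail y)).const_mul 4)).congr_deriv ?_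
    simp only [hk]
    ring
  have hkd : ∀ y, HasDerivAt k (8 * gaussWeight y - 2 * Real.pi) y := fun y => by
    refine ((((hasDerivAt_lowerTail y).sub (hasDerivAt_upperTail y)).const_mul 4).sub
      ((hasDerivAt_id y).const_mul (2 * Real.pi))).congr_deriv ?_
    ring
  have h0 : lowerTail 0 = upperTail 0 := by
    have := lowerTail_neg 0
    rwa [neg_zero] at this
  have hk0 : k 0 = 0 := by simp [hk, h0]
  have hg0 : g 0 = 0 := by
    have h1 := lowerTail_add_upperTail 0
    rw [h0] at h1
    simp only [hg, h0, gaussWeight]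
    rw [← hc2, ← h1]
    norm_num
    ring
  have hconc : ConcaveOn ℝ (Set.Ici 0) k := by
    refine AntitoneOn.concaveOn_of_deriv (convex_Ici 0)
      (fun y _ => (hkd y).continuousAt.continuousWithinAt)
      (fun y _ => (hkd y).differentiableAt.differentiableWithinAt) fun y hy z hz hyz => ?_
    rw [(hkd y).deriv, (hkd z).deriv]
    have : gaussWeight z ≤ gaussWeight y := by
      rw [interior_Ici, Set.mem_Ioi] at hy
      exact Real.exp_le_exp.2 (by nlinarith)
    linarith
  have hglim : Tendsto g atTop (𝓝 0) := by
    have h1 : Tendsto lowerTail atTop (𝓝 (∫ x, gaussWeight x)) :=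
      (aecover_Iic tendsto_id).integral_tendsto_of_countably_generated integrable_gaussWeight
    simpa using (tendsto_gaussWeight.const_mul (2 * Real.pi)).sub
      ((h1.mul tendsto_upperTail).const_mul 4)
  by_contra! hneg
  have hgx : g x < 0 := by
    simp only [hg]
    linarith
  have hx0 : 0 < x := lt_of_le_of_ne hx fun h => by
    rw [← h, hg0] at hgx
    exact lt_irrefl _ hgx
  obtain ⟨ξ, hξ, hξe⟩ := exists_hasDerivAt_eq_slope g _ hx0
    (fun y _ => (hgd y).continuousAt.continuousWithinAt) fun y _ => hgd y
  have hkξ : k ξ < 0 := by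
    have h1 : (g x - g 0) / (x - 0) < 0 := by
      rw [hg0, sub_zero, sub_zero]
      exact div_neg_of_neg_of_pos hgx hx0
    rw [← hξe] at h1
    exact neg_of_mul_neg_right h1 (gaussWeight_pos ξ).le
  have hkneg : ∀ y, ξ ≤ y → k y ≤ 0 := by
    intro y hy
    by_contra! hpos
    have hy0 : 0 < y := hξ.1.trans_le hy
    have h1 := hconc.2 (Set.mem_Ici.2 le_rfl) (Set.mem_Ici.2 hy0.le) (sub_nonneg.2 ((div_le_one hy0).2 hy))
      (div_nonneg hξ.1.le hy0.le) (by ring)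
    rw [hk0] at h1
    simp only [smul_eq_mul, mul_zero, zero_add, div_mul_cancel₀ _ hy0.ne'] at h1
    have := mul_pos (div_pos hξ.1 hy0) hpos
    linarith
  have hanti : AntitoneOn g (Set.Ici ξ) := by
    refine antitoneOn_of_deriv_nonpos (convex_Ici ξ)
      (fun y _ => (hgd y).continuousAt.continuousWithinAt)
      (fun y _ => (hgd y).differentiableAt.differentiableWithinAt) fun y hy => ?_
    rw [(hgd y).deriv]
    rw [interior_Ici] at hy
    exact mul_nonpos_of_nonneg_of_nonpos (gaussWeight_pos y).le (hkneg y (le_of_lt hy))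
  have h1 : (0 : ℝ) ≤ g x := by
    refine le_of_tendsto hglim ?_
    filter_upwards [eventually_ge_atTop x] with y hy
      using hanti (Set.mem_Ici.2 hξ.2.le) (Set.mem_Ici.2 (hξ.2.le.trans hy)) hy
  linarith

theorem four_mul_tails_le (x : ℝ) :
    4 * (lowerTail x * upperTail x) ≤ 2 * Real.pi * gaussWeight x := by
  rcases le_total 0 x with hx | hx
  · exact four_mul_tails_le_of_nonneg hx
  · have h := four_mul_tails_le_of_nonneg (neg_nonneg.2 hx)
    rw [lowerTail_neg, upperTail_neg, gaussWeight_neg] at h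
    linarith

/-- For `x ≥ 0`, Mills' inequality bounds `x` times the upper tail, and the lower tail is at most
the total mass. The other sign follows by reflection. -/
theorem abs_mul_tails_le (x : ℝ) :
    |x| * (lowerTail x * upperTail x) ≤ Real.sqrt (2 * Real.pi) * gaussWeight x := by
  have key : ∀ y : ℝ, 0 ≤ y →
      y * (lowerTail y * upperTail y) ≤ Real.sqrt (2 * Real.pi) * gaussWeight y := fun y hy => by
    have h1 := mul_upperTail_le y
    have h2 := lowerTail_nonneg y
    have h3 : lowerTail y ≤ Real.sqrt (2 * Real.pi) := by
      have := lowerTail_add_upperTail y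
      have := upperTail_nonneg y
      linarith
    calc y * (lowerTail y * upperTail y) = lowerTail y * (y * upperTail y) := by ring
      _ ≤ _ := mul_le_mul h3 h1 (mul_nonneg hy (upperTail_nonneg y)) (Real.sqrt_nonneg _)
  rcases le_total 0 x with hx | hx
  · rw [abs_of_nonneg hx]
    exact key x hx
  · rw [abs_of_nonpos hx]
    have h := key (-x) (neg_nonneg.2 hx)
    rw [lowerTail_neg, upperTail_neg, gaussWeight_neg] at h
    linarith

end GaussianTails

/-! ### Solution of the Stein equation -/

section SteinEquation

theorem integral_gaussianReal_zero_one (h : ℝ → ℝ) :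
    ∫ x, h x ∂(gaussianReal 0 1) =
      (∫ x, h x * gaussWeight x) / Real.sqrt (2 * Real.pi) := by
  rw [integral_gaussianReal_eq_integral_smul one_ne_zero, ← integral_div]
  refine integral_congr_ae (Eventually.of_forall fun x => ?_)
  simp only [gaussianPDFReal, gaussWeight, smul_eq_mul, NNReal.coe_one, mul_one, sub_zero]
  ring

/-- Bootstrapping: the equation expresses the derivative of `f` through `f` itself, which gains one
order of regularity at a time. -/
theorem contDiff_of_hasDerivAt_linear {f g : ℝ → ℝ}
    (hf : ∀ x, HasDerivAt f (x * f x + g x) x) (hg : ContDiff ℝ (⊤ : ℕ∞) g) :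
    ContDiff ℝ (⊤ : ℕ∞) f := by
  rw [contDiff_infty]
  intro n
  induction n with
  | zero => exact contDiff_zero.2 (continuous_iff_continuousAt.2 fun x => (hf x).continuousAt)
  | succ n ih =>
    push_cast
    rw [contDiff_succ_iff_deriv]
    refine ⟨fun x => (hf x).differentiableAt, by simp, ?_⟩
    rw [show deriv f = fun x => x * f x + g x from funext fun x => (hf x).deriv]
    exact (contDiff_id.mul ih).add (hg.of_le (by exact_mod_cast le_top))

/-- The Stein equation for the standard normal law, with bounds on the solution. -/
theorem exists_stein_solution {h : ℝ → ℝ} (hs : ContDiff ℝ (⊤ : ℕ∞) h) (h0 : ∀ x, 0 ≤ h x)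
    (h1 : ∀ x, h x ≤ 1) : ∃ f : ℝ → ℝ, ContDiff ℝ (⊤ : ℕ∞) f ∧
      (∀ x, deriv f x - x * f x = h x - ∫ y, h y ∂(gaussianReal 0 1)) ∧
      (∀ x, |f x| ≤ Real.sqrt Real.pi / 2) ∧ ∀ x, |deriv f x| ≤ 2 := by
  set m := ∫ y, h y ∂(gaussianReal 0 1) with hm
  set c := Real.sqrt (2 * Real.pi) with hc
  have hcpos : 0 < c := Real.sqrt_pos.2 (by positivity)
  have hc2 : c ^ 2 = 2 * Real.pi := Real.sq_sqrt (by positivity)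
  have hhb : ∀ x, ‖h x‖ ≤ 1 := fun x => by rw [Real.norm_of_nonneg (h0 x)]; exact h1 x
  have ihw : Integrable fun x => h x * gaussWeight x :=
    integrable_gaussWeight.bdd_mul hs.continuous.aestronglyMeasurable (Eventually.of_forall hhb)
  have hmc : m * c = ∫ x, h x * gaussWeight x := by
    rw [hm, integral_gaussianReal_zero_one, div_mul_cancel₀ _ hcpos.ne']
  set G : ℝ → ℝ := fun x => ∫ t in Set.Iic x, (h t - m) * gaussWeight t with hG
  have iG : Integrable fun t => (h t - m) * gaussWeight t := by
    simp_rw [sub_mul]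
    exact ihw.sub (integrable_gaussWeight.const_mul m)
  have hGd : ∀ x, HasDerivAt G ((h x - m) * gaussWeight x) x :=
    hasDerivAt_integral_Iic ((hs.continuous.sub continuous_const).mul continuous_gaussWeight) iG
  have hm0 : 0 ≤ m := integral_nonneg h0
  have hm1 : m ≤ 1 := by
    have := integral_mono_of_nonneg (μ := gaussianReal 0 1) (Eventually.of_forall h0)
      (integrable_const (1 : ℝ)) (Eventually.of_forall h1)
    simpa using this
  have hGabs : ∀ x, |G x| ≤ lowerTail x * upperTail x / c := by
    intro x
    have e1 : G x = (∫ t in Set.Iic x, h t * gaussWeight t) - m * lowerTail x := by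
      rw [hG, lowerTail, ← integral_const_mul,
        ← integral_sub ihw.integrableOn (integrable_gaussWeight.const_mul m).integrableOn]
      simp_rw [sub_mul]
    have e2 := intervalIntegral.integral_Iic_add_Ioi (b := x) ihw.integrableOn ihw.integrableOn
    rw [← hmc] at e2
    have e3 := lowerTail_add_upperTail x
    set H := ∫ t in Set.Iic x, h t * gaussWeight t with hH
    set H' := ∫ t in Set.Ioi x, h t * gaussWeight t with hH'
    have b1 : 0 ≤ H := integral_nonneg fun t => mul_nonneg (h0 t) (gaussWeight_pos t).le
    have b2 : 0 ≤ H' := integral_nonneg fun t => mul_nonneg (h0 t) (gaussWeight_pos t).le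
    have b3 : H ≤ lowerTail x := integral_mono ihw.integrableOn
      integrable_gaussWeight.integrableOn fun t =>
        mul_le_of_le_one_left (gaussWeight_pos t).le (h1 t)
    have b4 : H' ≤ upperTail x := integral_mono ihw.integrableOn
      integrable_gaussWeight.integrableOn fun t =>
        mul_le_of_le_one_left (gaussWeight_pos t).le (h1 t)
    -- From `m c = H + H'` and `lowerTail + upperTail = c`. Since `0 ≤ H ≤ lowerTail` and `0 ≤ H' ≤
    -- upperTail`, both products lie between `0` and `lowerTail * upperTail`.
    have e4 : G x * c = H * upperTail x - H' * lowerTail x := by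
      rw [e1]
      linear_combination lowerTail x * e2 - H * e3
    have e5 : |G x| * c = |G x * c| := by rw [abs_mul, abs_of_pos hcpos]
    rw [le_div_iff₀ hcpos, e5, e4, abs_le]
    have p1 := lowerTail_nonneg x
    have p2 := upperTail_nonneg x
    have q1 := mul_le_mul_of_nonneg_right b3 p2
    have q2 := mul_le_mul_of_nonneg_right b4 p1
    have q3 := mul_nonneg b1 p2
    have q4 := mul_nonneg b2 p1
    constructor <;> linarith
  -- The integrating factor of `f' - x f` is the Gaussian weight.
  set f : ℝ → ℝ := fun x => G x / gaussWeight x with hf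
  have hfd : ∀ x, HasDerivAt f (x * f x + (h x - m)) x := fun x => by
    have hw := (gaussWeight_pos x).ne'
    refine ((hGd x).div (hasDerivAt_gaussWeight x) hw).congr_deriv ?_
    simp only [hf]
    field_simp
    ring
  have hfabs : ∀ x, |f x| * gaussWeight x ≤ lowerTail x * upperTail x / c := fun x => by
    rw [hf, abs_div, abs_of_pos (gaussWeight_pos x), div_mul_cancel₀ _ (gaussWeight_pos x).ne']
    exact hGabs x
  refine ⟨f, contDiff_of_hasDerivAt_linear hfd (hs.sub contDiff_const), fun x => ?_, fun x => ?_,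
    fun x => ?_⟩
  · rw [(hfd x).deriv]
    ring
  · have k1 := four_mul_tails_le x
    have k2 := hfabs x
    have hw := gaussWeight_pos x
    rw [le_div_iff₀ hcpos] at k2
    have k3 : |f x| * c ≤ c ^ 2 / 4 := by
      refine le_of_mul_le_mul_right ?_ hw
      rw [hc2]
      linarith
    -- The bound `√(2π) / 4` is slightly better than the required `√π / 2`.
    have k4 : |f x| ≤ c / 4 := by
      refine le_of_mul_le_mul_right ?_ hcpos
      linarith
    refine k4.trans ?_
    rw [hc, Real.sqrt_mul (by norm_num)]
    have k5 : Real.sqrt 2 ≤ 2 := by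
      rw [Real.sqrt_le_left (by norm_num)]
      norm_num
    have := mul_le_mul_of_nonneg_right k5 (Real.sqrt_nonneg Real.pi)
    linarith
  · rw [(hfd x).deriv]
    have k1 := abs_mul_tails_le x
    have k2 := mul_le_mul_of_nonneg_left (hfabs x) (abs_nonneg x)
    have hw := gaussWeight_pos x
    have k3 : |x * f x| ≤ 1 := by
      rw [abs_mul]
      refine le_of_mul_le_mul_right ?_ hw
      rw [one_mul, mul_assoc]
      refine k2.trans ?_
      rw [mul_div_assoc', div_le_iff₀ hcpos]
      linarith
    have k4 : |h x - m| ≤ 1 := by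
      rw [abs_le]
      have := h0 x
      have := h1 x
      constructor <;> linarith
    exact (abs_add_le _ _).trans (by linarith)

end SteinEquation

/-! ### Total variation through smooth test functions -/

section TotalVariation

/-- By inner regularity for `μ` and outer regularity for `ν`, a Borel set is replaced by a compact
`C` inside it and an open `U` containing `C`. A smooth function equal to `1` on `C` and to `0` off
`U` bounds `μ C` from above and `ν U` from below. -/
theorem tvDist_le_of_forall_contDiff {μ ν : Measure ℝ} [IsProbabilityMeasure μ]
    [IsProbabilityMeasure ν] {K : ℝ≥0∞}
    (h : ∀ g : ℝ → ℝ, ContDiff ℝ (⊤ : ℕ∞) g → (∀ x, 0 ≤ g x) → (∀ x, g x ≤ 1) →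
      ENNReal.ofReal (∫ x, g x ∂μ - ∫ x, g x ∂ν) ≤ K) : tvDist μ ν ≤ K := by
  refine iSup₂_le fun B hB => ?_
  rw [tsub_le_iff_left]
  refine ENNReal.le_of_forall_pos_le_add fun ε hε _ => ?_
  have hε2 : ((ε / 2 : NNReal) : ℝ≥0∞) ≠ 0 := by
    have : 0 < ε / 2 := by positivity
    exact_mod_cast this.ne'
  obtain ⟨C, hCB, hC, hμC⟩ := hB.exists_isCompact_lt_add (μ := μ) (measure_ne_top _ _) hε2
  obtain ⟨U, hCU, hU, hνU⟩ := hC.exists_isOpen_lt_add (μ := ν) hε2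
  obtain ⟨g, hg0, hg1, hg⟩ := exists_contMDiffMap_zero_one_of_isClosed (n := (⊤ : ℕ∞))
    (modelWithCornersSelf ℝ ℝ) hU.isClosed_compl hC.isClosed
    (Set.disjoint_left.2 fun x hx hx' => hx (hCU hx'))
  have hgs : ContDiff ℝ (⊤ : ℕ∞) g := g.contMDiff.contDiff
  have hgn : ∀ x, ‖g x‖ ≤ 1 := fun x => by
    rw [Real.norm_of_nonneg (hg x).1]
    exact (hg x).2
  have ig : ∀ ρ : Measure ℝ, IsProbabilityMeasure ρ → Integrable g ρ := fun ρ _ =>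
    Integrable.of_bound hgs.continuous.aestronglyMeasurable 1 (Eventually.of_forall hgn)
  have e1 : μ C ≤ ENNReal.ofReal (∫ x, g x ∂μ) := by
    rw [ofReal_integral_eq_lintegral_ofReal (ig μ inferInstance)
      (Eventually.of_forall fun x => (hg x).1), ← lintegral_indicator_one hC.measurableSet]
    refine lintegral_mono fun x => ?_
    by_cases hx : x ∈ C
    · rw [Set.indicator_of_mem hx, hg1 hx]
      simp
    · rw [Set.indicator_of_notMem hx]
      exact zero_le
  have e2 : ENNReal.ofReal (∫ x, g x ∂ν) ≤ ν U := by
    rw [ofReal_integral_eq_lintegral_ofReal (ig ν inferInstance)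
      (Eventually.of_forall fun x => (hg x).1), ← lintegral_indicator_one hU.measurableSet]
    refine lintegral_mono fun x => ?_
    by_cases hx : x ∈ U
    · rw [Set.indicator_of_mem hx]
      simpa using (hg x).2
    · rw [Set.indicator_of_notMem hx, hg0 hx]
      simp
  calc μ B ≤ μ C + (ε / 2 : NNReal) := hμC.le
    _ ≤ ENNReal.ofReal ((∫ x, g x ∂μ - ∫ x, g x ∂ν) + ∫ x, g x ∂ν) + (ε / 2 : NNReal) := by
        rw [sub_add_cancel]
        gcongr
    _ ≤ (K + (ν B + (ε / 2 : NNReal))) + (ε / 2 : NNReal) := by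
        gcongr
        refine ENNReal.ofReal_add_le.trans (add_le_add
          (h g hgs (fun x => (hg x).1) fun x => (hg x).2) ?_)
        refine e2.trans (hνU.le.trans ?_)
        gcongr
    _ = ν B + K + ε := by
        have : (ε : ℝ≥0∞) = (ε / 2 : NNReal) + (ε / 2 : NNReal) := by
          rw [← ENNReal.coe_add, add_halves]
        rw [this]
        ring

theorem tvDist_map_measurableEquiv (e : ℝ ≃ᵐ ℝ) (μ ν : Measure ℝ) :
    tvDist (μ.map e) (ν.map e) = tvDist μ ν := by
  refine le_antisymm (iSup₂_le fun B hB => ?_) (iSup₂_le fun B hB => ?_)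
  · rw [e.map_apply, e.map_apply]
    exact le_iSup₂_of_le (e ⁻¹' B) (e.measurable hB) le_rfl
  · refine le_iSup₂_of_le (e.symm ⁻¹' B) (e.symm.measurable hB) ?_
    rw [e.map_apply, e.map_apply, ← Set.preimage_comp, e.symm_comp_self, Set.preimage_id]

end TotalVariation

/-! ### The univariate total variation bound -/

namespace DiffusiveMarkov

variable {Ω : Type*} [MeasurableSpace Ω] {P : Measure Ω} [IsProbabilityMeasure P]
  (D : DiffusiveMarkov P)

theorem tvDist_map_mul (X : D.domE) {σ : ℝ} (hσ : 0 < σ) :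
    tvDist (P.map (X : Lp ℝ 2 P)) ((gaussianReal 0 1).map (fun x => σ * x))
      = tvDist (P.map fun ω => σ⁻¹ * (X : Lp ℝ 2 P) ω) (gaussianReal 0 1) := by
  have hX : Measurable ((X : Lp ℝ 2 P) : Ω → ℝ) := (Lp.stronglyMeasurable _).measurable
  have h := tvDist_map_measurableEquiv (MeasurableEquiv.mulLeft₀ σ hσ.ne')
    (P.map fun ω => σ⁻¹ * (X : Lp ℝ 2 P) ω) (gaussianReal 0 1)
  rw [← h, Measure.map_map (by fun_prop) (by fun_prop)]
  congr 2
  ext ω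
  simp [hσ.ne']

/-- The Stein equation is evaluated at `x = σ⁻¹ X`. In `x f(x) = σ⁻¹ (L F + Z) f(x)` the `L F` part
integrates by parts to `σ⁻² Γ f'(x)`, leaving `f'(x) σ⁻² (σ² - Γ) - σ⁻¹ f(x) Z`. The bounds `2` on
`f'` and `√π / 2` on `f` give the constants. -/
theorem integral_sub_integral_le (F : D.domL) (X : D.domE) {Z : Ω → ℝ} (hZ : Integrable Z P)
    (h : ((X : Lp ℝ 2 P) : Ω → ℝ) =ᵐ[P] (fun ω => D.L F ω + Z ω)) {σ : ℝ} (hσ : 0 < σ)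
    {g : ℝ → ℝ} (hg : ContDiff ℝ (⊤ : ℕ∞) g) (h0 : ∀ x, 0 ≤ g x) (h1 : ∀ x, g x ≤ 1) :
    ∫ ω, g (σ⁻¹ * (X : Lp ℝ 2 P) ω) ∂P - ∫ x, g x ∂(gaussianReal 0 1) ≤
      2 / σ ^ 2 * ∫ ω, ‖σ ^ 2 - D.Γ X (-(F : D.domE)) ω‖ ∂P +
        Real.sqrt Real.pi / (2 * σ) * ∫ ω, ‖Z ω‖ ∂P := by
  have hX : Measurable ((X : Lp ℝ 2 P) : Ω → ℝ) := (Lp.stronglyMeasurable _).measurable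
  obtain ⟨f, hf, hfe, hfb, hfd⟩ := exists_stein_solution hg h0 h1
  have hfc := hf.continuous
  have hf'c : Continuous (deriv f) := hf.continuous_deriv (by simp)
  set x : Ω → ℝ := fun ω => σ⁻¹ * (X : Lp ℝ 2 P) ω with hx
  have hxm : Measurable x := by fun_prop
  set Γ : Ω → ℝ := fun ω => D.Γ X (-(F : D.domE)) ω with hΓ
  have iΓ : Integrable Γ P := L1.integrable_coeFn _
  have iL : Integrable (D.L F : Ω → ℝ) P := (Lp.memLp (D.L F)).integrable (by norm_num)
  have bf : ∀ u : Ω → ℝ, Integrable u P → Integrable (fun ω => f (x ω) * u ω) P := fun u hu =>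
    hu.bdd_mul (hfc.measurable.comp hxm).aestronglyMeasurable (Eventually.of_forall fun ω => hfb _)
  have bf' : ∀ u : Ω → ℝ, Integrable u P → Integrable (fun ω => deriv f (x ω) * u ω) P :=
    fun u hu => hu.bdd_mul (hf'c.measurable.comp hxm).aestronglyMeasurable
      (Eventually.of_forall fun ω => hfd _)
  -- integration by parts
  have ibp : ∫ ω, f (x ω) * D.L F ω ∂P = ∫ ω, deriv f (x ω) * (σ⁻¹ * Γ ω) ∂P := by
    let pr : (Fin 1 → ℝ) →L[ℝ] ℝ := σ⁻¹ • ContinuousLinearMap.proj 0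
    have hψ : ContDiff ℝ (⊤ : ℕ∞) fun y => f (pr y) := hf.comp pr.contDiff
    -- The chain rule asks for a Lipschitz function; the bound on the derivative of the Stein
    -- solution provides it.
    have hlip : LipschitzWith 2 f := lipschitzWith_of_nnnorm_deriv_le
      (hf.differentiable (by simp)) fun y => by
        rw [← NNReal.coe_le_coe]
        exact hfd y
    have key := D.integral_comp_mul_L (fun _ : Fin 1 => X) F hψ ⟨_, hlip.comp pr.lipschitz⟩
    refine key.trans (integral_congr_ae (Eventually.of_forall fun ω => ?_))
    have hd : HasFDerivAt (fun y => f (pr y)) _ (fun _ : Fin 1 => (X : Lp ℝ 2 P) ω) :=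
      HasDerivAt.comp_hasFDerivAt (fun _ : Fin 1 => (X : Lp ℝ 2 P) ω)
        ((hf.differentiable (by simp)) _).hasDerivAt pr.hasFDerivAt
    simp only [Finset.univ_unique, Finset.sum_singleton]
    rw [hd.fderiv]
    simp [pr, hx, hΓ]
    ring
  have e1 : ∫ ω, g (x ω) ∂P - ∫ y, g y ∂(gaussianReal 0 1) =
      ∫ ω, (deriv f (x ω) * (σ⁻¹ ^ 2 * (σ ^ 2 - Γ ω)) - σ⁻¹ * (f (x ω) * Z ω)) ∂P := by
    have ig : Integrable (fun ω => g (x ω)) P :=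
      Integrable.of_bound (hg.continuous.measurable.comp hxm).aestronglyMeasurable 1
        (Eventually.of_forall fun ω => by
          rw [Real.norm_of_nonneg (h0 _)]
          exact h1 _)
    have e2 : ∫ ω, g (x ω) ∂P - ∫ y, g y ∂(gaussianReal 0 1) =
        ∫ ω, (g (x ω) - ∫ y, g y ∂(gaussianReal 0 1)) ∂P := by
      rw [integral_sub ig (integrable_const _)]
      simp
    -- The second bracket is the defect in the integration by parts, whose integral vanishes.
    have e3 : ∀ᵐ ω ∂P, g (x ω) - ∫ y, g y ∂(gaussianReal 0 1) =
        (deriv f (x ω) * (σ⁻¹ ^ 2 * (σ ^ 2 - Γ ω)) - σ⁻¹ * (f (x ω) * Z ω)) +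
          (σ⁻¹ * (deriv f (x ω) * (σ⁻¹ * Γ ω)) - σ⁻¹ * (f (x ω) * D.L F ω)) := by
      filter_upwards [h] with ω hω
      rw [← hfe]
      have : x ω = σ⁻¹ * (D.L F ω + Z ω) := by
        rw [hx]
        simp only
        rw [hω]
      have h4 : σ⁻¹ ^ 2 * σ ^ 2 = 1 := by field_simp
      have h5 : x ω * f (x ω) = σ⁻¹ * (D.L F ω + Z ω) * f (x ω) := by rw [← this]
      rw [h5]
      linear_combination (-deriv f (x ω)) * h4
    have i1 : Integrable (fun ω => deriv f (x ω) * (σ⁻¹ ^ 2 * (σ ^ 2 - Γ ω)) -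
        σ⁻¹ * (f (x ω) * Z ω)) P :=
      (bf' _ (((integrable_const _).sub iΓ).const_mul _)).sub ((bf Z hZ).const_mul _)
    have i2 : Integrable (fun ω => σ⁻¹ * (deriv f (x ω) * (σ⁻¹ * Γ ω))) P :=
      (bf' _ (iΓ.const_mul _)).const_mul _
    have i3 : Integrable (fun ω => σ⁻¹ * (f (x ω) * D.L F ω)) P := (bf _ iL).const_mul _
    have i4 : Integrable (fun ω => σ⁻¹ * (deriv f (x ω) * (σ⁻¹ * Γ ω)) -
        σ⁻¹ * (f (x ω) * D.L F ω)) P := i2.sub i3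
    rw [e2, integral_congr_ae e3, integral_add i1 i4, integral_sub i2 i3,
      integral_const_mul, integral_const_mul, ibp, sub_self, add_zero]
  have iΓn : Integrable (fun ω => ‖σ ^ 2 - Γ ω‖) P := ((integrable_const _).sub iΓ).norm
  rw [e1, ← integral_const_mul, ← integral_const_mul,
    ← integral_add (iΓn.const_mul _) (hZ.norm.const_mul _)]
  refine integral_mono
    ((bf' _ (((integrable_const _).sub iΓ).const_mul _)).sub ((bf Z hZ).const_mul _))
    ((iΓn.const_mul _).add (hZ.norm.const_mul _)) fun ω => ?_
  refine (le_abs_self _).trans ((abs_sub _ _).trans (add_le_add ?_ ?_))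
  · rw [abs_mul, abs_mul, abs_of_pos (by positivity : 0 < σ⁻¹ ^ 2), Real.norm_eq_abs]
    calc _ ≤ 2 * (σ⁻¹ ^ 2 * |σ ^ 2 - Γ ω|) := by
          gcongr
          exact hfd _
      _ = _ := by
          field_simp
  · rw [abs_mul, abs_mul, abs_of_pos (by positivity : 0 < σ⁻¹), Real.norm_eq_abs]
    calc _ ≤ σ⁻¹ * (Real.sqrt Real.pi / 2 * |Z ω|) := by
          gcongr
          exact hfb _
      _ = _ := by
          field_simp

theorem tvDist_le (F : D.domL) (X : D.domE) {Z : Ω → ℝ} (hZ : MemLp Z 1 P)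
    (h : ((X : Lp ℝ 2 P) : Ω → ℝ) =ᵐ[P] (fun ω => D.L F ω + Z ω)) {σ : ℝ} (hσ : 0 < σ) :
    tvDist (P.map fun ω => σ⁻¹ * (X : Lp ℝ 2 P) ω) (gaussianReal 0 1) ≤
      ENNReal.ofReal (2 / σ ^ 2) * eLpNorm (fun ω => σ ^ 2 - D.Γ X (-(F : D.domE)) ω) 1 P
          + ENNReal.ofReal (Real.sqrt Real.pi / (2 * σ)) * eLpNorm Z 1 P := by
  have hX : Measurable ((X : Lp ℝ 2 P) : Ω → ℝ) := (Lp.stronglyMeasurable _).measurable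
  have hXm : Measurable fun ω => σ⁻¹ * (X : Lp ℝ 2 P) ω := by fun_prop
  have hprob : IsProbabilityMeasure (P.map fun ω => σ⁻¹ * (X : Lp ℝ 2 P) ω) :=
    Measure.isProbabilityMeasure_map hXm.aemeasurable
  have hZi := memLp_one_iff_integrable.1 hZ
  have iΓ : Integrable (fun ω => σ ^ 2 - D.Γ X (-(F : D.domE)) ω) P :=
    (integrable_const _).sub (L1.integrable_coeFn _)
  refine tvDist_le_of_forall_contDiff fun g hg h0 h1 => ?_
  rw [integral_map hXm.aemeasurable hg.continuous.aestronglyMeasurable]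
  refine (ENNReal.ofReal_le_ofReal (D.integral_sub_integral_le F X hZi h hσ hg h0 h1)).trans ?_
  rw [eLpNorm_one_eq_lintegral_enorm, eLpNorm_one_eq_lintegral_enorm,
    ← ofReal_integral_norm_eq_lintegral_enorm iΓ, ← ofReal_integral_norm_eq_lintegral_enorm hZi,
    ← ENNReal.ofReal_mul (by positivity), ← ENNReal.ofReal_mul (by positivity)]
  exact ENNReal.ofReal_add_le

end DiffusiveMarkov

/-! ### The main theorem -/

theorem theorem2p1 {Ω : Type*} [MeasurableSpace Ω] (P : Measure Ω) [IsProbabilityMeasure P]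
    (D : DiffusiveMarkov P) :
    -- the multivariate Wasserstein bounds
    (∀ (d : ℕ) (p : ℝ), 1 ≤ p →
      ∀ (F : Fin d → D.domL) (X : Fin d → D.domE) (Z : Fin d → Ω → ℝ),
      (∀ i, MemLp (Z i) (ENNReal.ofReal p) P) →
      (∀ i, ((X i : Lp ℝ 2 P) : Ω → ℝ) =ᵐ[P] fun ω => D.L (F i) ω + Z i ω) →
      ∀ S : Matrix (Fin d) (Fin d) ℝ, S.PosDef →
      wassersteinDist p
          (P.map fun ω => WithLp.toLp 2 fun i => (X i : Lp ℝ 2 P) ω)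
          ((stdGaussian (EuclideanSpace ℝ (Fin d))).map
            (Matrix.toEuclideanCLM (n := Fin d) (𝕜 := ℝ) S))
        ≤ ENNReal.ofReal (opNorm S)
            * eLpNorm id (ENNReal.ofReal p) (stdGaussian (EuclideanSpace ℝ (Fin d)))
            * eLpNorm (fun ω => hsNorm
                (1 - S⁻¹ * D.gammaMatrix X (fun j => -(F j : D.domE)) ω * S⁻¹))
                (ENNReal.ofReal p) P
          + eLpNorm (fun ω => WithLp.toLp 2 fun i => Z i ω) (ENNReal.ofReal p) P
      ∧ ENNReal.ofReal (opNorm S)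
            * eLpNorm id (ENNReal.ofReal p) (stdGaussian (EuclideanSpace ℝ (Fin d)))
            * eLpNorm (fun ω => hsNorm
                (1 - S⁻¹ * D.gammaMatrix X (fun j => -(F j : D.domE)) ω * S⁻¹))
                (ENNReal.ofReal p) P
          + eLpNorm (fun ω => WithLp.toLp 2 fun i => Z i ω) (ENNReal.ofReal p) P
        ≤ ENNReal.ofReal (opNorm S) * ENNReal.ofReal (opNorm (S ^ 2)⁻¹)
            * eLpNorm id (ENNReal.ofReal p) (stdGaussian (EuclideanSpace ℝ (Fin d)))
            * eLpNorm (fun ω => hsNorm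
                (S ^ 2 - D.gammaMatrix X (fun j => -(F j : D.domE)) ω))
                (ENNReal.ofReal p) P
          + eLpNorm (fun ω => WithLp.toLp 2 fun i => Z i ω) (ENNReal.ofReal p) P) ∧
    -- the univariate total variation bound
    (∀ (F : D.domL) (X : D.domE) (Z : Ω → ℝ), MemLp Z 1 P →
      ((X : Lp ℝ 2 P) : Ω → ℝ) =ᵐ[P] (fun ω => D.L F ω + Z ω) →
      ∀ σ : ℝ, 0 < σ →
      tvDist (P.map (X : Lp ℝ 2 P)) ((gaussianReal 0 1).map (fun x => σ * x))
        = tvDist (P.map fun ω => σ⁻¹ * (X : Lp ℝ 2 P) ω) (gaussianReal 0 1)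
      ∧ tvDist (P.map (X : Lp ℝ 2 P)) ((gaussianReal 0 1).map (fun x => σ * x))
        ≤ ENNReal.ofReal (2 / σ ^ 2) * eLpNorm (fun ω => σ ^ 2 - D.Γ X (-(F : D.domE)) ω) 1 P
          + ENNReal.ofReal (Real.sqrt Real.pi / (2 * σ)) * eLpNorm Z 1 P) := by
  refine ⟨fun d p hp F X Z hZ h S hS => ⟨D.wassersteinDist_le hp F X hZ h hS, ?_⟩,
    fun F X Z hZ h σ hσ => ⟨D.tvDist_map_mul X hσ, ?_⟩⟩
  · refine add_le_add ?_ le_rfl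
    have h1 := D.eLpNorm_hsNorm_conj_le X (fun j => -(F j : D.domE)) hS (ENNReal.ofReal p)
    refine (mul_le_mul_right h1 _).trans_eq ?_
    ring
  · rw [D.tvDist_map_mul X hσ]
    exact D.tvDist_le F X hZ h hσ
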